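/- Let $n \ge 3$, $\lambda > 0$, $\varepsilon > 0$, write $\langle x\rangle = (1+|x|^2)^{1/2}$ and $D = -i\nabla$, and let $A : \mathbb{R}^n \to \mathbb{C}^n$ be continuous with $\langle x\rangle^{1+\varepsilon} A$ bounded. Let $\chi \in C_c^\infty(\mathbb{R}^n)$ with $0 \le \chi \le 1$ and $\int \chi\,dx = 1$, put $\chi_\delta(x) = \delta^{-n}\chi(x/\delta)$, let $0 < \sigma_0 < \sigma < 1/3$, and set $A^\sharp = A * \chi_\delta$ with $\delta = h^{\sigma_0}$. For $0 < h_0 \le 1$, let $S^m_\sigma$ be the set of functions $c(x,\xi;h)$, $x,\xi\in\mathbb{R}^n$, $h \in (0,h_0]$, that are smooth in $(x,\xi)$ and satisfy $|\partial_x^\alpha\partial_\xi^{\beta} c(x,\xi;h)| \le C_{\alpha\beta} h^{-\sigma|\alpha+\beta|}\langle\xi\rangle^m$ for all $\alpha,\beta$, with $C_{\alpha\beta}$ independent of $x,\xi,h$. Put $$\mathrm{Op}_h(c) f(x) = (2\pi)^{-n}\int_{\mathbb{R}^n} e^{ix\cdot\xi} c(x,h\xi;h)\hat f(\xi)\,d\xi,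 \qquad \hat f(\xi) = \int_{\mathbb{R}^n} e^{-ix\cdot\xi} f(x)\,dx.$$ Then there are $\beta > 0$ and $h_0 \in (0,1]$ with $h_0^2\lambda < 1$ such that the following holds for every family $\rho = \rho(h) \in \mathbb{C}^n$, $h \in (0,h_0]$, with $\rho\cdot\rho = \lambda$ and $h = \big(\tfrac12(|\rho|^2+\lambda)\big)^{-1/2}$. With $\hat\rho = h\rho$, $$P = -h^2\Delta + 2\hat\rho\cdot hD, \qquad Q^\sharp = 2A^\sharp\cdot(hD+\hat\rho),$$ there exist $c,\tilde c,s \in S^0_\sigma$ such that $C = \mathrm{Op}_h(c)$, $\tilde C = \mathrm{Op}_h(\tilde c)$, $S = \mathrm{Op}_h(s)$ satisfy $$(P + hQ^\sharp)C = \tilde C P + h^{1+\beta}\langle x\rangle^{-1} S$$ on the Schwartz space $\mathscr{S}(\mathbb{R}^n)$ for all $h \in (0,h_0]$. Moreover $C$ and $\tilde C$ are elliptic: there is $\kappa > 0$ with $|c(x,\xi;h)| \ge \kappa$ and $|\tilde c(x,\xi;h)| \ge \kappa$ for all $x,\xi\in\mathbb{R}^n$ and $h\in(0,h_0]$; in particular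 $c$ and $\tilde c$ do not vanish. -/

import Mathlib

open MeasureTheory
open scoped ContDiff SchwartzMap

namespace SemiclassicalConjugation

noncomputable section

/-- The Japanese bracket `⟨x⟩ = (1 + |x|²)^{1/2}`. -/
def bracket {n : ℕ} (x : EuclideanSpace ℝ (Fin n)) : ℝ :=
  (1 + ‖x‖ ^ 2) ^ (1 / 2 : ℝ)

/-- The semiclassical symbol class `S^m_σ`: functions `c(x, ξ; h)`, with `h ∈ (0, h₀]`, that are
smooth in `(x, ξ)` and whose derivatives of total order `k` in `(x, ξ)` are bounded by
`C_k h^{-σ k} ⟨ξ⟩^m`, with `C_k` independent of `x`, `ξ` and `h`. (The bound depends on the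
multi-indices `α`, `β` of `∂_x^α ∂_ξ^β` only through `k = |α + β|`, so all the partial derivatives
of total order `k` are bounded at once through the `k`-th Fréchet derivative in `(x, ξ)`.) -/
def IsSymbol {n : ℕ} (h₀ m σ : ℝ)
    (c : ℝ → EuclideanSpace ℝ (Fin n) → EuclideanSpace ℝ (Fin n) → ℂ) : Prop :=
  (∀ h ∈ Set.Ioc 0 h₀, ContDiff ℝ ∞ (Function.uncurry (c h))) ∧
    ∀ k : ℕ, ∃ K : ℝ, ∀ h ∈ Set.Ioc 0 h₀, ∀ x ξ : EuclideanSpace ℝ (Fin n),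
      ‖iteratedFDeriv ℝ k (Function.uncurry (c h)) (x, ξ)‖ ≤
        K * h ^ (-σ * (k : ℝ)) * bracket ξ ^ m

/-- The Fourier transform `f̂(ξ) = ∫ e^{-i x·ξ} f(x) dx`. -/
def fourierT {n : ℕ} (f : EuclideanSpace ℝ (Fin n) → ℂ) (ξ : EuclideanSpace ℝ (Fin n)) : ℂ :=
  ∫ x : EuclideanSpace ℝ (Fin n), Complex.exp (-(Complex.I * ((inner ℝ x ξ : ℝ) : ℂ))) * f x

/-- The standard quantization at a fixed value of `h`; here `a(x, ξ) = c(x, ξ; h)`: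
`Op_h(c) f(x) = (2π)^{-n} ∫ e^{i x·ξ} c(x, hξ; h) f̂(ξ) dξ`. -/
def Op {n : ℕ} (h : ℝ) (a : EuclideanSpace ℝ (Fin n) → EuclideanSpace ℝ (Fin n) → ℂ)
    (f : EuclideanSpace ℝ (Fin n) → ℂ) (x : EuclideanSpace ℝ (Fin n)) : ℂ :=
  ((2 * (Real.pi : ℂ)) ^ n)⁻¹ *
    ∫ ξ : EuclideanSpace ℝ (Fin n),
      Complex.exp (Complex.I * ((inner ℝ x ξ : ℝ) : ℂ)) * a x (h • ξ) * fourierT f ξ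

/-- `D_j = -i ∂/∂x_j`. -/
def D {n : ℕ} (j : Fin n) (u : EuclideanSpace ℝ (Fin n) → ℂ) (x : EuclideanSpace ℝ (Fin n)) : ℂ :=
  -Complex.I * fderiv ℝ u x (EuclideanSpace.single j 1)

/-- `P = -h² Δ + 2 ρ̂ · hD` with `ρ̂ = hρ`. -/
def opP {n : ℕ} (h : ℝ) (ρ : EuclideanSpace ℂ (Fin n)) (u : EuclideanSpace ℝ (Fin n) → ℂ)
    (x : EuclideanSpace ℝ (Fin n)) : ℂ :=
  -(h : ℂ) ^ 2 * Laplacian.laplacian u x +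
    2 * ∑ j : Fin n, ((h : ℂ) * ρ j) * ((h : ℂ) * D j u x)

/-- `Q = 2 A · (hD + ρ̂)` with `ρ̂ = hρ`, for a vector field `A` with complex components. -/
def opQ {n : ℕ} (h : ℝ) (ρ : EuclideanSpace ℂ (Fin n))
    (A : EuclideanSpace ℝ (Fin n) → EuclideanSpace ℂ (Fin n))
    (u : EuclideanSpace ℝ (Fin n) → ℂ) (x : EuclideanSpace ℝ (Fin n)) : ℂ :=
  2 * ∑ j : Fin n, A x j * ((h : ℂ) * D j u x + ((h : ℂ) * ρ j) * u x)

/-- The rescaled mollifier `χ_δ(x) = δ^{-n} χ(x / δ)`. -/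
def mollifier {n : ℕ} (χ : EuclideanSpace ℝ (Fin n) → ℝ) (δ : ℝ)
    (x : EuclideanSpace ℝ (Fin n)) : ℝ :=
  (δ ^ n)⁻¹ * χ (δ⁻¹ • x)

/-- The smooth approximation `A^♯ = A * χ_δ` with `δ = h^{σ₀}`. -/
def sharp {n : ℕ} (χ : EuclideanSpace ℝ (Fin n) → ℝ) (σ₀ h : ℝ)
    (A : EuclideanSpace ℝ (Fin n) → EuclideanSpace ℂ (Fin n)) :
    EuclideanSpace ℝ (Fin n) → EuclideanSpace ℂ (Fin n) :=
  convolution (mollifier χ (h ^ σ₀)) A (ContinuousLinearMap.lsmul ℝ ℝ) volume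

/-- `ρ ∈ ℂⁿ` satisfies `ρ · ρ = λ` (bilinear product, no conjugation), and `h` is the
semiclassical parameter `h = ((|ρ|² + λ) / 2)^{-1/2}` that belongs to it. -/
def IsFrequency {n : ℕ} (lam h : ℝ) (ρ : EuclideanSpace ℂ (Fin n)) : Prop :=
  ∑ j : Fin n, ρ j * ρ j = (lam : ℂ) ∧ h = ((‖ρ‖ ^ 2 + lam) / 2) ^ (-(1 / 2) : ℝ)

/-- Ellipticity of a symbol of order `0` on `(0, h₀]`: `|c(x, ξ; h)| ≥ κ` for some `κ > 0`
independent of `x`, `ξ` and `h`. -/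
def IsEllipticSymbol {n : ℕ} (h₀ : ℝ)
    (c : ℝ → EuclideanSpace ℝ (Fin n) → EuclideanSpace ℝ (Fin n) → ℂ) : Prop :=
  ∃ κ : ℝ, 0 < κ ∧ ∀ h ∈ Set.Ioc 0 h₀, ∀ x ξ : EuclideanSpace ℝ (Fin n), κ ≤ ‖c h x ξ‖

end

end SemiclassicalConjugation

/-!
The operators `P` and `Q` are differential operators, so the full symbol of `(P + hQ) Op_h(e^Φ)` is
computed exactly by applying `P + hQ` to `e^{ix·ξ} e^{Φ(x, hξ)}` and integrating over `ξ`
(`conjugation_of_symbol_identity`). No symbolic calculus with asymptotic expansions is needed: with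
`p(ξ) = |ξ|² + 2 ρ̂·ξ`, the symbol is `e^Φ` times

  `p + 2h (ξ + ρ̂)·(A^♯ - i ∇_x Φ) - h² (Δ_x Φ + (∇_x Φ)² + 2i A^♯·∇_x Φ)`.

Near the set `p = 0` the phase has to cancel the term of order `h`, which means solving the
transport equation `(ξ + ρ̂)·∇_x Ψ_j = A^♯_j`. There `|ξ + Re ρ̂|` and `|Im ρ̂|` are close to `1` and
the two vectors are almost orthogonal (`nearlyOrthonormal_of_normSq_charSymbol_le`), so that the
equation is a Cauchy–Riemann equation in the plane through `x` that they span. It is solved by the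
Cauchy transform in that plane, written in polar coordinates and cut off at radius `R = h^{-τ}`,
`τ = σ - σ₀` (`cauchyRiemann_planeTransform`). In these coordinates the kernel is bounded, the
integral splits into integrals over rays, and the decay `⟨x⟩^{-1-ε}` makes it bounded uniformly.
Each derivative in `(x, ξ)` falls on `A^♯`, which costs `h^{-σ₀}`, and moves points at distance `r`
by a multiple of `1 + r`, which costs a factor `R = h^{-τ}`; the class `S_σ`, `σ = σ₀ + τ`, comes from
here (`symbolBound_planeTransform`). The cutoff leaves an error that is an average over
`R ≤ r ≤ 2R`; it is `O(R^{-ε/8})` even after multiplication by `⟨x⟩`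
(`exists_bracket_mul_tail_le`).

Away from the set `p = 0` the term of order `h` is divisible by `p`, and the quotient goes into
`c̃`. With a cutoff `m(ξ)` between the two regions and `Φ = -i m (ξ + ρ̂)·Ψ`, the symbol becomes
`c̃ p` plus a remainder (`symbol_splitting`). In the remainder the transport error gains
`h^{τε/8}`, and the terms of order `h²` lose `h^{-2σ}` from two derivatives and `h^{-τ}` from the
weight `⟨x⟩`, which `σ < 1/3` makes good (`symbolBound_remainderFactor`). Ellipticity of `c = e^Φ`
holds because `Φ` is bounded; `c̃ / c` is close to `1` once `h₀` is small, and the bound that is used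
for this is uniform in the frequency (`norm_parametrix_mul_sum_le`).
-/

/-! ### Families with semiclassical derivative bounds -/

namespace SemiclassicalConjugation

section SymbolBound

variable {E F G : Type*} [NormedAddCommGroup E] [NormedSpace ℝ E] [NormedAddCommGroup F]
  [NormedSpace ℝ F] [NormedAddCommGroup G] [NormedSpace ℝ G]

/-- The family `u h`, `h ∈ (0, h₀]`, is smooth, and each of its `k`-th derivatives is bounded by
`K_k h^{-σ k} w(h, z)` with `K_k` independent of `h` and `z`. The weight `w` is an arbitrary
function; it may vanish, so that it also records the support of the family. -/
def SymbolBound (h₀ σ : ℝ) (w : ℝ → E → ℝ) (u : ℝ → E → F) : Prop :=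
  (∀ h ∈ Set.Ioc 0 h₀, ContDiff ℝ ∞ (u h)) ∧
    ∀ k : ℕ, ∃ K : ℝ, 0 ≤ K ∧ ∀ h ∈ Set.Ioc 0 h₀, ∀ z : E,
      ‖iteratedFDeriv ℝ k (u h) z‖ ≤ K * (h ^ (-σ)) ^ k * w h z

namespace SymbolBound

variable {h₀ σ : ℝ} {w w₁ w₂ : ℝ → E → ℝ} {u u₁ u₂ : ℝ → E → F}

theorem norm_le (hu : SymbolBound h₀ σ w u) :
    ∃ K : ℝ, 0 ≤ K ∧ ∀ h ∈ Set.Ioc 0 h₀, ∀ z : E, ‖u h z‖ ≤ K * w h z := by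
  obtain ⟨K, hK, H⟩ := hu.2 0
  exact ⟨K, hK, fun h hh z => by simpa using H h hh z⟩

theorem weight_mono (hu : SymbolBound h₀ σ w₁ u) (C : ℝ) (hC : 0 ≤ C)
    (hw : ∀ h ∈ Set.Ioc 0 h₀, ∀ z, w₁ h z ≤ C * w₂ h z) : SymbolBound h₀ σ w₂ u := by
  refine ⟨hu.1, fun k => ?_⟩
  obtain ⟨K, hK, H⟩ := hu.2 k
  refine ⟨K * C, mul_nonneg hK hC, fun h hh z => (H h hh z).trans ?_⟩
  have hp : 0 ≤ (h ^ (-σ)) ^ k := pow_nonneg (Real.rpow_nonneg hh.1.le _) _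
  calc K * (h ^ (-σ)) ^ k * w₁ h z ≤ K * (h ^ (-σ)) ^ k * (C * w₂ h z) := by
        gcongr; exact hw h hh z
    _ = K * C * (h ^ (-σ)) ^ k * w₂ h z := by ring

theorem congr (hu : SymbolBound h₀ σ w u₁) (h12 : ∀ h ∈ Set.Ioc 0 h₀, u₂ h = u₁ h) :
    SymbolBound h₀ σ w u₂ :=
  ⟨fun h hh => h12 h hh ▸ hu.1 h hh, fun k => (hu.2 k).imp fun _ H =>
    ⟨H.1, fun h hh z => h12 h hh ▸ H.2 h hh z⟩⟩

theorem add (hu₁ : SymbolBound h₀ σ w u₁) (hu₂ : SymbolBound h₀ σ w u₂) :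
    SymbolBound h₀ σ w (fun h z => u₁ h z + u₂ h z) := by
  refine ⟨fun h hh => (hu₁.1 h hh).add (hu₂.1 h hh), fun k => ?_⟩
  obtain ⟨K₁, hK₁, H₁⟩ := hu₁.2 k
  obtain ⟨K₂, hK₂, H₂⟩ := hu₂.2 k
  refine ⟨K₁ + K₂, by positivity, fun h hh z => ?_⟩
  have e : iteratedFDeriv ℝ k (fun z => u₁ h z + u₂ h z) z
      = iteratedFDeriv ℝ k (u₁ h) z + iteratedFDeriv ℝ k (u₂ h) z :=
    fun_iteratedFDeriv_add_apply ((hu₁.1 h hh).contDiffAt.of_le (mod_cast le_top))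
      ((hu₂.1 h hh).contDiffAt.of_le (mod_cast le_top))
  rw [e]
  refine (norm_add_le _ _).trans ((add_le_add (H₁ h hh z) (H₂ h hh z)).trans (le_of_eq ?_))
  ring

theorem clm_comp (L : F →L[ℝ] G) (hu : SymbolBound h₀ σ w u) :
    SymbolBound h₀ σ w (fun h z => L (u h z)) := by
  refine ⟨fun h hh => L.contDiff.comp (hu.1 h hh), fun k => ?_⟩
  obtain ⟨K, hK, H⟩ := hu.2 k
  refine ⟨‖L‖ * K, by positivity, fun h hh z => ?_⟩
  have := L.norm_iteratedFDeriv_comp_left (x := z) (f := u h) (n := k) (N := ∞)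
    (hu.1 h hh).contDiffAt (mod_cast le_top)
  refine this.trans ((mul_le_mul_of_nonneg_left (H h hh z) (norm_nonneg _)).trans (le_of_eq ?_))
  ring

theorem const {a : ℝ → F} (hw : ∀ h ∈ Set.Ioc 0 h₀, ∀ z, ‖a h‖ ≤ w h z) :
    SymbolBound h₀ σ w (fun h _ => a h) := by
  refine ⟨fun h _ => contDiff_const, fun k => ⟨1, zero_le_one, fun h hh z => ?_⟩⟩
  have hp : 0 ≤ (h ^ (-σ)) ^ k := pow_nonneg (Real.rpow_nonneg hh.1.le _) _
  have h0 : 0 ≤ w h z := (norm_nonneg _).trans (hw h hh z)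
  rcases Nat.eq_zero_or_pos k with rfl | hk
  · simpa using hw h hh z
  · rw [iteratedFDeriv_const_of_ne hk.ne']
    simp only [Pi.zero_apply, norm_zero]
    positivity

theorem sum {ι : Type*} (s : Finset ι) {v : ι → ℝ → E → F}
    (hw : ∀ h ∈ Set.Ioc 0 h₀, ∀ z, 0 ≤ w h z) (hv : ∀ i ∈ s, SymbolBound h₀ σ w (v i)) :
    SymbolBound h₀ σ w (fun h z => ∑ i ∈ s, v i h z) := by
  classical
  induction s using Finset.induction_on with
  | empty => simpa using const (a := fun _ => (0 : F)) (by simpa using hw)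
  | insert i s hi ih =>
    refine ((hv i (by simp)).add (ih fun j hj => hv j (by simp [hj]))).congr fun h _ => ?_
    funext z
    rw [Finset.sum_insert hi]

theorem mul {A : Type*} [NormedRing A] [NormedAlgebra ℝ A] {a b : ℝ → E → A}
    (ha : SymbolBound h₀ σ w₁ a) (hb : SymbolBound h₀ σ w₂ b) :
    SymbolBound h₀ σ (fun h z => w₁ h z * w₂ h z) (fun h z => a h z * b h z) := by
  refine ⟨fun h hh => (ha.1 h hh).mul (hb.1 h hh), fun k => ?_⟩
  choose K₁ hK₁ H₁ using ha.2
  choose K₂ hK₂ H₂ using hb.2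
  refine ⟨∑ i ∈ Finset.range (k + 1), (k.choose i : ℝ) * K₁ i * K₂ (k - i),
    Finset.sum_nonneg fun i _ => mul_nonneg (mul_nonneg (Nat.cast_nonneg _) (hK₁ i)) (hK₂ _),
    fun h hh z => ?_⟩
  refine (norm_iteratedFDeriv_mul_le (ha.1 h hh) (hb.1 h hh) z (n := k) (mod_cast le_top)).trans ?_
  rw [Finset.sum_mul, Finset.sum_mul]
  refine Finset.sum_le_sum fun i hi => ?_
  have hik : i + (k - i) = k := by
    have := Finset.mem_range.1 hi; omega
  calc (k.choose i : ℝ) * ‖iteratedFDeriv ℝ i (a h) z‖ * ‖iteratedFDeriv ℝ (k - i) (b h) z‖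
      ≤ (k.choose i : ℝ) * (K₁ i * (h ^ (-σ)) ^ i * w₁ h z)
          * (K₂ (k - i) * (h ^ (-σ)) ^ (k - i) * w₂ h z) := by
        exact mul_le_mul (mul_le_mul_of_nonneg_left (H₁ i h hh z) (Nat.cast_nonneg _))
          (H₂ _ h hh z) (norm_nonneg _)
          (mul_nonneg (Nat.cast_nonneg _) ((norm_nonneg _).trans (H₁ i h hh z)))
    _ = _ := by
        rw [← hik, pow_add, hik]; ring

/-- Differentiation in a fixed direction costs a factor `h^{-σ}`. -/
theorem fderiv_apply (hu : SymbolBound h₀ σ w u) (e : E) :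
    SymbolBound h₀ σ (fun h z => h ^ (-σ) * w h z) (fun h z => fderiv ℝ (u h) z e) := by
  have hd : SymbolBound h₀ σ (fun h z => h ^ (-σ) * w h z) (fun h z => fderiv ℝ (u h) z) := by
    refine ⟨fun h hh => (hu.1 h hh).fderiv_right (mod_cast le_top), fun k => ?_⟩
    obtain ⟨K, hK, H⟩ := hu.2 (k + 1)
    refine ⟨K, hK, fun h hh z => ?_⟩
    rw [norm_iteratedFDeriv_fderiv]
    refine (H h hh z).trans (le_of_eq ?_)
    rw [pow_succ]; ring
  exact clm_comp (ContinuousLinearMap.apply ℝ F e) hd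

/-- A continuous linear map satisfies symbol bounds for every weight that dominates it and its
norm. -/
theorem clm (L : E →L[ℝ] F) (hh₀ : h₀ ≤ 1) (hσ : 0 ≤ σ) (hw1 : ∀ h ∈ Set.Ioc 0 h₀, ∀ z, 1 ≤ w h z)
    (hw : ∀ h ∈ Set.Ioc 0 h₀, ∀ z, ‖L z‖ ≤ w h z) : SymbolBound h₀ σ w (fun _ z => L z) := by
  refine ⟨fun h _ => L.contDiff, fun k => ⟨max 1 ‖L‖, by positivity, fun h hh z => ?_⟩⟩
  have h1 : 1 ≤ h ^ (-σ) := Real.one_le_rpow_of_pos_of_le_one_of_nonpos hh.1 (hh.2.trans hh₀)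
    (by linarith)
  have hw0 : 0 ≤ w h z := zero_le_one.trans (hw1 h hh z)
  match k with
  | 0 =>
    simp only [norm_iteratedFDeriv_zero, pow_zero, mul_one]
    exact (hw h hh z).trans (le_mul_of_one_le_left hw0 (le_max_left _ _))
  | 1 =>
    rw [norm_iteratedFDeriv_one, L.fderiv, pow_one]
    calc ‖L‖ = ‖L‖ * 1 * 1 := by ring
      _ ≤ max 1 ‖L‖ * h ^ (-σ) * w h z := by
        gcongr
        · exact le_max_right _ _
        · exact hw1 h hh z
  | k + 2 =>
    have : iteratedFDeriv ℝ (k + 2) (fun z => L z) z = 0 := by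
      rw [iteratedFDeriv_succ_eq_comp_right]
      simp only [Function.comp_apply, ContinuousLinearMap.fderiv]
      rw [iteratedFDeriv_const_of_ne (by omega)]
      exact (continuousMultilinearCurryRightEquiv' ℝ (k + 1) E F).symm.toLinearEquiv.map_zero
    rw [this, norm_zero]
    positivity

/-- Composition with a fixed smooth function. Derivative bounds of the inner family are only
needed where the weight of the outer function does not vanish. -/
theorem comp {g : F → G} (hg : ContDiff ℝ ∞ g) (hu : ∀ h ∈ Set.Ioc 0 h₀, ContDiff ℝ ∞ (u h))
    (hw : ∀ h ∈ Set.Ioc 0 h₀, ∀ z, 0 ≤ w h z)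
    (hgw : ∀ k : ℕ, ∃ C : ℝ, ∀ h ∈ Set.Ioc 0 h₀, ∀ z,
      ‖iteratedFDeriv ℝ k g (u h z)‖ ≤ C * w h z)
    (huw : ∀ k : ℕ, ∃ K : ℝ, ∀ h ∈ Set.Ioc 0 h₀, ∀ z, w h z ≠ 0 →
      ‖iteratedFDeriv ℝ k (u h) z‖ ≤ K * (h ^ (-σ)) ^ k) :
    SymbolBound h₀ σ w (fun h z => g (u h z)) := by
  refine ⟨fun h hh => hg.comp (hu h hh), fun k => ?_⟩
  choose C hC using hgw
  choose K hK using huw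
  have hle : ∀ (f : ℕ → ℝ) (i : ℕ), i ≤ k → f i ≤ 1 + ∑ j ∈ Finset.range (k + 1), |f j| := by
    intro f i hi
    have := Finset.single_le_sum (f := fun j => |f j|) (fun j _ => abs_nonneg _)
      (Finset.mem_range.2 (Nat.lt_succ_of_le hi))
    linarith [le_abs_self (f i)]
  have hpos : ∀ f : ℕ → ℝ, 1 ≤ 1 + ∑ j ∈ Finset.range (k + 1), |f j| := fun f => by
    linarith [Finset.sum_nonneg (s := Finset.range (k + 1)) (fun j _ => abs_nonneg (f j))]
  set C' := 1 + ∑ j ∈ Finset.range (k + 1), |C j|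
  set K' := 1 + ∑ j ∈ Finset.range (k + 1), |K j|
  have hC1 : 1 ≤ C' := hpos C
  have hK1 : 1 ≤ K' := hpos K
  refine ⟨k.factorial * C' * K' ^ k, by positivity, fun h hh z => ?_⟩
  have hp : 0 ≤ h ^ (-σ) := Real.rpow_nonneg hh.1.le _
  by_cases hwz : w h z = 0
  · -- all derivatives of the outer function vanish at this point
    have := norm_iteratedFDeriv_comp_le (n := k) hg (hu h hh) (mod_cast le_top) z (C := 0)
      (D := 1 + ∑ j ∈ Finset.range (k + 1), ‖iteratedFDeriv ℝ j (u h) z‖)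
      (fun i _ => by simpa [hwz] using hC i h hh z) (fun i hi hik => by
        have h1 := hle (fun j => ‖iteratedFDeriv ℝ j (u h) z‖) i hik
        have h2 := hpos (fun j => ‖iteratedFDeriv ℝ j (u h) z‖)
        simp only [abs_norm] at h1 h2
        exact h1.trans (le_self_pow₀ h2 (by omega)))
    rw [hwz, mul_zero]
    exact this.trans (by simp)
  · have := norm_iteratedFDeriv_comp_le (n := k) hg (hu h hh) (mod_cast le_top) z
      (C := C' * w h z) (D := K' * h ^ (-σ)) (fun i hi => (hC i h hh z).trans (by
        gcongr
        · exact hw h hh z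
        · exact hle C i hi)) (fun i hi hik => (hK i h hh z hwz).trans (by
        rw [mul_pow]
        gcongr
        exact (hle K i hik).trans (le_self_pow₀ hK1 (by omega))))
    refine this.trans (le_of_eq ?_)
    rw [mul_pow]; ring

/-- Composition with a fixed smooth function along a bounded family. -/
theorem comp_of_bounded [ProperSpace F] {g : F → G} (hg : ContDiff ℝ ∞ g)
    (hu : SymbolBound h₀ σ (fun _ _ => 1) u) :
    SymbolBound h₀ σ (fun _ _ => 1) (fun h z => g (u h z)) := by
  obtain ⟨M, -, hM⟩ := hu.norm_le
  refine comp hg hu.1 (fun _ _ _ => zero_le_one) (fun k => ?_) (fun k => ?_)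
  · obtain ⟨C, hC⟩ := (isCompact_closedBall (0 : F) M).exists_bound_of_continuousOn
      (hg.continuous_iteratedFDeriv (m := k) (mod_cast le_top)).continuousOn
    exact ⟨C, fun h hh z => by
      simpa using hC (u h z) (by simpa using hM h hh z)⟩
  · obtain ⟨K, -, H⟩ := hu.2 k
    exact ⟨K, fun h hh z _ => by simpa using H h hh z⟩

/-- Real powers of a positive family whose derivatives are controlled by the family itself. At
each point the family is normalised to take the value `1` there, and the derivatives of
`t ↦ t ^ s` at `t = 1` are fixed numbers. -/
theorem rpow {v : ℝ → E → ℝ} (hv : SymbolBound h₀ σ v v)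
    (hpos : ∀ h ∈ Set.Ioc 0 h₀, ∀ z, 0 < v h z) (s : ℝ) :
    SymbolBound h₀ σ (fun h z => v h z ^ s) (fun h z => v h z ^ s) := by
  have hsm : ∀ h ∈ Set.Ioc 0 h₀, ContDiff ℝ ∞ (fun z => v h z ^ s) := fun h hh =>
    (hv.1 h hh).rpow_const_of_ne fun z => (hpos h hh z).ne'
  refine ⟨hsm, fun k => ?_⟩
  choose K hK0 hK using hv.2
  set K' := 1 + ∑ j ∈ Finset.range (k + 1), K j
  have hK1 : 1 ≤ K' := by
    have := Finset.sum_nonneg (s := Finset.range (k + 1)) (fun j _ => hK0 j)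
    simp only [K']; linarith
  have hKle : ∀ i ≤ k, K i ≤ K' := fun i hi => by
    have := Finset.single_le_sum (f := K) (fun j _ => hK0 j)
      (Finset.mem_range.2 (Nat.lt_succ_of_le hi))
    simp only [K']; linarith
  set g : ℝ → ℝ := fun t => t ^ s
  have hg : ContDiffOn ℝ ∞ g (Set.Ioi 0) := fun t ht =>
    (Real.contDiffAt_rpow_const_of_ne (ne_of_gt ht)).contDiffWithinAt
  set C' := ∑ j ∈ Finset.range (k + 1), ‖iteratedFDerivWithin ℝ j g (Set.Ioi 0) 1‖
  refine ⟨k.factorial * C' * K' ^ k, by positivity, fun h hh z => ?_⟩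
  have hp : 0 ≤ h ^ (-σ) := Real.rpow_nonneg hh.1.le _
  set T := v h z
  have hT : 0 < T := hpos h hh z
  have hf : ContDiff ℝ ∞ (fun y => T⁻¹ • v h y) := by
    exact (hv.1 h hh).const_smul T⁻¹
  have key := norm_iteratedFDeriv_comp_le' (n := k) (t := Set.Ioi 0) (g := g)
    (f := fun y => T⁻¹ • v h y) (N := ∞) (by
      rintro _ ⟨y, rfl⟩
      have := hpos h hh y
      simp only [smul_eq_mul, Set.mem_Ioi]
      positivity) (uniqueDiffOn_Ioi _) hg hf (mod_cast le_top) z (C := C') (D := K' * h ^ (-σ))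
    (fun i hi => by
      have e1 : T⁻¹ • v h z = 1 := inv_mul_cancel₀ hT.ne'
      rw [e1]
      exact Finset.single_le_sum (f := fun j => ‖iteratedFDerivWithin ℝ j g (Set.Ioi 0) 1‖)
        (fun j _ => norm_nonneg _) (Finset.mem_range.2 (Nat.lt_succ_of_le hi)))
    (fun i hi hik => by
      have e2 : iteratedFDeriv ℝ i (fun y => T⁻¹ • v h y) z = T⁻¹ • iteratedFDeriv ℝ i (v h) z :=
        iteratedFDeriv_const_smul_apply' ((hv.1 h hh).of_le (mod_cast le_top)).contDiffAt
      rw [e2, norm_smul, Real.norm_of_nonneg (by positivity), mul_pow]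
      calc T⁻¹ * ‖iteratedFDeriv ℝ i (v h) z‖ ≤ T⁻¹ * (K i * (h ^ (-σ)) ^ i * T) := by
            gcongr; exact hK i h hh z
        _ = K i * (h ^ (-σ)) ^ i := by field_simp
        _ ≤ K' ^ i * (h ^ (-σ)) ^ i := by
            gcongr
            exact (hKle i hik).trans (le_self_pow₀ hK1 (by omega)))
  have e3 : (fun y => v h y ^ s) = fun y => T ^ s • (g ∘ fun y => T⁻¹ • v h y) y := by
    funext y
    simp only [g, Function.comp_apply, smul_eq_mul]
    rw [Real.mul_rpow (by positivity) (hpos h hh y).le, Real.inv_rpow hT.le, ← mul_assoc,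
      mul_inv_cancel₀ (by positivity), one_mul]
  have hgf : ContDiff ℝ ∞ (g ∘ fun y => T⁻¹ • v h y) := by
    refine hf.rpow_const_of_ne fun y => ?_
    have := hpos h hh y
    simp only [smul_eq_mul]
    positivity
  have e4 : iteratedFDeriv ℝ k (fun y => v h y ^ s) z
      = T ^ s • iteratedFDeriv ℝ k (g ∘ fun y => T⁻¹ • v h y) z := by
    rw [e3]
    exact iteratedFDeriv_const_smul_apply' (hgf.of_le (mod_cast le_top)).contDiffAt
  rw [e4, norm_smul, Real.norm_of_nonneg (by positivity)]
  refine (mul_le_mul_of_nonneg_left key (by positivity)).trans (le_of_eq ?_)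
  rw [mul_pow]; ring

end SymbolBound

end SymbolBound

end SemiclassicalConjugation

/-! ### Smoothness of parametric integrals -/

namespace SemiclassicalConjugation

section ParametricIntegral

variable {E F G : Type*} [NormedAddCommGroup E] [NormedSpace ℝ E] [NormedAddCommGroup F]
  [NormedSpace ℝ F] [NormedAddCommGroup G] [NormedSpace ℝ G]

open Topology in
/-- Differentiation under the integral sign to all orders, with locally uniform domination. -/
theorem contDiff_integral_of_dominated {Y : Type*} [MeasurableSpace Y] {μ : Measure Y}
    {f : E → Y → F} (hf : ∀ y, ContDiff ℝ ∞ (fun x => f x y))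
    (hm : ∀ (k : ℕ) (x : E),
      AEStronglyMeasurable (fun y => iteratedFDeriv ℝ k (fun x => f x y) x) μ)
    (hb : ∀ (k : ℕ) (x₀ : E), ∃ s ∈ 𝓝 x₀, ∃ bound : Y → ℝ, Integrable bound μ ∧
      ∀ᵐ y ∂μ, ∀ x ∈ s, ‖iteratedFDeriv ℝ k (fun x => f x y) x‖ ≤ bound y) :
    ContDiff ℝ ∞ (fun x => ∫ y, f x y ∂μ) ∧
      ∀ (k : ℕ) (x : E), iteratedFDeriv ℝ k (fun x => ∫ y, f x y ∂μ) x
        = ∫ y, iteratedFDeriv ℝ k (fun x => f x y) x ∂μ := by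
  have key : ∀ (k : ℕ) (x : E), HasFDerivAt
      (fun x => ∫ y, iteratedFDeriv ℝ k (fun x => f x y) x ∂μ)
      (∫ y, fderiv ℝ (iteratedFDeriv ℝ k (fun x => f x y)) x ∂μ) x := by
    intro k x
    obtain ⟨s, hs, bound, hbi, hbd⟩ := hb (k + 1) x
    refine hasFDerivAt_integral_of_dominated_of_fderiv_le (𝕜 := ℝ) (bound := bound)
      (F' := fun x y => fderiv ℝ (iteratedFDeriv ℝ k (fun x => f x y)) x) hs
      (Filter.Eventually.of_forall fun x => hm k x) ?_ ?_ ?_ hbi ?_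
    · obtain ⟨s', hs', bound', hbi', hbd'⟩ := hb k x
      exact hbi'.mono' (hm k x) (hbd'.mono fun y hy => hy x (mem_of_mem_nhds hs'))
    · simp_rw [fderiv_iteratedFDeriv]
      exact (LinearIsometryEquiv.continuous _).comp_aestronglyMeasurable (hm (k + 1) x)
    · filter_upwards [hbd] with y hy x hx
      rw [norm_fderiv_iteratedFDeriv]
      exact hy x hx
    · refine Filter.Eventually.of_forall fun y x _ => ?_
      exact ((hf y).differentiable_iteratedFDeriv (m := k) (mod_cast ENat.natCast_lt_top k)
        x).hasFDerivAt
  have hD : ∀ k : ℕ, iteratedFDeriv ℝ k (fun x => ∫ y, f x y ∂μ)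
        = fun x => ∫ y, iteratedFDeriv ℝ k (fun x => f x y) x ∂μ := by
    intro k
    induction k with
    | zero =>
      funext x
      simp only [iteratedFDeriv_zero_eq_comp, Function.comp_apply]
      exact (ContinuousLinearEquiv.integral_comp_comm
        (continuousMultilinearCurryFin0 ℝ E F).symm.toContinuousLinearEquiv _).symm
    | succ k ih =>
      funext x
      rw [iteratedFDeriv_succ_eq_comp_left, Function.comp_apply, ih, (key k x).fderiv]
      simp only [iteratedFDeriv_succ_eq_comp_left, Function.comp_apply]
      let Φ : (E →L[ℝ] E [×k]→L[ℝ] F) ≃L[ℝ] (E [×(k + 1)]→L[ℝ] F) :=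
        (continuousMultilinearCurryLeftEquiv ℝ (fun _ : Fin (k + 1) => E)
          F).symm.toContinuousLinearEquiv
      exact (ContinuousLinearEquiv.integral_comp_comm (𝕜 := ℝ) (E := E →L[ℝ] E [×k]→L[ℝ] F)
        (F := E [×(k + 1)]→L[ℝ] F) (μ := μ) Φ
        (fun y => fderiv ℝ (iteratedFDeriv ℝ k (fun x => f x y)) x)).symm
  refine ⟨contDiff_of_differentiable_iteratedFDeriv fun k _ => ?_, fun k x => by rw [hD]⟩
  rw [hD]
  exact fun x => (key k x).differentiableAt

/-- Partial iterated derivatives of a jointly smooth function are jointly continuous. -/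
theorem continuous_iteratedFDeriv_partial {f : E × G → F} (hf : ContDiff ℝ ∞ f) (k : ℕ) :
    Continuous fun p : E × G => iteratedFDeriv ℝ k (fun x => f (x, p.2)) p.1 := by
  have e : (fun p : E × G => iteratedFDeriv ℝ k (fun x => f (x, p.2)) p.1)
      = fun p => (iteratedFDeriv ℝ k f p).compContinuousLinearMap
          (fun _ => ContinuousLinearMap.inl ℝ E G) := by
    funext p
    have h1 : (fun x => f (x, p.2))
        = (fun q => f (q + (0, p.2))) ∘ ContinuousLinearMap.inl ℝ E G := by
      funext x; simp
    have h2 : ContDiff ℝ ∞ (fun q : E × G => f (q + (0, p.2))) :=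
      hf.comp (contDiff_id.add contDiff_const)
    rw [h1, ContinuousLinearMap.iteratedFDeriv_comp_right (n := ∞) (i := k) _ h2 _
      (mod_cast le_top), iteratedFDeriv_comp_add_right]
    simp
  rw [e]
  exact (ContinuousMultilinearMap.compContinuousLinearMapL (F := F)
    (fun _ : Fin k => ContinuousLinearMap.inl ℝ E G)).continuous.comp
    (hf.continuous_iteratedFDeriv (mod_cast le_top))

/-- Integrals of jointly smooth functions over compact sets are smooth in the parameter. -/
theorem contDiff_setIntegral_of_contDiff [ProperSpace E] [MeasurableSpace G] [BorelSpace G]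
    [SecondCountableTopology G] {μ : Measure G} [IsFiniteMeasureOnCompacts μ] {S : Set G}
    (hS : IsCompact S) {f : E × G → F} (hf : ContDiff ℝ ∞ f) :
    ContDiff ℝ ∞ (fun x => ∫ y in S, f (x, y) ∂μ) ∧
      ∀ (k : ℕ) (x : E), iteratedFDeriv ℝ k (fun x => ∫ y in S, f (x, y) ∂μ) x
        = ∫ y in S, iteratedFDeriv ℝ k (fun x => f (x, y)) x ∂μ := by
  refine contDiff_integral_of_dominated (f := fun x y => f (x, y))
    (fun y => hf.comp (contDiff_id.prodMk contDiff_const)) (fun k x => ?_) (fun k x₀ => ?_)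
  · exact ((continuous_iteratedFDeriv_partial hf k).comp
      (Continuous.prodMk_right x)).aestronglyMeasurable
  · obtain ⟨C, hC⟩ := ((isCompact_closedBall x₀ 1).prod hS).exists_bound_of_continuousOn
      (continuous_iteratedFDeriv_partial hf k).continuousOn
    refine ⟨_, Metric.closedBall_mem_nhds x₀ one_pos, fun _ => C,
      integrableOn_const (hS.measure_lt_top.ne), ?_⟩
    filter_upwards [ae_restrict_mem hS.measurableSet] with y hy x hx
    exact hC (x, y) ⟨hx, hy⟩

/-- Derivatives of a composition with an affine map. -/
theorem norm_iteratedFDeriv_comp_affine_le {g : G → F} (hg : ContDiff ℝ ∞ g) (L : E →L[ℝ] G)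
    (c : G) (k : ℕ) (z : E) :
    ‖iteratedFDeriv ℝ k (fun z => g (L z + c)) z‖ ≤ ‖iteratedFDeriv ℝ k g (L z + c)‖ * ‖L‖ ^ k := by
  have h1 : (fun z => g (L z + c)) = (fun q => g (q + c)) ∘ L := rfl
  have h2 : ContDiff ℝ ∞ (fun q : G => g (q + c)) := hg.comp (contDiff_id.add contDiff_const)
  rw [h1, ContinuousLinearMap.iteratedFDeriv_comp_right (n := ∞) (i := k) _ h2 _
    (mod_cast le_top), iteratedFDeriv_comp_add_right]
  refine (ContinuousMultilinearMap.norm_compContinuousLinearMap_le _ _).trans ?_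
  simp

end ParametricIntegral

end SemiclassicalConjugation

/-! ### The Japanese bracket -/

namespace SemiclassicalConjugation

section Bracket

variable {n : ℕ}

theorem bracket_eq_sqrt (x : EuclideanSpace ℝ (Fin n)) : bracket x = √(1 + ‖x‖ ^ 2) := by
  rw [bracket, Real.sqrt_eq_rpow]

theorem one_le_bracket (x : EuclideanSpace ℝ (Fin n)) : 1 ≤ bracket x := by
  rw [bracket_eq_sqrt, Real.one_le_sqrt]
  linarith [sq_nonneg ‖x‖]

theorem bracket_pos (x : EuclideanSpace ℝ (Fin n)) : 0 < bracket x :=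
  zero_lt_one.trans_le (one_le_bracket x)

theorem bracket_sq (x : EuclideanSpace ℝ (Fin n)) : bracket x ^ 2 = 1 + ‖x‖ ^ 2 := by
  rw [bracket_eq_sqrt, Real.sq_sqrt (by positivity)]

theorem norm_le_bracket (x : EuclideanSpace ℝ (Fin n)) : ‖x‖ ≤ bracket x :=
  abs_le_of_sq_le_sq' (by rw [bracket_sq]; linarith) (bracket_pos x).le |>.2

theorem bracket_le_one_add_norm (x : EuclideanSpace ℝ (Fin n)) : bracket x ≤ 1 + ‖x‖ := by
  refine abs_le_of_sq_le_sq' ?_ (by positivity) |>.2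
  rw [bracket_sq]
  nlinarith [norm_nonneg x]

theorem continuous_bracket : Continuous (bracket : EuclideanSpace ℝ (Fin n) → ℝ) := by
  have : (bracket : EuclideanSpace ℝ (Fin n) → ℝ) = fun x => √(1 + ‖x‖ ^ 2) :=
    funext bracket_eq_sqrt
  rw [this]; fun_prop

theorem continuous_bracket_rpow (a : ℝ) :
    Continuous fun x : EuclideanSpace ℝ (Fin n) => bracket x ^ a :=
  continuous_bracket.rpow_const fun x => Or.inl (bracket_pos x).ne'

theorem bracket_le_mul_bracket (x t : EuclideanSpace ℝ (Fin n)) :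
    bracket x ≤ (1 + ‖x - t‖) * bracket t := by
  refine abs_le_of_sq_le_sq' ?_ (by have := bracket_pos t; positivity) |>.2
  rw [mul_pow, bracket_sq, bracket_sq]
  have h1 : ‖x‖ ≤ ‖t‖ + ‖x - t‖ := by
    simpa using norm_add_le t (x - t)
  have h2 : ‖x‖ ^ 2 ≤ (‖t‖ + ‖x - t‖) ^ 2 := by gcongr
  nlinarith [norm_nonneg (x - t), norm_nonneg t, sq_nonneg (‖t‖ - 1),
    mul_nonneg (norm_nonneg (x - t)) (sq_nonneg (‖t‖ - 1)),
    mul_nonneg (sq_nonneg ‖x - t‖) (sq_nonneg ‖t‖),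
    mul_nonneg (norm_nonneg (x - t)) (sq_nonneg ‖t‖)]

theorem bracket_rpow_neg_le {x t : EuclideanSpace ℝ (Fin n)} {C a : ℝ} (hC : 0 < C) (ha : 0 ≤ a)
    (h : bracket x ≤ C * bracket t) : bracket t ^ (-a) ≤ C ^ a * bracket x ^ (-a) := by
  have hx := bracket_pos x
  have ht := bracket_pos t
  rw [Real.rpow_neg ht.le, Real.rpow_neg hx.le, ← div_eq_mul_inv, inv_eq_one_div,
    div_le_div_iff₀ (by positivity) (by positivity), one_mul, ← Real.mul_rpow hC.le ht.le]
  exact Real.rpow_le_rpow hx.le h ha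

end Bracket

/-! ### The mollified potential -/

section Sharp

variable {n : ℕ}

/-- Derivatives of `A^♯` cost a factor `h^{-σ₀}` each and inherit the decay of `A`. -/
theorem symbolBound_sharp {A : EuclideanSpace ℝ (Fin n) → EuclideanSpace ℂ (Fin n)}
    (hAcont : Continuous A) {ε : ℝ} (hε : 0 < ε)
    (hAdecay : ∃ K : ℝ, ∀ x, ‖A x‖ ≤ K * bracket x ^ (-1 - ε))
    {χ : EuclideanSpace ℝ (Fin n) → ℝ} (hχ : ContDiff ℝ ∞ χ) (hχsupp : HasCompactSupport χ)
    {σ₀ h₀ : ℝ} (hσ₀ : 0 < σ₀) (hh₀ : h₀ ≤ 1) :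
    SymbolBound h₀ σ₀ (fun _ x => bracket x ^ (-1 - ε)) (fun h => sharp χ σ₀ h A) := by
  obtain ⟨K₀, hK₀⟩ := hAdecay
  set K := max K₀ 0
  have hK0 : 0 ≤ K := le_max_right _ _
  have hK : ∀ x, ‖A x‖ ≤ K * bracket x ^ (-(1 + ε)) := fun x => by
    have := hK₀ x
    rw [show -1 - ε = -(1 + ε) by ring] at this
    exact this.trans (mul_le_mul_of_nonneg_right (le_max_left _ _)
      (Real.rpow_nonneg (bracket_pos x).le _))
  rw [show -1 - ε = -(1 + ε) by ring]
  obtain ⟨C₀, hC₀⟩ := hχsupp.isBounded.subset_closedBall 0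
  have hM : ∀ k : ℕ, ∃ M : ℝ, 0 ≤ M ∧ ∀ y, ‖iteratedFDeriv ℝ k χ y‖ ≤ M := fun k => by
    obtain ⟨M, hM⟩ := (hχ.continuous_iteratedFDeriv (m := k)
      (mod_cast le_top)).bounded_above_of_compact_support (hχsupp.iteratedFDeriv k)
    exact ⟨M, (norm_nonneg _).trans (hM 0), hM⟩
  choose M hM0 hM using hM
  set C := max C₀ 0
  have hC0 : 0 ≤ C := le_max_right _ _
  have hzero : ∀ (k : ℕ) (y : EuclideanSpace ℝ (Fin n)), C < ‖y‖ → iteratedFDeriv ℝ k χ y = 0 := by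
    intro k y hy
    by_contra hne
    have h1 := hC₀ (support_iteratedFDeriv_subset k (Function.mem_support.2 hne))
    rw [mem_closedBall_zero_iff] at h1
    exact absurd (h1.trans (le_max_left _ _)) (not_le.2 hy)
  -- derivatives of the rescaled mollifier
  have hmoll : ∀ (k : ℕ) (δ : ℝ), 0 < δ → ∀ y : EuclideanSpace ℝ (Fin n),
      ‖iteratedFDeriv ℝ k (mollifier χ δ) y‖
        ≤ (Metric.closedBall 0 (C * δ)).indicator (fun _ => (δ ^ n)⁻¹ * M k * (δ⁻¹) ^ k) y := by
    intro k δ hδ y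
    have hMk := hM0 k
    have hL : ‖δ⁻¹ • ContinuousLinearMap.id ℝ (EuclideanSpace ℝ (Fin n))‖ ≤ δ⁻¹ := by
      rw [norm_smul, Real.norm_of_nonneg (by positivity)]
      exact mul_le_of_le_one_right (by positivity) ContinuousLinearMap.norm_id_le
    have h1 := norm_iteratedFDeriv_comp_affine_le hχ
      (δ⁻¹ • ContinuousLinearMap.id ℝ (EuclideanSpace ℝ (Fin n))) 0 k y
    simp only [smul_apply, ContinuousLinearMap.id_apply, add_zero] at h1
    have h2 : iteratedFDeriv ℝ k (mollifier χ δ) y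
        = (δ ^ n)⁻¹ • iteratedFDeriv ℝ k (fun y => χ (δ⁻¹ • y)) y := by
      have hχδ : ContDiff ℝ ∞ (fun y : EuclideanSpace ℝ (Fin n) => χ (δ⁻¹ • y)) :=
        hχ.comp (contDiff_id.const_smul δ⁻¹)
      exact iteratedFDeriv_const_smul_apply' (a := (δ ^ n)⁻¹)
        (hχδ.of_le (mod_cast le_top)).contDiffAt
    rw [h2, norm_smul, Real.norm_of_nonneg (by positivity)]
    by_cases hy : y ∈ Metric.closedBall (0 : EuclideanSpace ℝ (Fin n)) (C * δ)
    · rw [Set.indicator_of_mem hy, mul_assoc]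
      gcongr
      refine h1.trans ?_
      gcongr
      exact hM k _
    · rw [Set.indicator_of_notMem hy]
      have h3 : iteratedFDeriv ℝ k χ (δ⁻¹ • y) = 0 := by
        refine hzero k _ ?_
        rw [mem_closedBall_zero_iff, not_le] at hy
        rw [norm_smul, Real.norm_of_nonneg (by positivity), inv_mul_eq_div, lt_div_iff₀ hδ]
        exact hy
      rw [h3, norm_zero, zero_mul] at h1
      exact mul_nonpos_of_nonneg_of_nonpos (by positivity) h1
  have hmollsm : ∀ δ : ℝ, ContDiff ℝ ∞ (mollifier χ δ) := fun δ =>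
    contDiff_const.mul (hχ.comp (contDiff_id.const_smul δ⁻¹))
  -- derivatives of the integrand
  have hint : ∀ (k : ℕ) (δ : ℝ), 0 < δ → ∀ x t : EuclideanSpace ℝ (Fin n),
      ‖iteratedFDeriv ℝ k (fun x => mollifier χ δ (x - t) • A t) x‖
        ≤ (Metric.closedBall x (C * δ)).indicator
          (fun t => (δ ^ n)⁻¹ * M k * (δ⁻¹) ^ k * ‖A t‖) t := by
    intro k δ hδ x t
    have h1 := (ContinuousLinearMap.toSpanSingleton ℝ (A t)).norm_iteratedFDeriv_comp_left
      (x := x) (f := fun x => mollifier χ δ (x - t)) (n := k) (N := ∞)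
      ((hmollsm δ).comp (contDiff_id.sub contDiff_const)).contDiffAt (mod_cast le_top)
    rw [iteratedFDeriv_comp_sub, ContinuousLinearMap.norm_toSpanSingleton] at h1
    refine h1.trans ((mul_le_mul_of_nonneg_left (hmoll k δ hδ (x - t)) (norm_nonneg _)).trans ?_)
    by_cases ht : t ∈ Metric.closedBall x (C * δ)
    · have ht' : x - t ∈ Metric.closedBall (0 : EuclideanSpace ℝ (Fin n)) (C * δ) := by
        rw [mem_closedBall_zero_iff]
        rwa [mem_closedBall_iff_norm, norm_sub_rev] at ht
      rw [Set.indicator_of_mem ht, Set.indicator_of_mem ht', mul_comm]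
    · have ht' : x - t ∉ Metric.closedBall (0 : EuclideanSpace ℝ (Fin n)) (C * δ) := by
        rw [mem_closedBall_zero_iff]
        rwa [mem_closedBall_iff_norm, norm_sub_rev] at ht
      rw [Set.indicator_of_notMem ht, Set.indicator_of_notMem ht', mul_zero]
  have hle1 : ∀ t : EuclideanSpace ℝ (Fin n), ‖A t‖ ≤ K := fun t => by
    refine (hK t).trans (mul_le_of_le_one_right hK0 ?_)
    exact Real.rpow_le_one_of_one_le_of_nonpos (one_le_bracket t) (by linarith)
  have hmain : ∀ δ : ℝ, 0 < δ → _ := fun δ hδ =>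
    contDiff_integral_of_dominated (μ := volume)
    (f := fun x t => mollifier χ δ (x - t) • A t)
    (fun t => ((hmollsm δ).comp (contDiff_id.sub contDiff_const)).smul contDiff_const)
    (fun k x => by
      have hj : ContDiff ℝ ∞ (fun p : EuclideanSpace ℝ (Fin n) ×
          (EuclideanSpace ℝ (Fin n) × EuclideanSpace ℂ (Fin n)) =>
          mollifier χ δ (p.1 - p.2.1) • p.2.2) :=
        ((hmollsm δ).comp (contDiff_fst.sub contDiff_snd.fst)).smul contDiff_snd.snd
      have hc : Continuous fun t : EuclideanSpace ℝ (Fin n) => (x, (t, A t)) := by fun_prop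
      exact ((continuous_iteratedFDeriv_partial hj k).comp hc).aestronglyMeasurable)
    (fun k x₀ => by
      refine ⟨_, Metric.closedBall_mem_nhds x₀ one_pos,
        (Metric.closedBall x₀ (C * δ + 1)).indicator
          (fun _ => (δ ^ n)⁻¹ * M k * (δ⁻¹) ^ k * K), ?_, ?_⟩
      · exact (integrable_indicator_iff measurableSet_closedBall).2
          (integrableOn_const measure_closedBall_lt_top.ne)
      · refine Filter.Eventually.of_forall fun t x hx => (hint k δ hδ x t).trans ?_
        have hM' := hM0 k
        by_cases ht : t ∈ Metric.closedBall x (C * δ)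
        · have ht' : t ∈ Metric.closedBall x₀ (C * δ + 1) := by
            rw [Metric.mem_closedBall] at *
            linarith [dist_triangle t x x₀]
          rw [Set.indicator_of_mem ht, Set.indicator_of_mem ht']
          gcongr
          exact hle1 t
        · rw [Set.indicator_of_notMem ht]
          exact Set.indicator_nonneg (fun _ _ => by positivity) _)
  have hsharp : ∀ h : ℝ, sharp χ σ₀ h A
      = fun x => ∫ t, mollifier χ (h ^ σ₀) (x - t) • A t := fun h => by
    funext x
    exact convolution_lsmul_swap
  refine ⟨fun h hh => ?_, fun k => ?_⟩
  · simp only [hsharp]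
    exact (hmain _ (Real.rpow_pos_of_pos hh.1 _)).1
  · refine ⟨M k * (K * (1 + C) ^ (1 + ε)) * (C ^ n *
      (volume (Metric.ball (0 : EuclideanSpace ℝ (Fin n)) 1)).toReal), ?_, fun h hh x => ?_⟩
    · have := hM0 k
      positivity
    have hδ : 0 < h ^ σ₀ := Real.rpow_pos_of_pos hh.1 _
    have hδ1 : h ^ σ₀ ≤ 1 := Real.rpow_le_one hh.1.le (hh.2.trans hh₀) hσ₀.le
    simp only [hsharp]
    rw [(hmain _ hδ).2 k x, Real.rpow_neg hh.1.le]
    set δ := h ^ σ₀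
    have hM' := hM0 k
    have hb := bracket_pos x
    set B : ℝ := (δ ^ n)⁻¹ * M k * (δ⁻¹) ^ k * (K * (1 + C) ^ (1 + ε) * bracket x ^ (-(1 + ε)))
    have h1 : ‖∫ t, iteratedFDeriv ℝ k (fun x => mollifier χ δ (x - t) • A t) x‖
        ≤ ∫ t, (Metric.closedBall x (C * δ)).indicator (fun _ => B) t := by
      refine norm_integral_le_of_norm_le ((integrable_indicator_iff measurableSet_closedBall).2
        (integrableOn_const measure_closedBall_lt_top.ne))
        (Filter.Eventually.of_forall fun t => (hint k δ hδ x t).trans ?_)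
      refine Set.indicator_le_indicator' fun ht => ?_
      simp only [B]
      gcongr
      refine (hK t).trans ?_
      rw [mul_assoc]
      gcongr
      refine bracket_rpow_neg_le (by positivity) (by positivity)
        ((bracket_le_mul_bracket x t).trans ?_)
      have := bracket_pos t
      gcongr
      rw [mem_closedBall_iff_norm, norm_sub_rev] at ht
      exact ht.trans (mul_le_of_le_one_right hC0 hδ1)
    refine h1.trans (le_of_eq ?_)
    rw [integral_indicator measurableSet_closedBall, setIntegral_const, smul_eq_mul,
      Measure.real, Measure.addHaar_closedBall _ _ (by positivity), ENNReal.toReal_mul,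
      ENNReal.toReal_ofReal (by positivity), finrank_euclideanSpace_fin]
    simp only [B]
    have : (C * δ) ^ n * (δ ^ n)⁻¹ = C ^ n := by
      rw [mul_pow]; field_simp
    rw [← this]
    ring

end Sharp

end SemiclassicalConjugation

/-! ### Decay of integrals over a plane in polar coordinates -/

namespace SemiclassicalConjugation

section PolarPlane

variable {n : ℕ}

/-- The point with polar coordinates `y = (r, θ)` in the plane through `x` that is spanned by
`ξ + a` and `b`, where `z = (x, ξ)`. -/
noncomputable def planePoint (a b : EuclideanSpace ℝ (Fin n))
    (z : EuclideanSpace ℝ (Fin n) × EuclideanSpace ℝ (Fin n)) (y : ℝ × ℝ) :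
    EuclideanSpace ℝ (Fin n) :=
  z.1 + y.1 • (Real.cos y.2 • (z.2 + a) + Real.sin y.2 • b)

/-- The frame `v, b` is nearly orthonormal: `y ↦ y₁ v + y₂ b` changes norms by a factor between
`1/2` and `2`. -/
def NearlyOrthonormal (v b : EuclideanSpace ℝ (Fin n)) : Prop :=
  ∀ s t : ℝ, (s ^ 2 + t ^ 2) / 4 ≤ ‖s • v + t • b‖ ^ 2 ∧ ‖s • v + t • b‖ ^ 2 ≤ 4 * (s ^ 2 + t ^ 2)

/-- The polar rectangle `0 ≤ r ≤ 2R`, `-π ≤ θ ≤ π`. -/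
def polarBox (R : ℝ) : Set (ℝ × ℝ) := Set.Icc 0 (2 * R) ×ˢ Set.Icc (-Real.pi) Real.pi

theorem isCompact_polarBox (R : ℝ) : IsCompact (polarBox R) := isCompact_Icc.prod isCompact_Icc

theorem contDiff_planePoint (a b : EuclideanSpace ℝ (Fin n)) :
    ContDiff ℝ ∞ (fun p : (EuclideanSpace ℝ (Fin n) × EuclideanSpace ℝ (Fin n)) × (ℝ × ℝ) =>
      planePoint a b p.1 p.2) := by
  unfold planePoint
  fun_prop

theorem continuous_planePoint (a b : EuclideanSpace ℝ (Fin n))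
    (z : EuclideanSpace ℝ (Fin n) × EuclideanSpace ℝ (Fin n)) :
    Continuous (planePoint a b z) :=
  (contDiff_planePoint a b).continuous.comp (Continuous.prodMk_right z)

theorem continuous_bracket_planePoint (a b : EuclideanSpace ℝ (Fin n))
    (z : EuclideanSpace ℝ (Fin n) × EuclideanSpace ℝ (Fin n)) (s : ℝ) :
    Continuous fun y => bracket (planePoint a b z y) ^ s :=
  (continuous_bracket_rpow s).comp (continuous_planePoint a b z)

theorem NearlyOrthonormal.norm_direction {v b : EuclideanSpace ℝ (Fin n)}
    (hv : NearlyOrthonormal v b) (θ : ℝ) :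
    1 / 2 ≤ ‖Real.cos θ • v + Real.sin θ • b‖ ∧ ‖Real.cos θ • v + Real.sin θ • b‖ ≤ 2 := by
  obtain ⟨h1, h2⟩ := hv (Real.cos θ) (Real.sin θ)
  rw [Real.cos_sq_add_sin_sq] at h1 h2
  have h0 := norm_nonneg (Real.cos θ • v + Real.sin θ • b)
  constructor <;> nlinarith

/-- The functions `⟨x⟩^{-1-ε}` have uniformly bounded integrals over lines. -/
theorem exists_lineIntegral_bracket_le {ε : ℝ} (hε : 0 < ε) :
    ∃ C : ℝ, 0 ≤ C ∧ ∀ x w : EuclideanSpace ℝ (Fin n), 1 / 2 ≤ ‖w‖ → ∀ S : Set ℝ,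
      ∫ r in S, bracket (x + r • w) ^ (-1 - ε) ≤ C := by
  set J : ℝ → ℝ := fun r => (1 + ‖r‖ ^ 2) ^ (-(1 + ε) / 2)
  have hJ : Integrable J := by
    refine integrable_rpow_neg_one_add_norm_sq ?_
    rw [Module.finrank_self]; push_cast; linarith
  have hJ0 : ∀ r, 0 ≤ J r := fun r => by positivity
  refine ⟨2 ^ (1 + ε) * ∫ r, J r, mul_nonneg (by positivity) (integral_nonneg hJ0), ?_⟩
  intro x w hw S
  have hw0 : 0 < ‖w‖ := by linarith
  set s := inner ℝ x w / ‖w‖ ^ 2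
  have hJs : Integrable (fun r => 2 ^ (1 + ε) * J (r + s)) :=
    (hJ.comp_add_right s).const_mul _
  have hpt : ∀ r : ℝ, bracket (x + r • w) ^ (-1 - ε) ≤ 2 ^ (1 + ε) * J (r + s) := by
    intro r
    have h1 : ‖x + r • w‖ ^ 2 = ‖x‖ ^ 2 + 2 * r * inner ℝ x w + r ^ 2 * ‖w‖ ^ 2 := by
      rw [norm_add_sq_real, inner_smul_right, norm_smul, mul_pow, Real.norm_eq_abs, sq_abs]; ring
    have hcs : inner ℝ x w ^ 2 ≤ ‖x‖ ^ 2 * ‖w‖ ^ 2 := by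
      rw [← mul_pow, ← sq_abs]
      gcongr
      exact abs_real_inner_le_norm x w
    have hs : s * ‖w‖ ^ 2 = inner ℝ x w := by simp only [s]; field_simp
    have hss : s ^ 2 * ‖w‖ ^ 2 ≤ ‖x‖ ^ 2 := by
      have : s ^ 2 * ‖w‖ ^ 2 * ‖w‖ ^ 2 ≤ ‖x‖ ^ 2 * ‖w‖ ^ 2 := by
        rw [← hs] at hcs; nlinarith
      exact le_of_mul_le_mul_right this (by positivity)
    have h2 : (r + s) ^ 2 * ‖w‖ ^ 2 ≤ ‖x + r • w‖ ^ 2 := by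
      rw [h1, ← hs]; nlinarith
    have h3 : (1 + ‖r + s‖ ^ 2) ≤ 4 * (1 + ‖x + r • w‖ ^ 2) := by
      rw [Real.norm_eq_abs, sq_abs]
      nlinarith [sq_nonneg (r + s), mul_nonneg (sq_nonneg (r + s)) (by nlinarith :
        (0 : ℝ) ≤ ‖w‖ ^ 2 - 1 / 4)]
    have h4 : bracket (x + r • w) ^ (-1 - ε) = (1 + ‖x + r • w‖ ^ 2) ^ (-((1 + ε) / 2)) := by
      rw [bracket, ← Real.rpow_mul (by positivity)]; congr 1; ring
    have h5 : (2 : ℝ) ^ (1 + ε) = (4 : ℝ) ^ ((1 + ε) / 2) := by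
      rw [show (4 : ℝ) = 2 ^ (2 : ℝ) by norm_num, ← Real.rpow_mul (by norm_num)]
      congr 1; ring
    simp only [J]
    rw [h4, h5, neg_div, Real.rpow_neg (by positivity), Real.rpow_neg (by positivity),
      ← div_eq_mul_inv, inv_eq_one_div, div_le_div_iff₀ (by positivity) (by positivity), one_mul,
      ← Real.mul_rpow (by norm_num) (by positivity)]
    exact Real.rpow_le_rpow (by positivity) h3 (by positivity)
  calc ∫ r in S, bracket (x + r • w) ^ (-1 - ε)
      ≤ ∫ r in S, 2 ^ (1 + ε) * J (r + s) :=
        integral_mono_of_nonneg (Filter.Eventually.of_forall fun r =>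
          Real.rpow_nonneg (bracket_pos _).le _) hJs.integrableOn (Filter.Eventually.of_forall hpt)
    _ ≤ ∫ r, 2 ^ (1 + ε) * J (r + s) :=
        setIntegral_le_integral hJs (Filter.Eventually.of_forall fun r =>
          mul_nonneg (by positivity) (hJ0 _))
    _ = 2 ^ (1 + ε) * ∫ r, J r := by
        rw [integral_const_mul, integral_add_right_eq_self]

theorem integrableOn_bracket_planePoint (a b : EuclideanSpace ℝ (Fin n))
    (z : EuclideanSpace ℝ (Fin n) × EuclideanSpace ℝ (Fin n)) (s : ℝ) {S : Set (ℝ × ℝ)}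
    (hS : IsCompact S) :
    IntegrableOn (fun y => bracket (planePoint a b z y) ^ s) S :=
  (continuous_bracket_planePoint a b z s).continuousOn.integrableOn_compact hS

/-- Uniform bound: in polar coordinates the integral splits into integrals over rays. -/
theorem exists_planeIntegral_bracket_le {ε : ℝ} (hε : 0 < ε) :
    ∃ C : ℝ, 0 ≤ C ∧ ∀ (a b : EuclideanSpace ℝ (Fin n))
      (z : EuclideanSpace ℝ (Fin n) × EuclideanSpace ℝ (Fin n)),
      NearlyOrthonormal (z.2 + a) b → ∀ s t : ℝ,
      ∫ y in Set.Icc s t ×ˢ Set.Icc (-Real.pi) Real.pi,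
        bracket (planePoint a b z y) ^ (-1 - ε) ≤ C := by
  obtain ⟨C, hC, H⟩ := exists_lineIntegral_bracket_le (n := n) hε
  refine ⟨C * (2 * Real.pi), by positivity, fun a b z hz s t => ?_⟩
  have hint := integrableOn_bracket_planePoint a b z (-1 - ε)
    ((isCompact_Icc (a := s) (b := t)).prod (isCompact_Icc (a := -Real.pi) (b := Real.pi)))
  rw [Measure.volume_eq_prod, ← Measure.prod_restrict,
    integral_prod_symm _ (by
      rw [Measure.prod_restrict, ← Measure.volume_eq_prod]; exact hint)]
  have h1 : ∀ θ ∈ Set.Icc (-Real.pi) Real.pi,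
      ‖∫ r in Set.Icc s t, bracket (planePoint a b z (r, θ)) ^ (-1 - ε)‖ ≤ C := fun θ _ => by
    rw [Real.norm_of_nonneg (integral_nonneg fun r => Real.rpow_nonneg (bracket_pos _).le _)]
    exact H z.1 _ (hz.norm_direction θ).1 _
  have h2 := norm_setIntegral_le_of_norm_le_const (μ := volume) (s := Set.Icc (-Real.pi) Real.pi)
    (by simp) h1
  refine (le_abs_self _).trans (h2.trans (le_of_eq ?_))
  rw [Measure.real, Real.volume_Icc, ENNReal.toReal_ofReal (by linarith [Real.pi_pos])]
  ring

/-- For `|x| ≥ 8R` the polar rectangle stays far from the origin. -/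
theorem bracket_planePoint_far {a b : EuclideanSpace ℝ (Fin n)}
    {z : EuclideanSpace ℝ (Fin n) × EuclideanSpace ℝ (Fin n)}
    (hz : NearlyOrthonormal (z.2 + a) b) {R : ℝ} (hx : 8 * R ≤ ‖z.1‖) {y : ℝ × ℝ}
    (hy0 : 0 ≤ y.1) (hy : y.1 ≤ 2 * R) :
    bracket z.1 ≤ 2 * bracket (planePoint a b z y) := by
  have h1 := (hz.norm_direction y.2).2
  have h2 : ‖y.1 • (Real.cos y.2 • (z.2 + a) + Real.sin y.2 • b)‖ ≤ 2 * R * 2 := by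
    rw [norm_smul, Real.norm_of_nonneg hy0]
    exact mul_le_mul hy h1 (norm_nonneg _) (hy0.trans hy)
  have h3 : ‖z.1‖ ≤ ‖planePoint a b z y‖
      + ‖y.1 • (Real.cos y.2 • (z.2 + a) + Real.sin y.2 • b)‖ := by
    have := norm_sub_le (planePoint a b z y)
      (y.1 • (Real.cos y.2 • (z.2 + a) + Real.sin y.2 • b))
    simpa [planePoint] using this
  have h4 : ‖z.1‖ ≤ 2 * ‖planePoint a b z y‖ := by linarith
  refine abs_le_of_sq_le_sq' ?_ (by have := bracket_pos (planePoint a b z y); positivity) |>.2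
  rw [mul_pow, bracket_sq, bracket_sq]
  have h5 : ‖z.1‖ ^ 2 ≤ (2 * ‖planePoint a b z y‖) ^ 2 := by gcongr
  nlinarith

/-- For `|x| ≥ 8R` the integral over a part of the polar rectangle is at most its measure times a
multiple of `⟨x⟩^{-1-ε}`. -/
theorem setIntegral_bracket_far {a b : EuclideanSpace ℝ (Fin n)}
    {z : EuclideanSpace ℝ (Fin n) × EuclideanSpace ℝ (Fin n)}
    (hz : NearlyOrthonormal (z.2 + a) b) {R ε s : ℝ} (hε : 0 < ε) (hε1 : ε ≤ 1)
    (hs : 0 ≤ s) (hsR : s ≤ 2 * R) (hx : 8 * R ≤ ‖z.1‖) :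
    ∫ y in Set.Icc s (2 * R) ×ˢ Set.Icc (-Real.pi) Real.pi,
      bracket (planePoint a b z y) ^ (-1 - ε)
        ≤ 4 * bracket z.1 ^ (-1 - ε) * ((2 * R - s) * (2 * Real.pi)) := by
  have hb := bracket_pos z.1
  have h1 : ∀ y ∈ Set.Icc s (2 * R) ×ˢ Set.Icc (-Real.pi) Real.pi,
      ‖bracket (planePoint a b z y) ^ (-1 - ε)‖ ≤ 4 * bracket z.1 ^ (-1 - ε) := by
    rintro y ⟨⟨hy1, hy2⟩, -⟩
    rw [Real.norm_of_nonneg (Real.rpow_nonneg (bracket_pos _).le _),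
      show -1 - ε = -(1 + ε) by ring]
    refine (bracket_rpow_neg_le two_pos (by positivity)
      (bracket_planePoint_far hz hx (hs.trans hy1) hy2)).trans ?_
    gcongr
    calc (2 : ℝ) ^ (1 + ε) ≤ 2 ^ (2 : ℝ) :=
          Real.rpow_le_rpow_of_exponent_le one_le_two (by linarith)
      _ = 4 := by norm_num
  have h2 := norm_setIntegral_le_of_norm_le_const (μ := volume)
    (s := Set.Icc s (2 * R) ×ˢ Set.Icc (-Real.pi) Real.pi)
    ((isCompact_Icc.prod isCompact_Icc).measure_lt_top) h1
  refine (le_abs_self _).trans (h2.trans (le_of_eq ?_))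
  rw [Measure.real, Measure.volume_eq_prod, Measure.prod_prod, ENNReal.toReal_mul,
    Real.volume_Icc, Real.volume_Icc, ENNReal.toReal_ofReal (by linarith),
    ENNReal.toReal_ofReal (by linarith [Real.pi_pos])]
  ring

/-- Multiplication by `⟨x⟩` costs at most a factor `R`. -/
theorem exists_bracket_mul_planeIntegral_le {ε : ℝ} (hε : 0 < ε) (hε1 : ε ≤ 1) :
    ∃ C : ℝ, 0 ≤ C ∧ ∀ (a b : EuclideanSpace ℝ (Fin n))
      (z : EuclideanSpace ℝ (Fin n) × EuclideanSpace ℝ (Fin n)),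
      NearlyOrthonormal (z.2 + a) b → ∀ R : ℝ, 1 ≤ R →
      bracket z.1 * ∫ y in polarBox R, bracket (planePoint a b z y) ^ (-1 - ε) ≤ C * R := by
  obtain ⟨C, hC, H⟩ := exists_planeIntegral_bracket_le (n := n) hε
  refine ⟨9 * C + 16 * Real.pi, by positivity, fun a b z hz R hR => ?_⟩
  have hb := bracket_pos z.1
  rcases le_total ‖z.1‖ (8 * R) with hx | hx
  · calc bracket z.1 * ∫ y in polarBox R, bracket (planePoint a b z y) ^ (-1 - ε)
        ≤ (9 * R) * C :=
          mul_le_mul (by linarith [bracket_le_one_add_norm z.1]) (H a b z hz 0 (2 * R))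
            (integral_nonneg fun y => Real.rpow_nonneg (bracket_pos _).le _) (by linarith)
      _ ≤ (9 * C + 16 * Real.pi) * R := by nlinarith [Real.pi_pos]
  · have h1 := setIntegral_bracket_far hz hε hε1 le_rfl (by linarith : 0 ≤ 2 * R) hx
    have h2 : bracket z.1 * bracket z.1 ^ (-1 - ε) ≤ 1 := by
      rw [show -1 - ε = -ε - 1 by ring, Real.rpow_sub_one hb.ne', mul_div_cancel₀ _ hb.ne']
      exact Real.rpow_le_one_of_one_le_of_nonpos (one_le_bracket _) (by linarith)
    calc bracket z.1 * ∫ y in polarBox R, bracket (planePoint a b z y) ^ (-1 - ε)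
        ≤ bracket z.1 * (4 * bracket z.1 ^ (-1 - ε) * ((2 * R - 0) * (2 * Real.pi))) :=
          mul_le_mul_of_nonneg_left h1 hb.le
      _ = (bracket z.1 * bracket z.1 ^ (-1 - ε)) * (16 * Real.pi * R) := by ring
      _ ≤ 1 * (16 * Real.pi * R) :=
          mul_le_mul_of_nonneg_right h2 (by positivity)
      _ ≤ _ := by nlinarith [mul_nonneg hC (zero_le_one.trans hR)]

/-- The part of the polar rectangle that lies in the ball of radius `ρ`, measured with the
Cartesian area element `r dr dθ`, has area at most `64 ρ²`. -/
theorem setIntegral_radius_indicator_le {a b : EuclideanSpace ℝ (Fin n)}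
    {z : EuclideanSpace ℝ (Fin n) × EuclideanSpace ℝ (Fin n)}
    (hz : NearlyOrthonormal (z.2 + a) b) {R ρ : ℝ} (hR : 0 < R) (hρ : 0 ≤ ρ) :
    ∫ y in Set.Icc R (2 * R) ×ˢ Set.Icc (-Real.pi) Real.pi,
      {y : ℝ × ℝ | ‖planePoint a b z y‖ ≤ ρ}.indicator (fun y => y.1) y ≤ 64 * ρ ^ 2 := by
  set T : Set (ℝ × ℝ) := {p | ‖z.1 + (p.1 • (z.2 + a) + p.2 • b)‖ ≤ ρ}
  have hTvol : volume T ≤ ENNReal.ofReal (64 * ρ ^ 2) := by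
    rcases T.eq_empty_or_nonempty with hT | ⟨p₀, hp₀⟩
    · rw [hT]; simp
    · have hsub : T ⊆ Set.Icc (p₀.1 - 4 * ρ) (p₀.1 + 4 * ρ) ×ˢ
          Set.Icc (p₀.2 - 4 * ρ) (p₀.2 + 4 * ρ) := by
        intro p hp
        have h1 : ‖(p.1 - p₀.1) • (z.2 + a) + (p.2 - p₀.2) • b‖ ≤ 2 * ρ := by
          have e : (p.1 - p₀.1) • (z.2 + a) + (p.2 - p₀.2) • b
              = (z.1 + (p.1 • (z.2 + a) + p.2 • b)) - (z.1 + (p₀.1 • (z.2 + a) + p₀.2 • b)) := by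
            rw [sub_smul, sub_smul]; abel
          rw [e]
          refine (norm_sub_le _ _).trans ?_
          have h2 : ‖z.1 + (p.1 • (z.2 + a) + p.2 • b)‖ ≤ ρ := hp
          have h3 : ‖z.1 + (p₀.1 • (z.2 + a) + p₀.2 • b)‖ ≤ ρ := hp₀
          linarith
        have h2 := (hz (p.1 - p₀.1) (p.2 - p₀.2)).1
        have h3 : ‖(p.1 - p₀.1) • (z.2 + a) + (p.2 - p₀.2) • b‖ ^ 2 ≤ (2 * ρ) ^ 2 := by gcongr
        have h4 := abs_le_of_sq_le_sq' (by nlinarith [sq_nonneg (p.2 - p₀.2)] :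
          (p.1 - p₀.1) ^ 2 ≤ (4 * ρ) ^ 2) (by positivity)
        have h5 := abs_le_of_sq_le_sq' (by nlinarith [sq_nonneg (p.1 - p₀.1)] :
          (p.2 - p₀.2) ^ 2 ≤ (4 * ρ) ^ 2) (by positivity)
        exact ⟨⟨by linarith, by linarith⟩, ⟨by linarith, by linarith⟩⟩
      refine (measure_mono hsub).trans (le_of_eq ?_)
      rw [Measure.volume_eq_prod, Measure.prod_prod, Real.volume_Icc, Real.volume_Icc,
        ← ENNReal.ofReal_mul (by linarith)]
      congr 1; ring
  have hTm : MeasurableSet T := by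
    have : IsClosed T := isClosed_le (by fun_prop) continuous_const
    exact this.measurableSet
  have hpolar := lintegral_comp_polarCoord_symm (T.indicator 1)
  rw [lintegral_indicator_one hTm] at hpolar
  set U : Set (ℝ × ℝ) := {y | ‖planePoint a b z y‖ ≤ ρ}
  have hUm : MeasurableSet U :=
    (isClosed_le (continuous_planePoint a b z).norm continuous_const).measurableSet
  have hUT : ∀ y : ℝ × ℝ, polarCoord.symm y ∈ T ↔ y ∈ U := fun y => by
    have : planePoint a b z y = z.1 + ((polarCoord.symm y).1 • (z.2 + a)
        + (polarCoord.symm y).2 • b) := by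
      simp [planePoint, polarCoord, smul_add, smul_smul]
    simp only [T, U, Set.mem_ofPred_eq, this]
  rw [integral_eq_lintegral_of_nonneg_ae]
  rotate_left
  · filter_upwards [ae_restrict_mem (measurableSet_Icc.prod measurableSet_Icc)] with y hy
    exact Set.indicator_apply_nonneg fun _ => hR.le.trans hy.1.1
  · exact (measurable_fst.indicator hUm).aestronglyMeasurable
  refine ENNReal.toReal_le_of_le_ofReal (by positivity) (le_trans ?_ hTvol)
  rw [← hpolar]
  have hae : (Set.Icc R (2 * R) ×ˢ Set.Icc (-Real.pi) Real.pi : Set (ℝ × ℝ))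
      =ᵐ[volume] Set.Icc R (2 * R) ×ˢ Set.Ioo (-Real.pi) Real.pi :=
    Measure.set_prod_ae_eq (ae_eq_refl _) Ioo_ae_eq_Icc.symm
  rw [setLIntegral_congr hae]
  calc ∫⁻ y in Set.Icc R (2 * R) ×ˢ Set.Ioo (-Real.pi) Real.pi,
        ENNReal.ofReal (U.indicator (fun y => y.1) y)
      ≤ ∫⁻ y in polarCoord.target, ENNReal.ofReal (U.indicator (fun y => y.1) y) := by
        refine lintegral_mono_set ?_
        rintro y ⟨⟨h1, -⟩, h2⟩
        exact ⟨hR.trans_le h1, h2⟩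
    _ = ∫⁻ y in polarCoord.target, ENNReal.ofReal y.1 • T.indicator 1
          (polarCoord.symm y) := by
        congr 1
        funext y
        by_cases hy : y ∈ U
        · rw [Set.indicator_of_mem hy, Set.indicator_of_mem ((hUT y).2 hy)]; simp
        · rw [Set.indicator_of_notMem hy, Set.indicator_of_notMem (fun h => hy ((hUT y).1 h))]
          simp

/-- On the outer half of the polar rectangle the mean of `⟨·⟩^{-1-ε}` gains a power of `R`, even
after multiplication by `⟨x⟩`: inside the ball of radius `R^{1/4}` the area is small, and outside
of it a part of the decay is left over. -/
theorem exists_bracket_mul_tail_le {ε : ℝ} (hε : 0 < ε) (hε1 : ε ≤ 1) :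
    ∃ C : ℝ, 0 ≤ C ∧ ∀ (a b : EuclideanSpace ℝ (Fin n))
      (z : EuclideanSpace ℝ (Fin n) × EuclideanSpace ℝ (Fin n)),
      NearlyOrthonormal (z.2 + a) b → ∀ R : ℝ, 1 ≤ R →
      bracket z.1 * (R⁻¹ * ∫ y in Set.Icc R (2 * R) ×ˢ Set.Icc (-Real.pi) Real.pi,
        bracket (planePoint a b z y) ^ (-1 - ε)) ≤ C * R ^ (-(ε / 8)) := by
  obtain ⟨C, hC, H⟩ := exists_planeIntegral_bracket_le (n := n) (half_pos hε)
  refine ⟨9 * (C + 64) + 8 * Real.pi, by positivity, fun a b z hz R hR => ?_⟩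
  have hb := bracket_pos z.1
  have hR0 : 0 < R := by linarith
  have hRε : 0 < R ^ (-(ε / 8)) := by positivity
  rcases le_total ‖z.1‖ (8 * R) with hx | hx
  · set ρ := R ^ (1 / 4 : ℝ)
    have hρ : 0 < ρ := by positivity
    set U : Set (ℝ × ℝ) := {y | ‖planePoint a b z y‖ ≤ ρ}
    have hUm : MeasurableSet U :=
      (isClosed_le (continuous_planePoint a b z).norm continuous_const).measurableSet
    set Q : Set (ℝ × ℝ) := Set.Icc R (2 * R) ×ˢ Set.Icc (-Real.pi) Real.pi
    have hQ : IsCompact Q := isCompact_Icc.prod isCompact_Icc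
    have hpt : ∀ y ∈ Q, bracket (planePoint a b z y) ^ (-1 - ε)
        ≤ ρ ^ (-(ε / 2)) * bracket (planePoint a b z y) ^ (-1 - ε / 2)
          + R⁻¹ * U.indicator (fun y => y.1) y := by
      intro y hy
      have hX := bracket_pos (planePoint a b z y)
      by_cases hyU : y ∈ U
      · rw [Set.indicator_of_mem hyU]
        have h1 : 1 ≤ R⁻¹ * y.1 := by
          rw [inv_mul_eq_div, one_le_div hR0]; exact hy.1.1
        have h2 : bracket (planePoint a b z y) ^ (-1 - ε) ≤ 1 :=
          Real.rpow_le_one_of_one_le_of_nonpos (one_le_bracket _) (by linarith)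
        have h3 : 0 ≤ ρ ^ (-(ε / 2)) * bracket (planePoint a b z y) ^ (-1 - ε / 2) := by
          positivity
        linarith
      · rw [Set.indicator_of_notMem hyU, mul_zero, add_zero,
          show -1 - ε = -(ε / 2) + (-1 - ε / 2) by ring, Real.rpow_add hX]
        have h1 : ρ < ‖planePoint a b z y‖ := not_le.1 hyU
        have h2 : -(ε / 2) ≤ 0 := by linarith
        exact mul_le_mul_of_nonneg_right
          (Real.rpow_le_rpow_of_nonpos hρ (h1.le.trans (norm_le_bracket _)) h2) (by positivity)
    have hi1 : IntegrableOn (fun y => ρ ^ (-(ε / 2)) *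
        bracket (planePoint a b z y) ^ (-1 - ε / 2)) Q :=
      (integrableOn_bracket_planePoint a b z _ hQ).const_mul _
    have hi2 : IntegrableOn (fun y => R⁻¹ * U.indicator (fun y : ℝ × ℝ => y.1) y) Q := by
      refine Integrable.const_mul ?_ _
      exact (continuous_fst.continuousOn.integrableOn_compact hQ).indicator hUm
    have h1 : ∫ y in Q, bracket (planePoint a b z y) ^ (-1 - ε)
        ≤ ρ ^ (-(ε / 2)) * C + R⁻¹ * (64 * ρ ^ 2) := by
      calc ∫ y in Q, bracket (planePoint a b z y) ^ (-1 - ε)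
          ≤ ∫ y in Q, (ρ ^ (-(ε / 2)) * bracket (planePoint a b z y) ^ (-1 - ε / 2)
            + R⁻¹ * U.indicator (fun y => y.1) y) :=
            setIntegral_mono_on (integrableOn_bracket_planePoint a b z _ hQ) (hi1.add hi2)
              hQ.measurableSet hpt
        _ ≤ _ := by
            rw [integral_add hi1 hi2, integral_const_mul, integral_const_mul]
            exact add_le_add (mul_le_mul_of_nonneg_left (H a b z hz R (2 * R)) (by positivity))
              (mul_le_mul_of_nonneg_left (setIntegral_radius_indicator_le hz hR0 hρ.le)
                (by positivity))
    have h2 : ρ ^ (-(ε / 2)) = R ^ (-(ε / 8)) := by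
      rw [← Real.rpow_mul hR0.le]; congr 1; ring
    have h3 : R⁻¹ * (64 * ρ ^ 2) ≤ 64 * R ^ (-(ε / 8)) := by
      have : R⁻¹ * ρ ^ 2 = R ^ (-(1 / 2) : ℝ) := by
        rw [← Real.rpow_natCast, ← Real.rpow_mul hR0.le, ← Real.rpow_neg_one,
          ← Real.rpow_add hR0]
        norm_num
      have h4 : R ^ (-(1 / 2) : ℝ) ≤ R ^ (-(ε / 8)) :=
        Real.rpow_le_rpow_of_exponent_le hR (by linarith)
      nlinarith
    have h5 : bracket z.1 * R⁻¹ ≤ 9 := by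
      rw [← div_eq_mul_inv, div_le_iff₀ hR0]
      linarith [bracket_le_one_add_norm z.1]
    calc bracket z.1 * (R⁻¹ * ∫ y in Q, bracket (planePoint a b z y) ^ (-1 - ε))
        = (bracket z.1 * R⁻¹) * ∫ y in Q, bracket (planePoint a b z y) ^ (-1 - ε) := by ring
      _ ≤ 9 * (ρ ^ (-(ε / 2)) * C + R⁻¹ * (64 * ρ ^ 2)) :=
          mul_le_mul h5 h1 (integral_nonneg fun y => Real.rpow_nonneg (bracket_pos _).le _)
            (by norm_num)
      _ ≤ 9 * (R ^ (-(ε / 8)) * C + 64 * R ^ (-(ε / 8))) := by rw [h2]; linarith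
      _ ≤ _ := by nlinarith [Real.pi_pos]
  · have h1 := setIntegral_bracket_far hz hε hε1 hR0.le (by linarith : R ≤ 2 * R) hx
    have h2 : bracket z.1 * bracket z.1 ^ (-1 - ε) ≤ R ^ (-(ε / 8)) := by
      rw [show -1 - ε = -ε - 1 by ring, Real.rpow_sub_one hb.ne', mul_div_cancel₀ _ hb.ne']
      calc bracket z.1 ^ (-ε) ≤ R ^ (-ε) :=
            Real.rpow_le_rpow_of_nonpos hR0 (by linarith [norm_le_bracket z.1]) (by linarith)
        _ ≤ R ^ (-(ε / 8)) := Real.rpow_le_rpow_of_exponent_le hR (by linarith)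
    calc _ ≤ bracket z.1 * (R⁻¹ * (4 * bracket z.1 ^ (-1 - ε) *
            ((2 * R - R) * (2 * Real.pi)))) :=
          mul_le_mul_of_nonneg_left (mul_le_mul_of_nonneg_left h1 (by positivity)) hb.le
      _ = (bracket z.1 * bracket z.1 ^ (-1 - ε)) * (8 * Real.pi) := by field_simp; ring
      _ ≤ R ^ (-(ε / 8)) * (8 * Real.pi) := mul_le_mul_of_nonneg_right h2 (by positivity)
      _ ≤ _ := by nlinarith [mul_nonneg hC hRε.le]

end PolarPlane

end SemiclassicalConjugation

/-! ### The inverse of the Cauchy–Riemann operator along planes -/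

namespace SemiclassicalConjugation

noncomputable section PlaneTransform

variable {n : ℕ}

/-- The integral of `B` with the kernel `k(r, θ)` over the polar rectangle `r ≤ 2R` of the plane
through `x` spanned by `ξ + a` and `b`, where `z = (x, ξ)`. -/
def planeTransform (k : ℝ × ℝ → ℂ) (R : ℝ) (a b : EuclideanSpace ℝ (Fin n))
    (B : EuclideanSpace ℝ (Fin n) → ℂ)
    (z : EuclideanSpace ℝ (Fin n) × EuclideanSpace ℝ (Fin n)) : ℂ :=
  ∫ y in polarBox R, k y * B (planePoint a b z y)

theorem contDiff_planeTransform_integrand {k : ℝ × ℝ → ℂ} (hk : ContDiff ℝ ∞ k)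
    (a b : EuclideanSpace ℝ (Fin n)) {B : EuclideanSpace ℝ (Fin n) → ℂ} (hB : ContDiff ℝ ∞ B) :
    ContDiff ℝ ∞ (fun p : (EuclideanSpace ℝ (Fin n) × EuclideanSpace ℝ (Fin n)) × (ℝ × ℝ) =>
      k p.2 * B (planePoint a b p.1 p.2)) :=
  (hk.comp contDiff_snd).mul (hB.comp (contDiff_planePoint a b))

/-- The point `planePoint a b z y` depends affinely on `z`, with linear part of norm at most
`1 + r`. -/
theorem planePoint_eq_affine (a b : EuclideanSpace ℝ (Fin n)) (y : ℝ × ℝ) :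
    ∃ (L : EuclideanSpace ℝ (Fin n) × EuclideanSpace ℝ (Fin n) →L[ℝ] EuclideanSpace ℝ (Fin n))
      (c : EuclideanSpace ℝ (Fin n)), ‖L‖ ≤ 1 + |y.1| ∧ ∀ z, planePoint a b z y = L z + c := by
  refine ⟨ContinuousLinearMap.fst ℝ _ _ + (y.1 * Real.cos y.2) • ContinuousLinearMap.snd ℝ _ _,
    y.1 • (Real.cos y.2 • a + Real.sin y.2 • b), ?_, fun z => ?_⟩
  · refine (norm_add_le _ _).trans (add_le_add (ContinuousLinearMap.norm_fst_le ..) ?_)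
    rw [norm_smul, norm_mul, Real.norm_eq_abs, Real.norm_eq_abs]
    have h1 := ContinuousLinearMap.norm_snd_le ℝ (EuclideanSpace ℝ (Fin n))
      (EuclideanSpace ℝ (Fin n))
    have h2 := Real.abs_cos_le_one y.2
    calc |y.1| * |Real.cos y.2| * _ ≤ |y.1| * 1 * 1 := by gcongr
      _ = |y.1| := by ring
  · simp only [planePoint, _root_.add_apply, smul_apply, ContinuousLinearMap.coe_fst',
      ContinuousLinearMap.coe_snd', smul_add, smul_smul]
    abel

/-- The weight is the transform of the decay rate of `B` by the majorant `K` of the kernel. Since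
`planePoint` is affine in `z` with linear part `O(R)`, a derivative costs `h^{-σ₀} R = h^{-(σ₀ + τ)}`. -/
theorem symbolBound_planeTransform {h₀ σ₀ τ ε : ℝ} (hh₀ : h₀ ≤ 1) (hτ : 0 ≤ τ)
    {B : ℝ → EuclideanSpace ℝ (Fin n) → ℂ}
    (hB : SymbolBound h₀ σ₀ (fun _ x => bracket x ^ (-1 - ε)) B)
    {k : ℝ → ℝ × ℝ → ℂ} {K : ℝ → ℝ × ℝ → ℝ} (hk : ∀ h ∈ Set.Ioc 0 h₀, ContDiff ℝ ∞ (k h))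
    (hkK : ∀ h ∈ Set.Ioc 0 h₀, ∀ y ∈ polarBox (h ^ (-τ)), ‖k h y‖ ≤ K h y)
    (hK : ∀ h ∈ Set.Ioc 0 h₀, IntegrableOn (K h) (polarBox (h ^ (-τ))))
    (a b : ℝ → EuclideanSpace ℝ (Fin n)) :
    SymbolBound h₀ (σ₀ + τ)
      (fun h z => ∫ y in polarBox (h ^ (-τ)), K h y * bracket (planePoint (a h) (b h) z y) ^ (-1 - ε))
      (fun h => planeTransform (k h) (h ^ (-τ)) (a h) (b h) (B h)) := by
  have hI : ∀ h ∈ Set.Ioc 0 h₀, _ := fun h hh =>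
    contDiff_setIntegral_of_contDiff (μ := volume) (isCompact_polarBox (h ^ (-τ)))
      (contDiff_planeTransform_integrand (hk h hh) (a h) (b h) (hB.1 h hh))
  refine ⟨fun h hh => (hI h hh).1, fun m => ?_⟩
  obtain ⟨C, hC, H⟩ := hB.2 m
  refine ⟨C * 3 ^ m, by positivity, fun h hh z => ?_⟩
  change ‖iteratedFDeriv ℝ m (fun z => ∫ y in polarBox (h ^ (-τ)),
    k h y * B h (planePoint (a h) (b h) z y)) z‖ ≤ _
  rw [(hI h hh).2 m z, ← integral_const_mul]
  have hh1 : h ≤ 1 := hh.2.trans hh₀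
  set R := h ^ (-τ)
  have hR : 1 ≤ R := Real.one_le_rpow_of_pos_of_le_one_of_nonpos hh.1 hh1 (by linarith)
  have hp : 0 ≤ h ^ (-σ₀) := Real.rpow_nonneg hh.1.le _
  refine norm_integral_le_of_norm_le (((hK h hh).mul_continuousOn
    (continuous_bracket_planePoint (a h) (b h) z _).continuousOn
      (isCompact_polarBox R)).const_mul _) ?_
  filter_upwards [ae_restrict_mem (isCompact_polarBox R).measurableSet] with y hy
  obtain ⟨L, c, hL, hLc⟩ := planePoint_eq_affine (a h) (b h) y
  have hL3 : ‖L‖ ≤ 3 * R := by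
    rw [abs_of_nonneg hy.1.1] at hL
    linarith [hy.1.2]
  have e1 : (fun z => k h y * B h (planePoint (a h) (b h) z y))
      = fun z => ContinuousLinearMap.mul ℝ ℂ (k h y) (B h (L z + c)) := by
    funext z; simp [hLc]
  have hBL : ContDiff ℝ ∞ (fun z => B h (L z + c)) :=
    (hB.1 h hh).comp (L.contDiff.add contDiff_const)
  have h1 := (ContinuousLinearMap.mul ℝ ℂ (k h y)).norm_iteratedFDeriv_comp_left
      (x := z) (f := fun z => B h (L z + c)) (n := m) (N := ∞) hBL.contDiffAt (mod_cast le_top)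
  have h2 := norm_iteratedFDeriv_comp_affine_le (hB.1 h hh) L c m z
  have h3 := H h hh (L z + c)
  have h4 : ‖ContinuousLinearMap.mul ℝ ℂ (k h y)‖ ≤ K h y :=
    (ContinuousLinearMap.opNorm_mul_apply_le ..).trans (hkK h hh y hy)
  have hbr := bracket_pos (planePoint (a h) (b h) z y)
  have hK0 : 0 ≤ K h y := (norm_nonneg _).trans h4
  rw [e1]
  refine h1.trans ?_
  calc _ ≤ K h y * (‖iteratedFDeriv ℝ m (B h) (L z + c)‖ * ‖L‖ ^ m) :=
        mul_le_mul h4 h2 (norm_nonneg _) hK0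
    _ ≤ K h y * ((C * (h ^ (-σ₀)) ^ m * bracket (L z + c) ^ (-1 - ε)) * (3 * R) ^ m) := by
        have hbr' := bracket_pos (L z + c)
        refine mul_le_mul_of_nonneg_left (mul_le_mul h3 (pow_le_pow_left₀ (norm_nonneg _) hL3 m)
          (by positivity) (by positivity)) hK0
    _ = C * 3 ^ m * (h ^ (-(σ₀ + τ))) ^ m *
          (K h y * bracket (planePoint (a h) (b h) z y) ^ (-1 - ε)) := by
        have : h ^ (-(σ₀ + τ)) = h ^ (-σ₀) * R := by
          rw [← Real.rpow_add hh.1]; congr 1; ring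
        rw [this, hLc z, mul_pow, mul_pow]
        ring

/-- A smooth cutoff on the line: `1` for `s ≤ 1` and `0` for `s ≥ 2`. -/
def radialCutoff (s : ℝ) : ℝ := Real.smoothTransition (2 - s)

theorem contDiff_radialCutoff : ContDiff ℝ ∞ radialCutoff :=
  Real.smoothTransition.contDiff.comp (contDiff_const.sub contDiff_id)

theorem radialCutoff_of_le_one {s : ℝ} (hs : s ≤ 1) : radialCutoff s = 1 :=
  Real.smoothTransition.one_of_one_le (by linarith)

theorem radialCutoff_of_two_le {s : ℝ} (hs : 2 ≤ s) : radialCutoff s = 0 :=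
  Real.smoothTransition.zero_of_nonpos (by linarith)

theorem radialCutoff_nonneg (s : ℝ) : 0 ≤ radialCutoff s := Real.smoothTransition.nonneg _

theorem radialCutoff_le_one (s : ℝ) : radialCutoff s ≤ 1 := Real.smoothTransition.le_one _

theorem deriv_radialCutoff_of_lt_one {s : ℝ} (hs : s < 1) : deriv radialCutoff s = 0 := by
  have : radialCutoff =ᶠ[nhds s] fun _ => 1 := by
    filter_upwards [gt_mem_nhds hs] with t ht using radialCutoff_of_le_one ht.le
  rw [this.deriv_eq, deriv_const]

/-- The kernel `e^{-iθ} η(r/R)`, that is, `r/(y₁ + i y₂)` with a radial cutoff. -/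
def cauchyKernel (R : ℝ) (y : ℝ × ℝ) : ℂ :=
  Complex.exp (-(Complex.I * y.2)) * (radialCutoff (y.1 / R) : ℝ)

/-- The kernel `∂_r η(r/R)`, which is supported in `R ≤ r ≤ 2R`. -/
def cutoffKernel (R : ℝ) (y : ℝ × ℝ) : ℂ := ((deriv radialCutoff (y.1 / R) / R : ℝ) : ℂ)

theorem contDiff_cauchyKernel (R : ℝ) : ContDiff ℝ ∞ (cauchyKernel R) := by
  have h1 : ContDiff ℝ ∞ fun y : ℝ × ℝ => radialCutoff (y.1 / R) :=
    contDiff_radialCutoff.comp (contDiff_fst.div_const R)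
  have h2 : ContDiff ℝ ∞ fun y : ℝ × ℝ => ((radialCutoff (y.1 / R) : ℝ) : ℂ) :=
    Complex.ofRealCLM.contDiff.comp h1
  have h3 : ContDiff ℝ ∞ fun y : ℝ × ℝ => ((y.2 : ℝ) : ℂ) :=
    Complex.ofRealCLM.contDiff.comp contDiff_snd
  exact ((contDiff_const.mul h3).neg.cexp).mul h2

theorem contDiff_cutoffKernel (R : ℝ) : ContDiff ℝ ∞ (cutoffKernel R) := by
  have h0 : ContDiff ℝ ∞ (deriv radialCutoff) :=
    ((contDiff_infty_iff_deriv (𝕜 := ℝ)).1 contDiff_radialCutoff).2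
  exact Complex.ofRealCLM.contDiff.comp ((h0.comp (contDiff_fst.div_const R)).div_const R)

theorem norm_cauchyKernel_le (R : ℝ) (y : ℝ × ℝ) : ‖cauchyKernel R y‖ ≤ 1 := by
  rw [cauchyKernel, norm_mul, show -(Complex.I * (y.2 : ℂ)) = ((-y.2 : ℝ) : ℂ) * Complex.I by
    push_cast; ring, Complex.norm_exp_ofReal_mul_I, one_mul, Complex.norm_real,
    Real.norm_of_nonneg (radialCutoff_nonneg _)]
  exact radialCutoff_le_one _

theorem exists_norm_cutoffKernel_le : ∃ C : ℝ, 0 ≤ C ∧ ∀ R : ℝ, 0 < R → ∀ y ∈ polarBox R,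
    ‖cutoffKernel R y‖ ≤ C * (R⁻¹ * (Set.Icc R (2 * R) ×ˢ Set.Icc (-Real.pi) Real.pi).indicator
      (fun _ => 1) y) := by
  obtain ⟨C, hC⟩ := (isCompact_Icc (a := (0 : ℝ)) (b := 2)).exists_bound_of_continuousOn
    (contDiff_radialCutoff.continuous_deriv (mod_cast le_top)).continuousOn
  refine ⟨C, (norm_nonneg _).trans (hC 0 (by simp)), fun R hR y hy => ?_⟩
  rw [cutoffKernel, Complex.norm_real, norm_div, Real.norm_of_nonneg hR.le]
  by_cases h : R ≤ y.1
  · rw [Set.indicator_of_mem (show y ∈ Set.Icc R (2 * R) ×ˢ Set.Icc (-Real.pi) Real.pi from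
      ⟨⟨h, hy.1.2⟩, hy.2⟩), mul_one, ← div_eq_mul_inv]
    gcongr
    refine hC _ ⟨div_nonneg hy.1.1 hR.le, ?_⟩
    rw [div_le_iff₀ hR]; exact hy.1.2
  · rw [Set.indicator_of_notMem (fun h' => h h'.1.1),
      deriv_radialCutoff_of_lt_one (by rw [div_lt_one hR]; exact not_le.1 h)]
    simp

/-- Directional derivatives in `x` may be taken under the integral sign. -/
theorem fderiv_planeTransform {k : ℝ × ℝ → ℂ} (hk : ContDiff ℝ ∞ k) (R : ℝ)
    (a b : EuclideanSpace ℝ (Fin n)) {B : EuclideanSpace ℝ (Fin n) → ℂ} (hB : ContDiff ℝ ∞ B)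
    (z : EuclideanSpace ℝ (Fin n) × EuclideanSpace ℝ (Fin n)) (e : EuclideanSpace ℝ (Fin n)) :
    fderiv ℝ (planeTransform k R a b B) z (e, 0)
      = ∫ y in polarBox R, k y * fderiv ℝ B (planePoint a b z y) e := by
  have hf := contDiff_planeTransform_integrand hk a b hB
  have h1 := (contDiff_setIntegral_of_contDiff (μ := volume) (isCompact_polarBox R) hf).2 1 z
  have hint : IntegrableOn (fun y => iteratedFDeriv ℝ 1
      (fun z => k y * B (planePoint a b z y)) z) (polarBox R) :=
    ((continuous_iteratedFDeriv_partial hf 1).comp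
      (Continuous.prodMk_right z)).continuousOn.integrableOn_compact (isCompact_polarBox R)
  have h2 := congrArg (fun T => T (fun _ : Fin 1 => (e, 0))) h1
  rw [ContinuousMultilinearMap.integral_apply hint] at h2
  simp only [iteratedFDeriv_one_apply] at h2
  refine h2.trans (integral_congr_ae (Filter.Eventually.of_forall fun y => ?_))
  have hpp : HasFDerivAt (fun z => planePoint a b z y)
      (ContinuousLinearMap.fst ℝ (EuclideanSpace ℝ (Fin n)) (EuclideanSpace ℝ (Fin n))
        + y.1 • Real.cos y.2 • ContinuousLinearMap.snd ℝ _ _) z := by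
    unfold planePoint
    exact hasFDerivAt_fst.add ((((hasFDerivAt_snd.add_const a).const_smul
      (Real.cos y.2)).add_const (Real.sin y.2 • b)).const_smul y.1)
  have hBd := ((hB.differentiable (by simp)) (planePoint a b z y)).hasFDerivAt
  have h3 := ((hBd.comp z hpp).const_mul (k y)).fderiv
  simp only [Function.comp_def] at h3
  beta_reduce
  rw [h3]
  simp

/-- On circles around `x` the tangential part of the Cauchy–Riemann operator integrates to zero. -/
theorem integral_tangential_eq_zero {B : EuclideanSpace ℝ (Fin n) → ℂ} (hB : ContDiff ℝ ∞ B)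
    (x v b : EuclideanSpace ℝ (Fin n)) {r : ℝ} (hr : r ≠ 0) :
    ∫ θ in (-Real.pi)..Real.pi, fderiv ℝ B (x + r • (Real.cos θ • v + Real.sin θ • b))
      (-Real.sin θ • v + Real.cos θ • b) = 0 := by
  have hd : ∀ θ : ℝ, HasDerivAt (fun θ => B (x + r • (Real.cos θ • v + Real.sin θ • b)))
      (r • fderiv ℝ B (x + r • (Real.cos θ • v + Real.sin θ • b))
        (-Real.sin θ • v + Real.cos θ • b)) θ := by
    intro θ
    have h1 : HasDerivAt (fun θ : ℝ => x + r • (Real.cos θ • v + Real.sin θ • b))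
        (r • (-Real.sin θ • v + Real.cos θ • b)) θ :=
      ((((Real.hasDerivAt_cos θ).smul_const v).add
        ((Real.hasDerivAt_sin θ).smul_const b)).const_smul r).const_add x
    have h2 := ((hB.differentiable (by simp)) (x + r • (Real.cos θ • v + Real.sin θ • b))
      ).hasFDerivAt.comp_hasDerivAt θ h1
    rwa [map_smul] at h2
  have hBd : Continuous fun p : EuclideanSpace ℝ (Fin n) × EuclideanSpace ℝ (Fin n) =>
      fderiv ℝ B p.1 p.2 :=
    ((hB.continuous_fderiv (by simp)).comp continuous_fst).clm_apply continuous_snd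
  have hc : Continuous fun θ : ℝ => fderiv ℝ B (x + r • (Real.cos θ • v + Real.sin θ • b))
      (-Real.sin θ • v + Real.cos θ • b) :=
    hBd.comp (f := fun θ : ℝ => (x + r • (Real.cos θ • v + Real.sin θ • b),
      -Real.sin θ • v + Real.cos θ • b)) (by fun_prop)
  have h3 := intervalIntegral.integral_eq_sub_of_hasDerivAt (a := -Real.pi) (b := Real.pi)
    (fun θ _ => hd θ) ((hc.const_smul r).intervalIntegrable _ _)
  rw [intervalIntegral.integral_smul] at h3
  simpa [hr] using h3

/-- Radial part of the Cauchy–Riemann operator: the fundamental theorem of calculus on a ray. -/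
theorem integral_radial {B : EuclideanSpace ℝ (Fin n) → ℂ} (hB : ContDiff ℝ ∞ B)
    (x w : EuclideanSpace ℝ (Fin n)) {R : ℝ} (hR : 0 < R) :
    ∫ r in (0 : ℝ)..(2 * R), (radialCutoff (r / R) : ℂ) * fderiv ℝ B (x + r • w) w
      = -B x - ∫ r in (0 : ℝ)..(2 * R), ((deriv radialCutoff (r / R) / R : ℝ) : ℂ) * B (x + r • w) := by
  have hu : ∀ r ∈ Set.uIcc 0 (2 * R), HasDerivAt (fun r => (radialCutoff (r / R) : ℂ))
      ((deriv radialCutoff (r / R) / R : ℝ) : ℂ) r := fun r _ => by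
    have h1 := ((contDiff_radialCutoff.differentiable (by simp)) (r / R)).hasDerivAt
    have h2 : HasDerivAt (fun r : ℝ => r / R) (1 / R) r := (hasDerivAt_id r).div_const R
    have h3 := (h1.comp r h2).ofReal_comp
    rwa [mul_one_div] at h3
  have hv : ∀ r ∈ Set.uIcc 0 (2 * R), HasDerivAt (fun r : ℝ => B (x + r • w))
      (fderiv ℝ B (x + r • w) w) r := fun r _ => by
    have h1 : HasDerivAt (fun r : ℝ => x + r • w) w r := by
      simpa using ((hasDerivAt_id r).smul_const w).const_add x
    exact ((hB.differentiable (by simp)) (x + r • w)).hasFDerivAt.comp_hasDerivAt r h1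
  have hc1 : Continuous fun r : ℝ => ((deriv radialCutoff (r / R) / R : ℝ) : ℂ) := by
    have h0 := contDiff_radialCutoff.continuous_deriv (mod_cast le_top)
    exact Complex.continuous_ofReal.comp
      ((h0.comp (continuous_id.div_const R)).div_const R)
  have hc2 : Continuous fun r : ℝ => fderiv ℝ B (x + r • w) w :=
    ((hB.continuous_fderiv (by simp)).comp (by fun_prop)).clm_apply continuous_const
  rw [intervalIntegral.integral_mul_deriv_eq_deriv_mul hu hv (hc1.intervalIntegrable _ _)
    (hc2.intervalIntegrable _ _)]
  rw [mul_div_assoc, div_self hR.ne', mul_one, radialCutoff_of_two_le le_rfl, zero_div,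
    radialCutoff_of_le_one zero_le_one]
  simp

/-- The transform with kernel `e^{-iθ} η(r/R)` inverts `(v + i b)·∇_x`, `v = ξ + a`, up to the
factor `-2π` and an error that lives at radius `R ≤ r ≤ 2R`. In polar coordinates
`e^{-iθ} (v + i b)·∇ = ∂_r + (i/r) ∂_θ`. -/
theorem cauchyRiemann_planeTransform {B : EuclideanSpace ℝ (Fin n) → ℂ} (hB : ContDiff ℝ ∞ B)
    {R : ℝ} (hR : 0 < R) (a b : EuclideanSpace ℝ (Fin n))
    (z : EuclideanSpace ℝ (Fin n) × EuclideanSpace ℝ (Fin n)) :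
    fderiv ℝ (planeTransform (cauchyKernel R) R a b B) z (z.2 + a, 0)
      + Complex.I * fderiv ℝ (planeTransform (cauchyKernel R) R a b B) z (b, 0)
      = -(2 * Real.pi) * B z.1 - planeTransform (cutoffKernel R) R a b B z := by
  have hpi := Real.pi_pos
  set v := z.2 + a with hv
  rw [fderiv_planeTransform (contDiff_cauchyKernel R) R a b hB,
    fderiv_planeTransform (contDiff_cauchyKernel R) R a b hB, ← integral_const_mul]
  have hBd : Continuous fun p : EuclideanSpace ℝ (Fin n) × EuclideanSpace ℝ (Fin n) =>
      fderiv ℝ B p.1 p.2 :=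
    ((hB.continuous_fderiv (by simp)).comp continuous_fst).clm_apply continuous_snd
  have hpp := continuous_planePoint a b z
  have hck := (contDiff_cauchyKernel R).continuous
  have hcut : Continuous fun y : ℝ × ℝ => (radialCutoff (y.1 / R) : ℂ) :=
    Complex.continuous_ofReal.comp (contDiff_radialCutoff.continuous.comp
      (continuous_fst.div_const R))
  set f₁ : ℝ × ℝ → ℂ := fun y => (radialCutoff (y.1 / R) : ℂ) *
    fderiv ℝ B (planePoint a b z y) (Real.cos y.2 • v + Real.sin y.2 • b)
  set f₂ : ℝ × ℝ → ℂ := fun y => (radialCutoff (y.1 / R) : ℂ) *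
    fderiv ℝ B (planePoint a b z y) (-Real.sin y.2 • v + Real.cos y.2 • b)
  have hf₁ : Continuous f₁ := hcut.mul (hBd.comp (f := fun y : ℝ × ℝ => (planePoint a b z y,
    Real.cos y.2 • v + Real.sin y.2 • b)) (by fun_prop))
  have hf₂ : Continuous f₂ := hcut.mul (hBd.comp (f := fun y : ℝ × ℝ => (planePoint a b z y,
    -Real.sin y.2 • v + Real.cos y.2 • b)) (by fun_prop))
  have hio : ∀ f : ℝ × ℝ → ℂ, Continuous f → IntegrableOn f (polarBox R) := fun f hf =>
    hf.continuousOn.integrableOn_compact (isCompact_polarBox R)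
  have hBv : ∀ e : EuclideanSpace ℝ (Fin n), Continuous fun y : ℝ × ℝ =>
      cauchyKernel R y * fderiv ℝ B (planePoint a b z y) e := fun e =>
    hck.mul (hBd.comp (f := fun y : ℝ × ℝ => (planePoint a b z y, e)) (by fun_prop))
  have hBb : Continuous fun y : ℝ × ℝ =>
      Complex.I * (cauchyKernel R y * fderiv ℝ B (planePoint a b z y) b) :=
    continuous_const.mul (hBv b)
  rw [← integral_add (hio _ (hBv v)) (hio _ hBb)]
  have e1 : (fun y : ℝ × ℝ => cauchyKernel R y * fderiv ℝ B (planePoint a b z y) v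
      + Complex.I * (cauchyKernel R y * fderiv ℝ B (planePoint a b z y) b))
      = fun y => f₁ y + Complex.I * f₂ y := by
    funext y
    simp only [f₁, f₂, map_add, map_smul, cauchyKernel, neg_smul, map_neg, Complex.real_smul]
    have hexp : Complex.exp (-(Complex.I * y.2))
        = Real.cos y.2 - Complex.I * Real.sin y.2 := by
      rw [show -(Complex.I * (y.2 : ℂ)) = ((-y.2 : ℝ) : ℂ) * Complex.I by push_cast; ring,
        Complex.exp_mul_I, ← Complex.ofReal_cos, ← Complex.ofReal_sin, Real.cos_neg,
        Real.sin_neg]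
      push_cast; ring
    rw [hexp]
    linear_combination (-(radialCutoff (y.1 / R) : ℂ) * Real.sin y.2
      * fderiv ℝ B (planePoint a b z y) b) * Complex.I_sq
  have hf₂I : Continuous fun y => Complex.I * f₂ y := continuous_const.mul hf₂
  rw [e1, integral_add (hio _ hf₁) (hio _ hf₂I), integral_const_mul]
  have hi2 : ∫ y in polarBox R, f₂ y = 0 := by
    rw [polarBox, Measure.volume_eq_prod, setIntegral_prod _ (hio _ hf₂)]
    have : ∀ᵐ r ∂(volume.restrict (Set.Icc 0 (2 * R))),
        ∫ θ in Set.Icc (-Real.pi) Real.pi, f₂ (r, θ) = 0 := by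
      have hne : ∀ᵐ r ∂(volume.restrict (Set.Icc 0 (2 * R))), r ≠ 0 :=
        ae_restrict_of_ae (Measure.ae_ne volume 0)
      filter_upwards [hne] with r hr
      have h1 := integral_tangential_eq_zero hB z.1 v b hr
      rw [intervalIntegral.integral_of_le (by linarith), ← integral_Icc_eq_integral_Ioc] at h1
      simp only [f₂, planePoint]
      rw [integral_const_mul, h1, mul_zero]
    rw [integral_congr_ae this, integral_zero]
  set g : ℝ × ℝ → ℂ := fun y => cutoffKernel R y * B (planePoint a b z y)
  have hg : Continuous g := (contDiff_cutoffKernel R).continuous.mul (hB.continuous.comp hpp)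
  have hi1 : ∫ y in polarBox R, f₁ y = -(2 * Real.pi) * B z.1 - ∫ y in polarBox R, g y := by
    have hsymm : ∀ f : ℝ × ℝ → ℂ, Continuous f → ∫ y in polarBox R, f y
        = ∫ θ in Set.Icc (-Real.pi) Real.pi, ∫ r in Set.Icc 0 (2 * R), f (r, θ) := fun f hf => by
      rw [polarBox, Measure.volume_eq_prod, ← Measure.prod_restrict,
        integral_prod_symm _ (by
          rw [Measure.prod_restrict, ← Measure.volume_eq_prod]; exact hio f hf)]
    have hgi : Integrable (fun θ => ∫ r in Set.Icc 0 (2 * R), g (r, θ))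
        (volume.restrict (Set.Icc (-Real.pi) Real.pi)) := by
      refine Integrable.integral_prod_right (f := g) ?_
      rw [Measure.prod_restrict, ← Measure.volume_eq_prod]
      exact hio g hg
    rw [hsymm f₁ hf₁, hsymm g hg]
    have hθ : ∀ θ : ℝ, ∫ r in Set.Icc 0 (2 * R), f₁ (r, θ)
        = -B z.1 - ∫ r in Set.Icc 0 (2 * R), g (r, θ) := fun θ => by
      have h1 := integral_radial hB z.1 (Real.cos θ • v + Real.sin θ • b) hR
      rwa [intervalIntegral.integral_of_le (by linarith),
        intervalIntegral.integral_of_le (by linarith), ← integral_Icc_eq_integral_Ioc,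
        ← integral_Icc_eq_integral_Ioc] at h1
    simp_rw [hθ]
    rw [integral_sub (integrable_const _) hgi, setIntegral_const, Measure.real,
      Real.volume_Icc, ENNReal.toReal_ofReal (by linarith), Complex.real_smul]
    push_cast; ring
  rw [hi1, hi2, mul_zero, add_zero]
  rfl

end PlaneTransform

end SemiclassicalConjugation

/-! ### The symbol of `P` and its characteristic set -/

namespace SemiclassicalConjugation

noncomputable section CharSymbol

variable {n : ℕ}

/-- The real part of `ρ̂ = hρ`. -/
def freqRe (h : ℝ) (ρ : EuclideanSpace ℂ (Fin n)) : EuclideanSpace ℝ (Fin n) :=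
  WithLp.toLp 2 fun j => h * (ρ j).re

/-- The imaginary part of `ρ̂ = hρ`. -/
def freqIm (h : ℝ) (ρ : EuclideanSpace ℂ (Fin n)) : EuclideanSpace ℝ (Fin n) :=
  WithLp.toLp 2 fun j => h * (ρ j).im

/-- The symbol `p(ξ) = |ξ|² + 2 ρ̂·ξ` of `P`. -/
def charSymbol (h : ℝ) (ρ : EuclideanSpace ℂ (Fin n)) (ξ : EuclideanSpace ℝ (Fin n)) : ℂ :=
  ∑ j, ((ξ j : ℂ) * ξ j + 2 * (h * ρ j) * ξ j)

theorem freq_norm {lam h : ℝ} (hlam : 0 < lam) {ρ : EuclideanSpace ℂ (Fin n)}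
    (hρ : IsFrequency lam h ρ) :
    ‖freqRe h ρ‖ ^ 2 = 1 ∧ ‖freqIm h ρ‖ ^ 2 = 1 - h ^ 2 * lam ∧
      inner ℝ (freqRe h ρ) (freqIm h ρ) = 0 := by
  obtain ⟨h1, h2⟩ := hρ
  have hT : 0 < (‖ρ‖ ^ 2 + lam) / 2 := by positivity
  have h3 : h ^ 2 * (‖ρ‖ ^ 2 + lam) = 2 := by
    have : h ^ 2 = ((‖ρ‖ ^ 2 + lam) / 2)⁻¹ := by
      conv_lhs => rw [h2]
      rw [← Real.rpow_natCast, ← Real.rpow_mul hT.le, ← Real.rpow_neg_one]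
      norm_num
    rw [this]; field_simp
  have hre := congrArg Complex.re h1
  have him := congrArg Complex.im h1
  simp only [Complex.re_sum, Complex.im_sum, Complex.mul_re, Complex.mul_im, Complex.ofReal_re,
    Complex.ofReal_im] at hre him
  have hn : ‖ρ‖ ^ 2 = ∑ j, ((ρ j).re * (ρ j).re + (ρ j).im * (ρ j).im) := by
    rw [EuclideanSpace.norm_sq_eq]
    exact Finset.sum_congr rfl fun j _ => by rw [Complex.sq_norm, Complex.normSq_apply]
  have ha : ‖freqRe h ρ‖ ^ 2 = h ^ 2 * ∑ j, (ρ j).re * (ρ j).re := by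
    rw [EuclideanSpace.norm_sq_eq, Finset.mul_sum]
    exact Finset.sum_congr rfl fun j _ => by
      simp only [freqRe, Real.norm_eq_abs, sq_abs]; ring
  have hb : ‖freqIm h ρ‖ ^ 2 = h ^ 2 * ∑ j, (ρ j).im * (ρ j).im := by
    rw [EuclideanSpace.norm_sq_eq, Finset.mul_sum]
    exact Finset.sum_congr rfl fun j _ => by
      simp only [freqIm, Real.norm_eq_abs, sq_abs]; ring
  rw [Finset.sum_sub_distrib] at hre
  rw [Finset.sum_add_distrib] at him hn
  refine ⟨?_, ?_, ?_⟩
  · rw [ha]; rw [hn] at h3; nlinarith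
  · rw [hb]; rw [hn] at h3; nlinarith
  · have e : inner ℝ (freqRe h ρ) (freqIm h ρ) = h ^ 2 * ∑ j, (ρ j).re * (ρ j).im := by
      rw [PiLp.inner_apply, Finset.mul_sum]
      exact Finset.sum_congr rfl fun j _ => by
        simp only [freqRe, freqIm, RCLike.inner_apply, conj_trivial]; ring
    have h4 : ∑ j, (ρ j).im * (ρ j).re = ∑ j, (ρ j).re * (ρ j).im :=
      Finset.sum_congr rfl fun j _ => mul_comm _ _
    rw [e]
    rw [h4] at him
    have h5 : ∑ j, (ρ j).re * (ρ j).im = 0 := by linarith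
    rw [h5, mul_zero]

theorem norm_freq_component_le {lam h : ℝ} (hlam : 0 < lam) (hh : 0 < h)
    {ρ : EuclideanSpace ℂ (Fin n)} (hρ : IsFrequency lam h ρ) (j : Fin n) :
    ‖(h : ℂ) * ρ j‖ ≤ 2 := by
  obtain ⟨h1, h2, -⟩ := freq_norm hlam hρ
  have h3 := PiLp.norm_apply_le (freqRe h ρ) j
  have h4 := PiLp.norm_apply_le (freqIm h ρ) j
  have h5 : ‖freqRe h ρ‖ ≤ 1 := by nlinarith [norm_nonneg (freqRe h ρ)]
  have h6 : ‖freqIm h ρ‖ ≤ 1 := by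
    have : 0 < h ^ 2 * lam := by positivity
    nlinarith [norm_nonneg (freqIm h ρ)]
  have h7 := Complex.norm_le_abs_re_add_abs_im ((h : ℂ) * ρ j)
  simp only [Complex.mul_re, Complex.mul_im, Complex.ofReal_re, Complex.ofReal_im, zero_mul,
    sub_zero, add_zero] at h7
  simp only [freqRe, freqIm, Real.norm_eq_abs] at h3 h4 h5 h6
  linarith

theorem charSymbol_re (h : ℝ) (ρ : EuclideanSpace ℂ (Fin n)) (ξ : EuclideanSpace ℝ (Fin n)) :
    (charSymbol h ρ ξ).re = ‖ξ‖ ^ 2 + 2 * inner ℝ (freqRe h ρ) ξ := by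
  rw [charSymbol, Complex.re_sum, EuclideanSpace.norm_sq_eq, PiLp.inner_apply, Finset.mul_sum,
    ← Finset.sum_add_distrib]
  refine Finset.sum_congr rfl fun j _ => ?_
  simp [freqRe]
  ring

theorem charSymbol_im (h : ℝ) (ρ : EuclideanSpace ℂ (Fin n)) (ξ : EuclideanSpace ℝ (Fin n)) :
    (charSymbol h ρ ξ).im = 2 * inner ℝ (freqIm h ρ) ξ := by
  rw [charSymbol, Complex.im_sum, PiLp.inner_apply, Finset.mul_sum]
  refine Finset.sum_congr rfl fun j _ => ?_
  simp [freqIm]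
  ring

/-- Near the characteristic set the vectors `ξ + Re ρ̂` and `Im ρ̂` are nearly orthonormal. -/
theorem nearlyOrthonormal_of_normSq_charSymbol_le {lam h : ℝ} (hlam : 0 < lam) (hh : 0 < h)
    (hh4 : h ^ 2 * lam ≤ 1 / 4) {ρ : EuclideanSpace ℂ (Fin n)} (hρ : IsFrequency lam h ρ)
    {ξ : EuclideanSpace ℝ (Fin n)} (hξ : Complex.normSq (charSymbol h ρ ξ) ≤ 1 / 100) :
    NearlyOrthonormal (ξ + freqRe h ρ) (freqIm h ρ) := by
  obtain ⟨h1, h2, h3⟩ := freq_norm hlam hρ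
  rw [Complex.normSq_apply] at hξ
  have hre := charSymbol_re h ρ ξ
  have him := charSymbol_im h ρ ξ
  set u := (charSymbol h ρ ξ).re
  set v := (charSymbol h ρ ξ).im
  have hu := abs_le_of_sq_le_sq' (by nlinarith [mul_self_nonneg v] : u ^ 2 ≤ (1 / 10) ^ 2)
    (by norm_num)
  have hv := abs_le_of_sq_le_sq' (by nlinarith [mul_self_nonneg u] : v ^ 2 ≤ (1 / 10) ^ 2)
    (by norm_num)
  have hpos : 0 < h ^ 2 * lam := by positivity
  have hV : ‖ξ + freqRe h ρ‖ ^ 2 = 1 + u := by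
    rw [norm_add_sq_real, h1, hre, real_inner_comm]; ring
  have hVb : inner ℝ (ξ + freqRe h ρ) (freqIm h ρ) = v / 2 := by
    rw [inner_add_left, h3, him, real_inner_comm]; ring
  intro s t
  have e : ‖s • (ξ + freqRe h ρ) + t • freqIm h ρ‖ ^ 2
      = s ^ 2 * (1 + u) + s * t * v + t ^ 2 * (1 - h ^ 2 * lam) := by
    rw [norm_add_sq_real, norm_smul, norm_smul, mul_pow, mul_pow, hV, h2, inner_smul_left,
      inner_smul_right, hVb, Real.norm_eq_abs, Real.norm_eq_abs, sq_abs, sq_abs]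
    simp only [conj_trivial]; ring
  have hst : |s * t * v| ≤ (s ^ 2 + t ^ 2) / 20 := by
    rw [abs_mul]
    have h5 : |s * t| ≤ (s ^ 2 + t ^ 2) / 2 := by
      rw [abs_le]; constructor <;> nlinarith [sq_nonneg (s - t), sq_nonneg (s + t)]
    have h6 : |v| ≤ 1 / 10 := abs_le.2 hv
    calc |s * t| * |v| ≤ (s ^ 2 + t ^ 2) / 2 * (1 / 10) := by gcongr
      _ = _ := by ring
  have hst' := abs_le.1 hst
  rw [e]
  constructor
  · nlinarith [mul_nonneg (sq_nonneg s) (by linarith : (0 : ℝ) ≤ 1 / 10 + u),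
      mul_nonneg (sq_nonneg t) (by linarith : (0 : ℝ) ≤ 1 / 4 - h ^ 2 * lam), sq_nonneg s,
      sq_nonneg t]
  · nlinarith [mul_nonneg (sq_nonneg s) (by linarith : (0 : ℝ) ≤ 1 / 10 - u),
      mul_nonneg (sq_nonneg t) hpos.le, sq_nonneg s, sq_nonneg t]

theorem bracket_sq_le_charSymbol {lam h : ℝ} (hlam : 0 < lam)
    {ρ : EuclideanSpace ℂ (Fin n)} (hρ : IsFrequency lam h ρ) (ξ : EuclideanSpace ℝ (Fin n)) :
    bracket ξ ^ 2 ≤ 5 * (1 + ‖charSymbol h ρ ξ‖) := by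
  obtain ⟨h1, -, -⟩ := freq_norm hlam hρ
  have ha : ‖freqRe h ρ‖ ≤ 1 := by nlinarith [norm_nonneg (freqRe h ρ)]
  have h2 := (abs_le.1 (abs_real_inner_le_norm (freqRe h ρ) ξ)).1
  have h3 : ‖freqRe h ρ‖ * ‖ξ‖ ≤ 1 * ‖ξ‖ := by gcongr
  have h4 := (le_abs_self _).trans (Complex.abs_re_le_norm (charSymbol h ρ ξ))
  rw [charSymbol_re] at h4
  rw [bracket_sq]
  nlinarith [sq_nonneg (‖ξ‖ - 2), norm_nonneg (charSymbol h ρ ξ)]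

/-- A smooth cutoff on `[0, ∞)`: `1` on `[0, 1/200]` and `0` on `[1/100, ∞)`. Applied to `|p|²`, its
support lies in the region of `nearlyOrthonormal_of_normSq_charSymbol_le`. -/
def charCutoff (s : ℝ) : ℝ := Real.smoothTransition (2 - 200 * s)

theorem contDiff_charCutoff : ContDiff ℝ ∞ charCutoff :=
  Real.smoothTransition.contDiff.comp (contDiff_const.sub (contDiff_const.mul contDiff_id))

theorem charCutoff_of_le {s : ℝ} (hs : s ≤ 1 / 200) : charCutoff s = 1 :=
  Real.smoothTransition.one_of_one_le (by linarith)

theorem charCutoff_of_ge {s : ℝ} (hs : 1 / 100 ≤ s) : charCutoff s = 0 :=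
  Real.smoothTransition.zero_of_nonpos (by linarith)

theorem charCutoff_nonneg (s : ℝ) : 0 ≤ charCutoff s := Real.smoothTransition.nonneg _

theorem iteratedFDeriv_charCutoff_of_gt (k : ℕ) {s : ℝ} (hs : 1 / 100 < s) :
    iteratedFDeriv ℝ k charCutoff s = 0 := by
  have : charCutoff =ᶠ[nhds s] fun _ => 0 := by
    filter_upwards [lt_mem_nhds hs] with t ht using charCutoff_of_ge ht.le
  rw [(this.iteratedFDeriv ℝ k).eq_of_nhds]
  exact congrFun (iteratedFDeriv_fun_zero (𝕜 := ℝ) (n := k)) s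

/-- A positive replacement of `|p|²`, equal to it away from the characteristic set. -/
def regSq (h : ℝ) (ρ : EuclideanSpace ℂ (Fin n)) (ξ : EuclideanSpace ℝ (Fin n)) : ℝ :=
  Complex.normSq (charSymbol h ρ ξ) + charCutoff (Complex.normSq (charSymbol h ρ ξ))

/-- The cutoff `m(ξ)` to a neighbourhood of the characteristic set. -/
def microCutoff (h : ℝ) (ρ : EuclideanSpace ℂ (Fin n)) (ξ : EuclideanSpace ℝ (Fin n)) : ℝ :=
  charCutoff (Complex.normSq (charSymbol h ρ ξ)) * (regSq h ρ ξ) ^ (-1 : ℝ)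

/-- The smooth quotient `(1 - m(ξ)) / p(ξ)`. -/
def parametrix (h : ℝ) (ρ : EuclideanSpace ℂ (Fin n)) (ξ : EuclideanSpace ℝ (Fin n)) : ℂ :=
  (starRingEnd ℂ) (charSymbol h ρ ξ) * (((regSq h ρ ξ) ^ (-1 : ℝ) : ℝ) : ℂ)

theorem le_regSq (h : ℝ) (ρ : EuclideanSpace ℂ (Fin n)) (ξ : EuclideanSpace ℝ (Fin n)) :
    (1 + Complex.normSq (charSymbol h ρ ξ)) / 201 ≤ regSq h ρ ξ := by
  have h0 := Complex.normSq_nonneg (charSymbol h ρ ξ)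
  have h1 := charCutoff_nonneg (Complex.normSq (charSymbol h ρ ξ))
  rw [regSq]
  rcases le_total (Complex.normSq (charSymbol h ρ ξ)) (1 / 200) with h2 | h2
  · rw [charCutoff_of_le h2]; linarith
  · linarith

theorem regSq_pos (h : ℝ) (ρ : EuclideanSpace ℂ (Fin n)) (ξ : EuclideanSpace ℝ (Fin n)) :
    0 < regSq h ρ ξ := by
  have h0 := Complex.normSq_nonneg (charSymbol h ρ ξ)
  have := le_regSq h ρ ξ
  linarith

theorem one_sub_microCutoff (h : ℝ) (ρ : EuclideanSpace ℂ (Fin n))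
    (ξ : EuclideanSpace ℝ (Fin n)) :
    1 - (microCutoff h ρ ξ : ℂ) = parametrix h ρ ξ * charSymbol h ρ ξ := by
  have h0 := (regSq_pos h ρ ξ).ne'
  have h1 : 1 - microCutoff h ρ ξ
      = Complex.normSq (charSymbol h ρ ξ) * (regSq h ρ ξ) ^ (-1 : ℝ) := by
    rw [microCutoff, Real.rpow_neg_one]
    field_simp
    rw [regSq]; ring
  calc 1 - (microCutoff h ρ ξ : ℂ) = ((1 - microCutoff h ρ ξ : ℝ) : ℂ) := by push_cast; ring
    _ = _ := by
      rw [h1, parametrix, Complex.ofReal_mul, Complex.normSq_eq_conj_mul_self]; ring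

/-- The positive replacement of `|p|²` is bounded from below by a multiple of `⟨ξ⟩⁴`, uniformly in
the frequency. As `p` is of order two, `(1 - m) / p` is therefore of order `-2`. -/
theorem bracket_mul_parametrix_le {lam h : ℝ} (hlam : 0 < lam)
    {ρ : EuclideanSpace ℂ (Fin n)} (hρ : IsFrequency lam h ρ) (ξ : EuclideanSpace ℝ (Fin n)) :
    bracket ξ ^ 4 * (regSq h ρ ξ) ^ (-1 : ℝ) ≤ 10050 := by
  have h1 := bracket_sq_le_charSymbol hlam hρ ξ
  have h2 := le_regSq h ρ ξ
  rw [Real.rpow_neg_one, ← div_eq_mul_inv, div_le_iff₀ (regSq_pos h ρ ξ)]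
  rw [Complex.normSq_eq_norm_sq] at h2
  have h3 : (bracket ξ ^ 2) ^ 2 ≤ (5 * (1 + ‖charSymbol h ρ ξ‖)) ^ 2 := by gcongr
  have h4 : bracket ξ ^ 4 = (bracket ξ ^ 2) ^ 2 := by ring
  nlinarith [sq_nonneg (‖charSymbol h ρ ξ‖ - 1)]

section Classes

variable {h₀ σ lam : ℝ} {ρ : ℝ → EuclideanSpace ℂ (Fin n)}

/-- The weight that records the support of the cutoff `m`. -/
def nearWeight (ρ : ℝ → EuclideanSpace ℂ (Fin n)) (h : ℝ)
    (z : EuclideanSpace ℝ (Fin n) × EuclideanSpace ℝ (Fin n)) : ℝ :=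
  {z : EuclideanSpace ℝ (Fin n) × EuclideanSpace ℝ (Fin n) |
    Complex.normSq (charSymbol h (ρ h) z.2) ≤ 1 / 100}.indicator (fun _ => 1) z

theorem nearWeight_nonneg (h : ℝ) (z : EuclideanSpace ℝ (Fin n) × EuclideanSpace ℝ (Fin n)) :
    0 ≤ nearWeight ρ h z := Set.indicator_nonneg (fun _ _ => zero_le_one) _

theorem nearWeight_eq (h : ℝ) (z : EuclideanSpace ℝ (Fin n) × EuclideanSpace ℝ (Fin n)) :
    (Complex.normSq (charSymbol h (ρ h) z.2) ≤ 1 / 100 ∧ nearWeight ρ h z = 1) ∨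
      (1 / 100 < Complex.normSq (charSymbol h (ρ h) z.2) ∧ nearWeight ρ h z = 0) := by
  rcases le_or_gt (Complex.normSq (charSymbol h (ρ h) z.2)) (1 / 100) with hz | hz
  · exact Or.inl ⟨hz, Set.indicator_of_mem (s := {z : EuclideanSpace ℝ (Fin n) ×
      EuclideanSpace ℝ (Fin n) | Complex.normSq (charSymbol h (ρ h) z.2) ≤ 1 / 100}) hz _⟩
  · exact Or.inr ⟨hz, Set.indicator_of_notMem (s := {z : EuclideanSpace ℝ (Fin n) ×
      EuclideanSpace ℝ (Fin n) | Complex.normSq (charSymbol h (ρ h) z.2) ≤ 1 / 100})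
      (not_le.2 hz) _⟩

/-- The coordinate functions `ξ_j + ρ̂_j` are symbols of order one. -/
theorem symbolBound_coord_add_freq (hh₀ : h₀ ≤ 1) (hσ : 0 ≤ σ) (hlam : 0 < lam)
    (hρ : ∀ h ∈ Set.Ioc 0 h₀, IsFrequency lam h (ρ h)) (j : Fin n) :
    SymbolBound h₀ σ (fun _ z => bracket z.2)
      (fun h (z : EuclideanSpace ℝ (Fin n) × EuclideanSpace ℝ (Fin n)) =>
        (z.2 j : ℂ) + h * ρ h j) := by
  have h1 : SymbolBound h₀ σ (fun _ z => bracket z.2)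
      (fun _ (z : EuclideanSpace ℝ (Fin n) × EuclideanSpace ℝ (Fin n)) => (z.2 j : ℂ)) :=
    SymbolBound.clm (Complex.ofRealCLM.comp ((EuclideanSpace.proj j).comp
      (ContinuousLinearMap.snd ℝ (EuclideanSpace ℝ (Fin n)) (EuclideanSpace ℝ (Fin n)))))
      hh₀ hσ (fun _ _ z => one_le_bracket _) (fun _ _ z => by
        have := (PiLp.norm_apply_le z.2 j).trans (norm_le_bracket z.2)
        simpa using this)
  have h2 : SymbolBound h₀ σ (fun _ z => 2 * bracket z.2)
      (fun h (z : EuclideanSpace ℝ (Fin n) × EuclideanSpace ℝ (Fin n)) => (h : ℂ) * ρ h j) :=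
    SymbolBound.const fun h hh z =>
      (norm_freq_component_le hlam hh.1 (hρ h hh) j).trans (by linarith [one_le_bracket z.2])
  exact h1.add (h2.weight_mono 2 zero_le_two fun _ _ _ => le_rfl)

theorem symbolBound_charSymbol (hh₀ : h₀ ≤ 1) (hσ : 0 ≤ σ) (hlam : 0 < lam)
    (hρ : ∀ h ∈ Set.Ioc 0 h₀, IsFrequency lam h (ρ h)) :
    SymbolBound h₀ σ (fun _ z => bracket z.2 ^ 2)
      (fun h (z : EuclideanSpace ℝ (Fin n) × EuclideanSpace ℝ (Fin n)) =>
        charSymbol h (ρ h) z.2) := by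
  refine SymbolBound.sum Finset.univ (fun _ _ _ => sq_nonneg _) fun j _ => ?_
  have h1 : SymbolBound h₀ σ (fun _ z => bracket z.2)
      (fun _ (z : EuclideanSpace ℝ (Fin n) × EuclideanSpace ℝ (Fin n)) => (z.2 j : ℂ)) :=
    SymbolBound.clm (Complex.ofRealCLM.comp ((EuclideanSpace.proj j).comp
      (ContinuousLinearMap.snd ℝ (EuclideanSpace ℝ (Fin n)) (EuclideanSpace ℝ (Fin n)))))
      hh₀ hσ (fun _ _ z => one_le_bracket _) (fun _ _ z => by
        have := (PiLp.norm_apply_le z.2 j).trans (norm_le_bracket z.2)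
        simpa using this)
  have h2 : SymbolBound h₀ σ (fun _ z => bracket z.2)
      (fun h (z : EuclideanSpace ℝ (Fin n) × EuclideanSpace ℝ (Fin n)) => 2 * ((h : ℂ) * ρ h j)) := by
    have h3 : SymbolBound h₀ σ (fun _ z => 4 * bracket z.2)
        (fun h (z : EuclideanSpace ℝ (Fin n) × EuclideanSpace ℝ (Fin n)) =>
          2 * ((h : ℂ) * ρ h j)) :=
      SymbolBound.const (a := fun h => 2 * ((h : ℂ) * ρ h j)) fun h hh z => by
        rw [norm_mul, Complex.norm_ofNat]
        linarith [norm_freq_component_le hlam hh.1 (hρ h hh) j, one_le_bracket z.2]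
    exact h3.weight_mono 4 (by norm_num) fun _ _ _ => le_rfl
  refine ((h1.mul h1).add (h2.mul h1)).weight_mono 1 zero_le_one fun h hh z => ?_
  rw [sq, one_mul]

theorem symbolBound_normSq_charSymbol (hh₀ : h₀ ≤ 1) (hσ : 0 ≤ σ) (hlam : 0 < lam)
    (hρ : ∀ h ∈ Set.Ioc 0 h₀, IsFrequency lam h (ρ h)) :
    SymbolBound h₀ σ (fun _ z => bracket z.2 ^ 4)
      (fun h (z : EuclideanSpace ℝ (Fin n) × EuclideanSpace ℝ (Fin n)) =>
        Complex.normSq (charSymbol h (ρ h) z.2)) := by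
  have hp := symbolBound_charSymbol hh₀ hσ hlam hρ
  have h1 := hp.clm_comp Complex.reCLM
  have h2 := hp.clm_comp Complex.imCLM
  refine (((h1.mul h1).add (h2.mul h2)).congr fun h _ => ?_).weight_mono 1 zero_le_one
    fun h hh z => ?_
  · funext z; rw [Complex.normSq_apply]; rfl
  · exact le_of_eq (by ring)

theorem symbolBound_charCutoff (hh₀ : h₀ ≤ 1) (hσ : 0 ≤ σ) (hlam : 0 < lam)
    (hρ : ∀ h ∈ Set.Ioc 0 h₀, IsFrequency lam h (ρ h)) :
    SymbolBound h₀ σ (nearWeight ρ)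
      (fun h (z : EuclideanSpace ℝ (Fin n) × EuclideanSpace ℝ (Fin n)) =>
        charCutoff (Complex.normSq (charSymbol h (ρ h) z.2))) := by
  have ht := symbolBound_normSq_charSymbol hh₀ hσ hlam hρ
  refine SymbolBound.comp contDiff_charCutoff ht.1 (fun _ _ _ => nearWeight_nonneg _ _)
    (fun k => ?_) (fun k => ?_)
  · obtain ⟨C, hC⟩ := (isCompact_Icc (a := (0 : ℝ)) (b := 1 / 100)).exists_bound_of_continuousOn
      (contDiff_charCutoff.continuous_iteratedFDeriv (m := k) (mod_cast le_top)).continuousOn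
    refine ⟨C, fun h hh z => ?_⟩
    rcases nearWeight_eq (ρ := ρ) h z with ⟨hz, hw⟩ | ⟨hz, hw⟩
    · rw [hw, mul_one]
      exact hC _ ⟨Complex.normSq_nonneg _, hz⟩
    · rw [hw, iteratedFDeriv_charCutoff_of_gt k hz]; simp
  · obtain ⟨K, hK, H⟩ := ht.2 k
    refine ⟨K * 100, fun h hh z hz => (H h hh z).trans ?_⟩
    rcases nearWeight_eq (ρ := ρ) h z with ⟨hz', -⟩ | ⟨-, hw⟩
    · have hp : 0 ≤ (h ^ (-σ)) ^ k := pow_nonneg (Real.rpow_nonneg hh.1.le _) _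
      have hb := bracket_sq_le_charSymbol hlam (hρ h hh) z.2
      rw [Complex.normSq_eq_norm_sq] at hz'
      have h1 : ‖charSymbol h (ρ h) z.2‖ ≤ 1 := by nlinarith [norm_nonneg (charSymbol h (ρ h) z.2)]
      have h2 : bracket z.2 ^ 4 ≤ 100 := by
        have h3 : bracket z.2 ^ 2 ≤ 10 := by linarith
        calc bracket z.2 ^ 4 = (bracket z.2 ^ 2) ^ 2 := by ring
          _ ≤ 10 ^ 2 := by gcongr
          _ = 100 := by norm_num
      calc K * (h ^ (-σ)) ^ k * bracket z.2 ^ 4 ≤ K * (h ^ (-σ)) ^ k * 100 := by gcongr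
        _ = _ := by ring
    · exact absurd hw hz

theorem symbolBound_regSq_inv (hh₀ : h₀ ≤ 1) (hσ : 0 ≤ σ) (hlam : 0 < lam)
    (hρ : ∀ h ∈ Set.Ioc 0 h₀, IsFrequency lam h (ρ h)) :
    SymbolBound h₀ σ (fun h z => (regSq h (ρ h) z.2) ^ (-1 : ℝ))
      (fun h (z : EuclideanSpace ℝ (Fin n) × EuclideanSpace ℝ (Fin n)) =>
        (regSq h (ρ h) z.2) ^ (-1 : ℝ)) := by
  have h1 : SymbolBound h₀ σ (fun h z => regSq h (ρ h) z.2)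
      (fun h (z : EuclideanSpace ℝ (Fin n) × EuclideanSpace ℝ (Fin n)) =>
        Complex.normSq (charSymbol h (ρ h) z.2)) := by
    refine (symbolBound_normSq_charSymbol hh₀ hσ hlam hρ).weight_mono 10050 (by norm_num)
      fun h hh z => ?_
    have h1 := bracket_mul_parametrix_le hlam (hρ h hh) z.2
    rwa [Real.rpow_neg_one, ← div_eq_mul_inv, div_le_iff₀ (regSq_pos h (ρ h) z.2)] at h1
  have h2 : SymbolBound h₀ σ (fun h z => regSq h (ρ h) z.2)
      (fun h (z : EuclideanSpace ℝ (Fin n) × EuclideanSpace ℝ (Fin n)) =>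
        charCutoff (Complex.normSq (charSymbol h (ρ h) z.2))) := by
    refine (symbolBound_charCutoff hh₀ hσ hlam hρ).weight_mono 201 (by norm_num) fun h hh z => ?_
    have h1 := le_regSq h (ρ h) z.2
    have h2 := Complex.normSq_nonneg (charSymbol h (ρ h) z.2)
    rcases nearWeight_eq (ρ := ρ) h z with ⟨-, hw⟩ | ⟨-, hw⟩ <;> rw [hw] <;> linarith
  have h3 : SymbolBound h₀ σ (fun h z => regSq h (ρ h) z.2)
      (fun h (z : EuclideanSpace ℝ (Fin n) × EuclideanSpace ℝ (Fin n)) =>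
        regSq h (ρ h) z.2) := h1.add h2
  exact h3.rpow (fun h _ z => regSq_pos h (ρ h) z.2) (-1)

theorem symbolBound_microCutoff (hh₀ : h₀ ≤ 1) (hσ : 0 ≤ σ) (hlam : 0 < lam)
    (hρ : ∀ h ∈ Set.Ioc 0 h₀, IsFrequency lam h (ρ h)) :
    SymbolBound h₀ σ (nearWeight ρ)
      (fun h (z : EuclideanSpace ℝ (Fin n) × EuclideanSpace ℝ (Fin n)) =>
        (microCutoff h (ρ h) z.2 : ℂ)) := by
  refine (((symbolBound_charCutoff hh₀ hσ hlam hρ).mul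
    (symbolBound_regSq_inv hh₀ hσ hlam hρ)).clm_comp Complex.ofRealCLM).weight_mono 201
    (by norm_num) fun h hh z => ?_
  rw [mul_comm]
  refine mul_le_mul_of_nonneg_right ?_ (nearWeight_nonneg h z)
  have h1 := le_regSq h (ρ h) z.2
  have h2 := Complex.normSq_nonneg (charSymbol h (ρ h) z.2)
  rw [Real.rpow_neg_one, inv_le_comm₀ (regSq_pos h (ρ h) z.2) (by norm_num)]
  linarith

theorem symbolBound_parametrix (hh₀ : h₀ ≤ 1) (hσ : 0 ≤ σ) (hlam : 0 < lam)
    (hρ : ∀ h ∈ Set.Ioc 0 h₀, IsFrequency lam h (ρ h)) :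
    SymbolBound h₀ σ (fun h z => bracket z.2 ^ 2 * (regSq h (ρ h) z.2) ^ (-1 : ℝ))
      (fun h (z : EuclideanSpace ℝ (Fin n) × EuclideanSpace ℝ (Fin n)) =>
        parametrix h (ρ h) z.2) :=
  ((symbolBound_charSymbol hh₀ hσ hlam hρ).clm_comp
    (Complex.conjCLE : ℂ →L[ℝ] ℂ)).mul
    ((symbolBound_regSq_inv hh₀ hσ hlam hρ).clm_comp Complex.ofRealCLM)

end Classes

end CharSymbol

end SemiclassicalConjugation

/-! ### The Fourier transform on Schwartz functions -/

namespace SemiclassicalConjugation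

noncomputable section Fourier

variable {n : ℕ}

open FourierTransform LineDeriv

theorem fourierT_eq_fourier (f : EuclideanSpace ℝ (Fin n) → ℂ) (ξ : EuclideanSpace ℝ (Fin n)) :
    fourierT f ξ = 𝓕 f ((2 * Real.pi)⁻¹ • ξ) := by
  rw [Real.fourier_eq', fourierT]
  congr 1
  funext x
  have h : -2 * Real.pi * ((2 * Real.pi)⁻¹ * inner ℝ x ξ) = -inner ℝ x ξ := by
    field_simp
  rw [inner_smul_right, h, smul_eq_mul]
  congr 2
  push_cast; ring

theorem exists_schwartz_fourierT (f : 𝓢(EuclideanSpace ℝ (Fin n), ℂ)) :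
    ∃ g : 𝓢(EuclideanSpace ℝ (Fin n), ℂ), ∀ ξ, fourierT f ξ = g ξ := by
  have hne : (2 * Real.pi)⁻¹ ≠ 0 := by positivity
  refine ⟨SchwartzMap.compCLMOfContinuousLinearEquiv ℂ
    (ContinuousLinearEquiv.smulLeft (R₁ := ℝ) (M₁ := EuclideanSpace ℝ (Fin n))
      (Units.mk0 _ hne)) (𝓕 f), fun ξ => ?_⟩
  rw [fourierT_eq_fourier, ← SchwartzMap.fourier_coe]
  rfl

theorem integrable_fourierT_integrand (f : 𝓢(EuclideanSpace ℝ (Fin n), ℂ))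
    (ξ : EuclideanSpace ℝ (Fin n)) :
    Integrable fun x => Complex.exp (-(Complex.I * ((inner ℝ x ξ : ℝ) : ℂ))) * f x := by
  refine f.integrable.bdd_mul (c := 1) (by fun_prop) (Filter.Eventually.of_forall fun x => ?_)
  rw [show -(Complex.I * ((inner ℝ x ξ : ℝ) : ℂ)) = ((-inner ℝ x ξ : ℝ) : ℂ) * Complex.I by
    push_cast; ring, Complex.norm_exp_ofReal_mul_I]

theorem fourierT_add (f g : 𝓢(EuclideanSpace ℝ (Fin n), ℂ)) (ξ : EuclideanSpace ℝ (Fin n)) :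
    fourierT (⇑(f + g)) ξ = fourierT f ξ + fourierT g ξ := by
  simp only [fourierT]
  rw [← integral_add (integrable_fourierT_integrand f ξ) (integrable_fourierT_integrand g ξ)]
  congr 1
  funext x
  rw [_root_.add_apply]; ring

theorem fourierT_smul (c : ℂ) (f : 𝓢(EuclideanSpace ℝ (Fin n), ℂ))
    (ξ : EuclideanSpace ℝ (Fin n)) : fourierT (⇑(c • f)) ξ = c * fourierT f ξ := by
  simp only [fourierT]
  rw [← integral_const_mul]
  congr 1
  funext x
  rw [smul_apply, smul_eq_mul]; ring

theorem fourierT_sum {ι : Type*} (s : Finset ι) (f : ι → 𝓢(EuclideanSpace ℝ (Fin n), ℂ))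
    (ξ : EuclideanSpace ℝ (Fin n)) :
    fourierT (⇑(∑ i ∈ s, f i)) ξ = ∑ i ∈ s, fourierT (f i) ξ := by
  classical
  induction s using Finset.induction_on with
  | empty => simp [fourierT]
  | insert i s hi ih => rw [Finset.sum_insert hi, Finset.sum_insert hi, fourierT_add, ih]

theorem fourierT_lineDeriv (f : 𝓢(EuclideanSpace ℝ (Fin n), ℂ)) (j : Fin n)
    (ξ : EuclideanSpace ℝ (Fin n)) :
    fourierT (∂_{EuclideanSpace.single j (1 : ℝ)} f : 𝓢(EuclideanSpace ℝ (Fin n), ℂ)) ξ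
      = Complex.I * ξ j * fourierT f ξ := by
  rw [fourierT_eq_fourier, fourierT_eq_fourier, ← SchwartzMap.fourier_coe,
    SchwartzMap.fourier_lineDerivOp_eq, ← SchwartzMap.fourier_coe]
  have hg : (fun x : EuclideanSpace ℝ (Fin n) =>
      inner ℝ x (EuclideanSpace.single j (1 : ℝ))).HasTemperateGrowth :=
    ((innerSL ℝ).flip (EuclideanSpace.single j (1 : ℝ))).hasTemperateGrowth
  rw [smul_apply, SchwartzMap.smulLeftCLM_apply_apply hg]
  simp only [inner_smul_left, EuclideanSpace.inner_single_right, Complex.real_smul, smul_eq_mul]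
  have hpi : (Real.pi : ℂ) ≠ 0 := by exact_mod_cast Real.pi_ne_zero
  simp
  field_simp

/-- On the Fourier side `P` is multiplication by `p(hξ)`. -/
theorem fourierT_opP (h : ℝ) (ρ : EuclideanSpace ℂ (Fin n))
    (f : 𝓢(EuclideanSpace ℝ (Fin n), ℂ)) (ξ : EuclideanSpace ℝ (Fin n)) :
    fourierT (opP h ρ f) ξ = charSymbol h ρ (h • ξ) * fourierT f ξ := by
  have e : opP h ρ f = ⇑(∑ j : Fin n, ((-(h : ℂ) ^ 2) •
      (∂_{EuclideanSpace.single j (1 : ℝ)} (∂_{EuclideanSpace.single j (1 : ℝ)} f :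
        𝓢(EuclideanSpace ℝ (Fin n), ℂ)) : 𝓢(EuclideanSpace ℝ (Fin n), ℂ))
      + (2 * ((h : ℂ) * ρ j) * (h * -Complex.I)) •
        (∂_{EuclideanSpace.single j (1 : ℝ)} f : 𝓢(EuclideanSpace ℝ (Fin n), ℂ)))) := by
    funext x
    rw [opP, ← SchwartzMap.laplacian_apply,
      SchwartzMap.laplacian_eq_sum (EuclideanSpace.basisFun (Fin n) ℝ)]
    simp only [sum_apply, Finset.mul_sum, _root_.add_apply, smul_apply, smul_eq_mul,
      EuclideanSpace.basisFun_apply, D]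
    rw [← Finset.sum_add_distrib]
    refine Finset.sum_congr rfl fun j _ => ?_
    simp only [SchwartzMap.lineDerivOp_apply_eq_fderiv]
    ring
  rw [e, fourierT_sum, charSymbol, Finset.sum_mul]
  refine Finset.sum_congr rfl fun j _ => ?_
  rw [fourierT_add, fourierT_smul, fourierT_smul, fourierT_lineDeriv, fourierT_lineDeriv]
  simp only [PiLp.smul_apply, smul_eq_mul]
  push_cast
  linear_combination (-(h : ℂ) ^ 2 * ξ j ^ 2 - 2 * h * ρ j * h * ξ j) * fourierT f ξ * Complex.I_sq

end Fourier

/-! ### Differentiating quantized symbols -/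

noncomputable section Quantization

variable {n : ℕ}

theorem laplacian_eq_sum_fderiv {u : EuclideanSpace ℝ (Fin n) → ℂ} (hu : ContDiff ℝ ∞ u)
    (x : EuclideanSpace ℝ (Fin n)) :
    Laplacian.laplacian u x = ∑ j, fderiv ℝ (fun y => fderiv ℝ u y (EuclideanSpace.single j 1)) x
      (EuclideanSpace.single j 1) := by
  rw [InnerProductSpace.laplacian_eq_iteratedFDeriv_orthonormalBasis u
    (EuclideanSpace.basisFun (Fin n) ℝ)]
  refine Finset.sum_congr rfl fun j _ => ?_
  rw [iteratedFDeriv_two_apply, EuclideanSpace.basisFun_apply]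
  have hd : DifferentiableAt ℝ (fderiv ℝ u) x :=
    ((hu.fderiv_right (m := ∞) (mod_cast le_top)).differentiable (by simp)) x
  rw [fderiv_clm_apply hd (differentiableAt_const _)]
  simp

theorem norm_iteratedDeriv_exp_I_mul (k : ℕ) (t : ℝ) :
    ‖iteratedDeriv k (fun t : ℝ => Complex.exp (Complex.I * t)) t‖ = 1 := by
  have h : ∀ k : ℕ, iteratedDeriv k (fun t : ℝ => Complex.exp (Complex.I * t))
      = fun t : ℝ => Complex.I ^ k * Complex.exp (Complex.I * t) := by
    intro k
    induction k with
    | zero => simp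
    | succ k ih =>
      funext t
      rw [iteratedDeriv_succ, ih]
      have h1 : HasDerivAt (fun t : ℝ => Complex.I * (t : ℂ)) (Complex.I * 1) t :=
        (Complex.ofRealCLM.hasDerivAt (x := t)).const_mul Complex.I
      have h2 := (h1.cexp.const_mul (Complex.I ^ k)).deriv
      rw [h2]; ring
  rw [h, norm_mul, norm_pow, Complex.norm_I, one_pow, one_mul, mul_comm,
    Complex.norm_exp_ofReal_mul_I]

/-- The integrand of `Op_h(a) f`, with `g = f̂`. -/
def opIntegrand (h : ℝ) (a : EuclideanSpace ℝ (Fin n) → EuclideanSpace ℝ (Fin n) → ℂ)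
    (g : 𝓢(EuclideanSpace ℝ (Fin n), ℂ)) (x ξ : EuclideanSpace ℝ (Fin n)) : ℂ :=
  Complex.exp (Complex.I * ((inner ℝ x ξ : ℝ) : ℂ)) * a x (h • ξ) * g ξ

theorem contDiff_opIntegrand (h : ℝ)
    {a : EuclideanSpace ℝ (Fin n) → EuclideanSpace ℝ (Fin n) → ℂ}
    (ha : ContDiff ℝ ∞ (Function.uncurry a)) (g : 𝓢(EuclideanSpace ℝ (Fin n), ℂ)) :
    ContDiff ℝ ∞ (fun p : EuclideanSpace ℝ (Fin n) × EuclideanSpace ℝ (Fin n) =>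
      opIntegrand h a g p.1 p.2) := by
  have h1 : ContDiff ℝ ∞ fun p : EuclideanSpace ℝ (Fin n) × EuclideanSpace ℝ (Fin n) =>
      ((inner ℝ p.1 p.2 : ℝ) : ℂ) :=
    Complex.ofRealCLM.contDiff.comp (contDiff_fst.inner ℝ contDiff_snd)
  have h2 : ContDiff ℝ ∞ fun p : EuclideanSpace ℝ (Fin n) × EuclideanSpace ℝ (Fin n) =>
      a p.1 (h • p.2) := ha.comp (contDiff_fst.prodMk (contDiff_snd.const_smul h))
  exact ((contDiff_const.mul h1).cexp.mul h2).mul ((g.smooth ⊤).comp contDiff_snd)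

/-- The derivatives in `x` of the integrand are dominated by integrable functions of `ξ`: they grow
polynomially in `ξ`, and `g` is a Schwartz function. -/
theorem exists_norm_iteratedFDeriv_opIntegrand_le (h : ℝ)
    {a : EuclideanSpace ℝ (Fin n) → EuclideanSpace ℝ (Fin n) → ℂ}
    (ha : ContDiff ℝ ∞ (Function.uncurry a))
    (hab : ∀ k : ℕ, ∃ K : ℝ, ∀ z, ‖iteratedFDeriv ℝ k (Function.uncurry a) z‖ ≤ K)
    (g : 𝓢(EuclideanSpace ℝ (Fin n), ℂ)) (k : ℕ) :
    ∃ bound : EuclideanSpace ℝ (Fin n) → ℝ, Integrable bound ∧ ∀ x ξ,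
      ‖iteratedFDeriv ℝ k (fun x => opIntegrand h a g x ξ) x‖ ≤ bound ξ := by
  choose K hK using hab
  have hK0 : ∀ i, 0 ≤ K i := fun i => (norm_nonneg _).trans (hK i 0)
  refine ⟨fun ξ => ∑ i ∈ Finset.range (k + 1), ((k.choose i : ℝ) * K (k - i)) *
    (‖ξ‖ ^ i * ‖g ξ‖), integrable_finsetSum _ fun i _ =>
      (g.integrable_pow_mul volume i).const_mul _, fun x ξ => ?_⟩
  have hle : ∀ m : ℕ, (m : ℕ∞ω) ≤ ∞ := fun m => mod_cast le_top
  have hE : ContDiff ℝ ∞ (fun t : ℝ => Complex.exp (Complex.I * t)) :=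
    (contDiff_const.mul Complex.ofRealCLM.contDiff).cexp
  have h1 : ContDiff ℝ ∞ fun x : EuclideanSpace ℝ (Fin n) =>
      Complex.exp (Complex.I * ((inner ℝ x ξ : ℝ) : ℂ)) :=
    hE.comp (contDiff_id.inner ℝ contDiff_const)
  have h2 : ContDiff ℝ ∞ fun x => a x (h • ξ) := ha.comp (contDiff_id.prodMk contDiff_const)
  have e : (fun x => opIntegrand h a g x ξ) = fun x =>
      Complex.exp (Complex.I * ((inner ℝ x ξ : ℝ) : ℂ)) * (a x (h • ξ) * g ξ) := by
    funext x; rw [opIntegrand, mul_assoc]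
  rw [e]
  refine (norm_iteratedFDeriv_mul_le h1 (h2.mul contDiff_const) x (n := k)
    (mod_cast le_top)).trans (Finset.sum_le_sum fun i _ => ?_)
  have h3 : ‖iteratedFDeriv ℝ i (fun x : EuclideanSpace ℝ (Fin n) =>
      Complex.exp (Complex.I * ((inner ℝ x ξ : ℝ) : ℂ))) x‖ ≤ ‖ξ‖ ^ i := by
    have h4 := norm_iteratedFDeriv_comp_affine_le hE (innerSL ℝ ξ) 0 i x
    rw [norm_iteratedFDeriv_eq_norm_iteratedDeriv, norm_iteratedDeriv_exp_I_mul, one_mul,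
      innerSL_apply_norm] at h4
    simpa [real_inner_comm] using h4
  have h5 : ‖iteratedFDeriv ℝ (k - i) (fun x => a x (h • ξ) * g ξ) x‖ ≤ K (k - i) * ‖g ξ‖ := by
    have h6 := ((ContinuousLinearMap.mul ℝ ℂ).flip (g ξ)).norm_iteratedFDeriv_comp_left
      (x := x) (f := fun x => a x (h • ξ)) (n := k - i) (N := ∞) h2.contDiffAt (hle _)
    have h7 : ‖(ContinuousLinearMap.mul ℝ ℂ).flip (g ξ)‖ ≤ ‖g ξ‖ :=
      ContinuousLinearMap.opNorm_le_bound _ (norm_nonneg _) fun y => by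
        simp [mul_comm]
    have h8 := norm_iteratedFDeriv_comp_affine_le ha
      (ContinuousLinearMap.inl ℝ (EuclideanSpace ℝ (Fin n)) (EuclideanSpace ℝ (Fin n)))
      (0, h • ξ) (k - i) x
    have h9 : ‖ContinuousLinearMap.inl ℝ (EuclideanSpace ℝ (Fin n))
        (EuclideanSpace ℝ (Fin n))‖ ≤ 1 := ContinuousLinearMap.norm_inl_le_one ..
    have h10 : (fun z => Function.uncurry a (ContinuousLinearMap.inl ℝ (EuclideanSpace ℝ (Fin n))
        (EuclideanSpace ℝ (Fin n)) z + (0, h • ξ))) = fun x => a x (h • ξ) := by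
      funext z; simp [Function.uncurry]
    rw [h10] at h8
    have h11 : ‖iteratedFDeriv ℝ (k - i) (fun x => a x (h • ξ)) x‖ ≤ K (k - i) :=
      h8.trans ((mul_le_mul (hK _ _) (pow_le_one₀ (norm_nonneg _) h9) (by positivity)
        (hK0 _)).trans (by rw [mul_one]))
    refine h6.trans ((mul_le_mul h7 h11 (norm_nonneg _) (norm_nonneg _)).trans ?_)
    rw [mul_comm]
  calc _ ≤ (k.choose i : ℝ) * ‖ξ‖ ^ i * (K (k - i) * ‖g ξ‖) := by
        refine mul_le_mul (mul_le_mul_of_nonneg_left h3 (Nat.cast_nonneg _)) h5 (norm_nonneg _)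
          (by positivity)
    _ = _ := by ring

/-- Derivatives up to second order may be taken under the integral sign. -/
theorem derivatives_integral {G : EuclideanSpace ℝ (Fin n) → EuclideanSpace ℝ (Fin n) → ℂ}
    (hG : ContDiff ℝ ∞ (fun p : EuclideanSpace ℝ (Fin n) × EuclideanSpace ℝ (Fin n) => G p.1 p.2))
    (hb : ∀ k : ℕ, ∃ bound : EuclideanSpace ℝ (Fin n) → ℝ, Integrable bound ∧ ∀ x ξ,
      ‖iteratedFDeriv ℝ k (fun x => G x ξ) x‖ ≤ bound ξ) (x : EuclideanSpace ℝ (Fin n)) :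
    ContDiff ℝ ∞ (fun x => ∫ ξ, G x ξ) ∧
      Integrable (fun ξ => G x ξ) ∧
      (∀ j, Integrable (fun ξ => D j (fun x => G x ξ) x)) ∧
      (∀ j, D j (fun x => ∫ ξ, G x ξ) x = ∫ ξ, D j (fun x => G x ξ) x) ∧
      Integrable (fun ξ => Laplacian.laplacian (fun x => G x ξ) x) ∧
      Laplacian.laplacian (fun x => ∫ ξ, G x ξ) x
        = ∫ ξ, Laplacian.laplacian (fun x => G x ξ) x := by
  have hGx : ∀ ξ, ContDiff ℝ ∞ (fun x => G x ξ) := fun ξ =>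
    hG.comp (contDiff_id.prodMk contDiff_const)
  have hm : ∀ (k : ℕ) (x : EuclideanSpace ℝ (Fin n)), AEStronglyMeasurable
      (fun ξ => iteratedFDeriv ℝ k (fun x => G x ξ) x) volume := fun k x =>
    ((continuous_iteratedFDeriv_partial hG k).comp
      (Continuous.prodMk_right x)).aestronglyMeasurable
  obtain ⟨hsm, hD⟩ := contDiff_integral_of_dominated (μ := volume) hGx hm (fun k x₀ => by
    obtain ⟨bound, hbi, hbd⟩ := hb k
    exact ⟨Set.univ, Filter.univ_mem, bound, hbi, Filter.Eventually.of_forall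
      fun ξ x _ => hbd x ξ⟩)
  have hint : ∀ k : ℕ, Integrable
      (fun ξ => iteratedFDeriv ℝ k (fun x => G x ξ) x) := fun k => by
    obtain ⟨bound, hbi, hbd⟩ := hb k
    exact hbi.mono' (hm k x) (Filter.Eventually.of_forall fun ξ => hbd x ξ)
  set u : EuclideanSpace ℝ (Fin n) → ℂ := fun x => ∫ ξ, G x ξ
  have hi0 : Integrable (fun ξ => G x ξ) := by
    obtain ⟨bound, hbi, hbd⟩ := hb 0
    refine hbi.mono' (hG.continuous.comp (Continuous.prodMk_right x)).aestronglyMeasurable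
      (Filter.Eventually.of_forall fun ξ => ?_)
    simpa using hbd x ξ
  have hi1 : ∀ e, Integrable (fun ξ => fderiv ℝ (fun x => G x ξ) x e) := fun e => by
    have := (ContinuousMultilinearMap.apply ℝ (fun _ : Fin 1 => EuclideanSpace ℝ (Fin n)) ℂ
      (fun _ => e)).integrable_comp (hint 1)
    simpa using this
  have hu1 : ∀ e, fderiv ℝ u x e = ∫ ξ, fderiv ℝ (fun x => G x ξ) x e := fun e => by
    have := congrArg (fun T => T (fun _ : Fin 1 => e)) (hD 1 x)
    rw [ContinuousMultilinearMap.integral_apply (hint 1)] at this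
    simpa only [iteratedFDeriv_one_apply] using this
  have hi2 : ∀ j : Fin n, Integrable (fun ξ => iteratedFDeriv ℝ 2 (fun x => G x ξ) x
      ![EuclideanSpace.basisFun (Fin n) ℝ j, EuclideanSpace.basisFun (Fin n) ℝ j]) := fun j =>
    (ContinuousMultilinearMap.apply ℝ (fun _ : Fin 2 => EuclideanSpace ℝ (Fin n)) ℂ
      ![EuclideanSpace.basisFun (Fin n) ℝ j, EuclideanSpace.basisFun (Fin n) ℝ j]).integrable_comp
      (hint 2)
  have hLap : ∀ v : EuclideanSpace ℝ (Fin n) → ℂ, Laplacian.laplacian v x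
      = ∑ j, iteratedFDeriv ℝ 2 v x
        ![EuclideanSpace.basisFun (Fin n) ℝ j, EuclideanSpace.basisFun (Fin n) ℝ j] := fun v => by
    rw [InnerProductSpace.laplacian_eq_iteratedFDeriv_orthonormalBasis v
      (EuclideanSpace.basisFun (Fin n) ℝ)]
  have hu2 : Laplacian.laplacian u x
      = ∫ ξ, Laplacian.laplacian (fun x => G x ξ) x := by
    simp only [hLap]
    rw [integral_finsetSum _ fun j _ => hi2 j]
    refine Finset.sum_congr rfl fun j _ => ?_
    rw [hD 2 x, ContinuousMultilinearMap.integral_apply (hint 2)]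
  have hiL : Integrable (fun ξ => Laplacian.laplacian (fun x => G x ξ) x) := by
    simp only [hLap]
    exact integrable_finsetSum _ fun j _ => hi2 j
  have hDj : ∀ j, D j u x = ∫ ξ, D j (fun x => G x ξ) x := fun j => by
    simp only [D]
    rw [hu1, ← integral_const_mul]
  exact ⟨hsm, hi0, fun j => (hi1 _).const_mul _, hDj, hiL, hu2⟩

/-- The operator `P + hQ` may be applied under the integral sign. -/
theorem opP_add_opQ_integral (h : ℝ) (ρ : EuclideanSpace ℂ (Fin n))
    (A : EuclideanSpace ℝ (Fin n) → EuclideanSpace ℂ (Fin n))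
    {G : EuclideanSpace ℝ (Fin n) → EuclideanSpace ℝ (Fin n) → ℂ}
    (hG : ContDiff ℝ ∞ (fun p : EuclideanSpace ℝ (Fin n) × EuclideanSpace ℝ (Fin n) => G p.1 p.2))
    (hb : ∀ k : ℕ, ∃ bound : EuclideanSpace ℝ (Fin n) → ℝ, Integrable bound ∧ ∀ x ξ,
      ‖iteratedFDeriv ℝ k (fun x => G x ξ) x‖ ≤ bound ξ) (c : ℂ) (x : EuclideanSpace ℝ (Fin n)) :
    opP h ρ (fun x => c * ∫ ξ, G x ξ) x + h * opQ h ρ A (fun x => c * ∫ ξ, G x ξ) x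
      = c * ∫ ξ, (opP h ρ (fun x => G x ξ) x + h * opQ h ρ A (fun x => G x ξ) x) := by
  obtain ⟨hsm, hi0, hiD, hDj, hiL, hu2⟩ := derivatives_integral hG hb x
  set u : EuclideanSpace ℝ (Fin n) → ℂ := fun x => ∫ ξ, G x ξ
  have hcL : Laplacian.laplacian (fun x => c * u x) x = c * Laplacian.laplacian u x :=
    InnerProductSpace.laplacian_smul c (contDiff_infty.1 hsm 2).contDiffAt
  have hcD : ∀ j, D j (fun x => c * u x) x = c * D j u x := fun j => by
    rw [D, D, fderiv_const_mul ((hsm.differentiable (by simp)) x)]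
    simp only [smul_apply, smul_eq_mul]; ring
  have hiP : Integrable (fun ξ => opP h ρ (fun x => G x ξ) x) := by
    simp only [opP]
    exact (hiL.const_mul _).add ((integrable_finsetSum _ fun j _ =>
      ((hiD j).const_mul _).const_mul _).const_mul _)
  have hiQ : Integrable (fun ξ => (h : ℂ) * opQ h ρ A (fun x => G x ξ) x) := by
    simp only [opQ]
    exact ((integrable_finsetSum _ fun j _ =>
      (((hiD j).const_mul _).add (hi0.const_mul _)).const_mul _).const_mul _).const_mul _
  rw [integral_add hiP hiQ, integral_const_mul]
  have hP : opP h ρ (fun x => c * u x) x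
      = c * ∫ ξ, opP h ρ (fun x => G x ξ) x := by
    simp only [opP]
    rw [integral_add (hiL.const_mul _) ((integrable_finsetSum _ fun j _ =>
      ((hiD j).const_mul _).const_mul _).const_mul _), integral_const_mul, integral_const_mul,
      integral_finsetSum _ fun j _ => ((hiD j).const_mul _).const_mul _, hcL, hu2]
    simp only [integral_const_mul, hcD, hDj, mul_add, Finset.mul_sum]
    congr 1
    · ring
    · exact Finset.sum_congr rfl fun j _ => by ring
  have hQ : opQ h ρ A (fun x => c * u x) x
      = c * ∫ ξ, opQ h ρ A (fun x => G x ξ) x := by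
    simp only [opQ]
    have hij : ∀ j, Integrable (fun ξ => A x j * ((h : ℂ) * D j (fun x => G x ξ) x
        + ((h : ℂ) * ρ j) * G x ξ)) := fun j =>
      (((hiD j).const_mul _).add (hi0.const_mul _)).const_mul _
    rw [integral_const_mul, integral_finsetSum _ fun j _ => hij j]
    simp only [Finset.mul_sum]
    refine Finset.sum_congr rfl fun j _ => ?_
    rw [integral_const_mul, integral_add ((hiD j).const_mul _) (hi0.const_mul _),
      integral_const_mul, integral_const_mul, hcD, hDj]
    ring
  rw [hP, hQ]
  ring

end Quantization

end SemiclassicalConjugation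

/-! ### Conjugation of `P + hQ` by an exponential -/

namespace SemiclassicalConjugation

noncomputable section Conjugation

variable {n : ℕ}

/-- The full symbol of `(P + hQ) Op_h(e^Φ)`, divided by `e^Φ`, computed on one exponential. The
composition formula is exact because `P` and `Q` are differential operators. -/
theorem opP_add_opQ_exp (h : ℝ) (ρ : EuclideanSpace ℂ (Fin n))
    (A : EuclideanSpace ℝ (Fin n) → EuclideanSpace ℂ (Fin n))
    {φ : EuclideanSpace ℝ (Fin n) → ℂ} (hφ : ContDiff ℝ ∞ φ) (ξ : EuclideanSpace ℝ (Fin n)) (γ : ℂ)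
    {v : EuclideanSpace ℝ (Fin n) → ℂ}
    (hv : v = fun x => Complex.exp (Complex.I * ((inner ℝ x ξ : ℝ) : ℂ) + φ x) * γ)
    (x : EuclideanSpace ℝ (Fin n)) :
    opP h ρ v x + h * opQ h ρ A v x
      = v x * (charSymbol h ρ (h • ξ)
        + 2 * h * ∑ j, (((h • ξ) j : ℝ) + (h : ℂ) * ρ j) *
            (A x j - Complex.I * fderiv ℝ φ x (EuclideanSpace.single j 1))
        - (h : ℂ) ^ 2 * ∑ j, (fderiv ℝ (fun y => fderiv ℝ φ y (EuclideanSpace.single j 1)) x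
              (EuclideanSpace.single j 1)
            + fderiv ℝ φ x (EuclideanSpace.single j 1) ^ 2
            + 2 * Complex.I * A x j * fderiv ℝ φ x (EuclideanSpace.single j 1))) := by
  have hlin : ∀ y : EuclideanSpace ℝ (Fin n), HasFDerivAt
      (fun x : EuclideanSpace ℝ (Fin n) => Complex.I * ((inner ℝ x ξ : ℝ) : ℂ))
      (Complex.I • Complex.ofRealCLM.comp (innerSL ℝ ξ)) y := fun y => by
    have h1 : HasFDerivAt (fun x : EuclideanSpace ℝ (Fin n) => ((inner ℝ x ξ : ℝ) : ℂ))
        (Complex.ofRealCLM.comp (innerSL ℝ ξ)) y := by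
      have := (Complex.ofRealCLM.comp (innerSL ℝ ξ)).hasFDerivAt (x := y)
      refine this.congr_of_eventuallyEq (Filter.Eventually.of_forall fun x => ?_)
      simp [real_inner_comm]
    exact h1.const_mul Complex.I
  have hφd : ∀ y, HasFDerivAt φ (fderiv ℝ φ y) y := fun y =>
    ((hφ.differentiable (by simp)) y).hasFDerivAt
  have hvd : ∀ (y : EuclideanSpace ℝ (Fin n)) (j : Fin n),
      fderiv ℝ v y (EuclideanSpace.single j 1)
        = v y * (Complex.I * ξ j + fderiv ℝ φ y (EuclideanSpace.single j 1)) := by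
    intro y j
    have h1 := ((((hlin y).add (hφd y)).cexp).mul_const γ).fderiv
    have h2 : v = fun x => Complex.exp (((fun x : EuclideanSpace ℝ (Fin n) =>
        Complex.I * ((inner ℝ x ξ : ℝ) : ℂ)) + φ) x) * γ := hv
    rw [h2, h1]
    simp [EuclideanSpace.inner_single_right]
    ring
  have hvsm : ContDiff ℝ ∞ v := by
    have h1 : ContDiff ℝ ∞ fun x : EuclideanSpace ℝ (Fin n) => ((inner ℝ x ξ : ℝ) : ℂ) :=
      Complex.ofRealCLM.contDiff.comp (contDiff_id.inner ℝ contDiff_const)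
    rw [hv]
    exact ((contDiff_const.mul h1).add hφ).cexp.mul contDiff_const
  have hvdd : ∀ j : Fin n, fderiv ℝ (fun y => fderiv ℝ v y (EuclideanSpace.single j 1)) x
      (EuclideanSpace.single j 1) = v x * ((Complex.I * ξ j
        + fderiv ℝ φ x (EuclideanSpace.single j 1)) ^ 2
        + fderiv ℝ (fun y => fderiv ℝ φ y (EuclideanSpace.single j 1)) x
          (EuclideanSpace.single j 1)) := by
    intro j
    have h1 : (fun y => fderiv ℝ v y (EuclideanSpace.single j 1)) = fun y => v y *
        (Complex.I * ξ j + fderiv ℝ φ y (EuclideanSpace.single j 1)) := funext fun y => hvd y j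
    have h2 : DifferentiableAt ℝ (fun y => fderiv ℝ φ y (EuclideanSpace.single j 1)) x :=
      (((hφ.fderiv_right (m := ∞) (mod_cast le_top)).clm_apply
        contDiff_const).differentiable (by simp)) x
    rw [h1, fderiv_fun_mul ((hvsm.differentiable (by simp)) x) (h2.const_add _),
      fderiv_const_add]
    simp only [_root_.add_apply, smul_apply, smul_eq_mul, hvd]
    ring
  rw [opP, opQ, laplacian_eq_sum_fderiv hvsm, charSymbol]
  simp only [hvdd]
  simp only [D, hvd, Finset.mul_sum, PiLp.smul_apply, smul_eq_mul]
  rw [← Finset.sum_add_distrib, ← Finset.sum_add_distrib, ← Finset.sum_add_distrib,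
    ← Finset.sum_sub_distrib, Finset.mul_sum]
  refine Finset.sum_congr rfl fun j _ => ?_
  push_cast
  linear_combination (-(h : ℂ) ^ 2 * ξ j ^ 2 * v x - 2 * h * h * ρ j * ξ j * v x
    - 2 * h * h * A x j * ξ j * v x) * Complex.I_sq

/-- If the symbol of `(P + hQ) Op_h(e^Φ)` splits as `c' p + r s`, then the operator identity
holds on Schwartz functions. -/
theorem conjugation_of_symbol_identity (h : ℝ) (ρ : EuclideanSpace ℂ (Fin n))
    (A : EuclideanSpace ℝ (Fin n) → EuclideanSpace ℂ (Fin n))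
    {Φ : EuclideanSpace ℝ (Fin n) × EuclideanSpace ℝ (Fin n) → ℂ} (hΦ : ContDiff ℝ ∞ Φ)
    {c c' s : EuclideanSpace ℝ (Fin n) → EuclideanSpace ℝ (Fin n) → ℂ}
    (hc : ∀ x ξ, c x ξ = Complex.exp (Φ (x, ξ)))
    (hcb : ∀ k : ℕ, ∃ K : ℝ, ∀ z, ‖iteratedFDeriv ℝ k (Function.uncurry c) z‖ ≤ K)
    (hc' : ContDiff ℝ ∞ (Function.uncurry c'))
    (hc'b : ∀ k : ℕ, ∃ K : ℝ, ∀ z, ‖iteratedFDeriv ℝ k (Function.uncurry c') z‖ ≤ K)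
    (hs : ContDiff ℝ ∞ (Function.uncurry s))
    (hsb : ∀ k : ℕ, ∃ K : ℝ, ∀ z, ‖iteratedFDeriv ℝ k (Function.uncurry s) z‖ ≤ K)
    (r : EuclideanSpace ℝ (Fin n) → ℂ)
    (hsymb : ∀ x η, c x η * (charSymbol h ρ η
        + 2 * h * ∑ j, ((η j : ℂ) + (h : ℂ) * ρ j) *
            (A x j - Complex.I * fderiv ℝ Φ (x, η) (EuclideanSpace.single j 1, 0))
        - (h : ℂ) ^ 2 * ∑ j, (fderiv ℝ (fun z => fderiv ℝ Φ z (EuclideanSpace.single j 1, 0)) (x, η)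
              (EuclideanSpace.single j 1, 0)
            + fderiv ℝ Φ (x, η) (EuclideanSpace.single j 1, 0) ^ 2
            + 2 * Complex.I * A x j * fderiv ℝ Φ (x, η) (EuclideanSpace.single j 1, 0)))
      = c' x η * charSymbol h ρ η + r x * s x η)
    (f : 𝓢(EuclideanSpace ℝ (Fin n), ℂ)) (x : EuclideanSpace ℝ (Fin n)) :
    opP h ρ (Op h c f) x + (h : ℂ) * opQ h ρ A (Op h c f) x
      = Op h c' (opP h ρ f) x + r x * Op h s f x := by
  obtain ⟨g, hg⟩ := exists_schwartz_fourierT f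
  obtain ⟨gP, hgP⟩ : ∃ g : 𝓢(EuclideanSpace ℝ (Fin n), ℂ), ∀ ξ,
      charSymbol h ρ (h • ξ) * fourierT f ξ = g ξ := by
    have e : opP h ρ f = ⇑(-(h : ℂ) ^ 2 • Laplacian.laplacian f + ∑ j : Fin n,
        (2 * ((h : ℂ) * ρ j) * (h * -Complex.I)) •
        (LineDeriv.lineDerivOp (EuclideanSpace.single j (1 : ℝ)) f :
          𝓢(EuclideanSpace ℝ (Fin n), ℂ))) := by
      funext x
      simp only [opP, _root_.add_apply, smul_apply, smul_eq_mul, sum_apply, D,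
        SchwartzMap.lineDerivOp_apply_eq_fderiv, SchwartzMap.laplacian_apply, Finset.mul_sum]
      congr 1
      exact Finset.sum_congr rfl fun j _ => by ring
    obtain ⟨g', hg'⟩ := exists_schwartz_fourierT (-(h : ℂ) ^ 2 • Laplacian.laplacian f +
      ∑ j : Fin n, (2 * ((h : ℂ) * ρ j) * (h * -Complex.I)) •
        (LineDeriv.lineDerivOp (EuclideanSpace.single j (1 : ℝ)) f :
          𝓢(EuclideanSpace ℝ (Fin n), ℂ)))
    rw [← e] at hg'
    exact ⟨g', fun ξ => by rw [← fourierT_opP, hg']⟩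
  have hcsm : ContDiff ℝ ∞ (Function.uncurry c) := by
    have : Function.uncurry c = fun z => Complex.exp (Φ z) := funext fun z => hc z.1 z.2
    rw [this]; exact hΦ.cexp
  have hint : ∀ {a : EuclideanSpace ℝ (Fin n) → EuclideanSpace ℝ (Fin n) → ℂ},
      ContDiff ℝ ∞ (Function.uncurry a) →
      (∀ k : ℕ, ∃ K : ℝ, ∀ z, ‖iteratedFDeriv ℝ k (Function.uncurry a) z‖ ≤ K) →
      ∀ g : 𝓢(EuclideanSpace ℝ (Fin n), ℂ), Integrable (fun ξ => opIntegrand h a g x ξ) :=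
    fun ha hab g => (derivatives_integral (contDiff_opIntegrand h ha g)
      (exists_norm_iteratedFDeriv_opIntegrand_le h ha hab g) x).2.1
  have hOpc : Op h c f = fun x => ((2 * (Real.pi : ℂ)) ^ n)⁻¹ * ∫ ξ, opIntegrand h c g x ξ := by
    funext x; simp only [Op, opIntegrand, hg]
  have hOpc' : Op h c' (opP h ρ f) x
      = ((2 * (Real.pi : ℂ)) ^ n)⁻¹ * ∫ ξ, opIntegrand h c' gP x ξ := by
    simp only [Op, opIntegrand, fourierT_opP, hgP]
  have hOps : Op h s f x = ((2 * (Real.pi : ℂ)) ^ n)⁻¹ * ∫ ξ, opIntegrand h s g x ξ := by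
    simp only [Op, opIntegrand, hg]
  rw [hOpc, opP_add_opQ_integral h ρ A (contDiff_opIntegrand h hcsm g)
    (exists_norm_iteratedFDeriv_opIntegrand_le h hcsm hcb g), hOpc', hOps,
    show ∀ κ a b d : ℂ, κ * a + b * (κ * d) = κ * (a + b * d) from fun κ a b d => by ring,
    ← integral_const_mul (r x), ← integral_add (hint hc' hc'b gP) ((hint hs hsb g).const_mul _)]
  congr 1
  refine integral_congr_ae (Filter.Eventually.of_forall fun ξ => ?_)
  -- the partial derivatives of `Φ` in `x` are those of its restriction to a fixed `ξ`
  have hres : ∀ {F : EuclideanSpace ℝ (Fin n) × EuclideanSpace ℝ (Fin n) → ℂ},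
      ContDiff ℝ ∞ F → ∀ y e, fderiv ℝ (fun x => F (x, h • ξ)) y e
        = fderiv ℝ F (y, h • ξ) (e, 0) := fun {F} hF y e => by
    have h1 := ((hF.differentiable (by simp)) (y, h • ξ)).hasFDerivAt
    have h2 : HasFDerivAt (fun x : EuclideanSpace ℝ (Fin n) => (x, h • ξ))
        (ContinuousLinearMap.inl ℝ _ _) y := hasFDerivAt_prodMk_left y (h • ξ)
    have h3 := (h1.comp y h2).fderiv
    simp only [Function.comp_def] at h3
    rw [h3]; simp
  have hφ : ContDiff ℝ ∞ (fun x => Φ (x, h • ξ)) := hΦ.comp (contDiff_id.prodMk contDiff_const)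
  have hΦ1 : ∀ j : Fin n, ContDiff ℝ ∞ (fun z => fderiv ℝ Φ z (EuclideanSpace.single j 1, 0)) :=
    fun j => (hΦ.fderiv_right (m := ∞) (mod_cast le_top)).clm_apply contDiff_const
  have hkey := opP_add_opQ_exp h ρ A hφ ξ (g ξ) (v := fun x => opIntegrand h c g x ξ) (by
    funext x; rw [opIntegrand, hc, Complex.exp_add]) x
  simp only [hres hΦ] at hkey
  simp only [fun j => hres (hΦ1 j)] at hkey
  refine hkey.trans ?_
  have h1 := hsymb x (h • ξ)
  simp only [opIntegrand]
  rw [← hgP, hg]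
  linear_combination (Complex.exp (Complex.I * ((inner ℝ x ξ : ℝ) : ℂ)) * g ξ) * h1

end Conjugation

end SemiclassicalConjugation

/-! ### The phase and the transport equation -/

namespace SemiclassicalConjugation

noncomputable section Phase

variable {n : ℕ}

/-- Approximate solution `Ψ_j` of `(ξ + ρ̂)·∇_x Ψ_j = B_j`, with cutoff radius `R = h^{-τ}`. -/
def transportSolution (τ h : ℝ) (ρ : EuclideanSpace ℂ (Fin n))
    (B : EuclideanSpace ℝ (Fin n) → EuclideanSpace ℂ (Fin n)) (j : Fin n)
    (z : EuclideanSpace ℝ (Fin n) × EuclideanSpace ℝ (Fin n)) : ℂ :=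
  -(2 * Real.pi : ℂ)⁻¹ * planeTransform (cauchyKernel (h ^ (-τ))) (h ^ (-τ)) (freqRe h ρ)
    (freqIm h ρ) (fun x => B x j) z

/-- The error `(ξ + ρ̂)·∇_x Ψ_j - B_j`. -/
def transportError (τ h : ℝ) (ρ : EuclideanSpace ℂ (Fin n))
    (B : EuclideanSpace ℝ (Fin n) → EuclideanSpace ℂ (Fin n)) (j : Fin n)
    (z : EuclideanSpace ℝ (Fin n) × EuclideanSpace ℝ (Fin n)) : ℂ :=
  (2 * Real.pi : ℂ)⁻¹ * planeTransform (cutoffKernel (h ^ (-τ))) (h ^ (-τ)) (freqRe h ρ)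
    (freqIm h ρ) (fun x => B x j) z

/-- The phase `Φ = -i m(ξ) (ξ + ρ̂)·Ψ`. -/
def phase (τ h : ℝ) (ρ : EuclideanSpace ℂ (Fin n))
    (B : EuclideanSpace ℝ (Fin n) → EuclideanSpace ℂ (Fin n))
    (z : EuclideanSpace ℝ (Fin n) × EuclideanSpace ℝ (Fin n)) : ℂ :=
  -Complex.I * ((microCutoff h ρ z.2 : ℂ) *
    ∑ j, ((z.2 j : ℂ) + h * ρ j) * transportSolution τ h ρ B j z)

/-- The part of order two in `h` of the symbol of `(P + hQ) Op_h(e^Φ)`, divided by `e^Φ`. -/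
def secondOrderTerm (Φ : EuclideanSpace ℝ (Fin n) × EuclideanSpace ℝ (Fin n) → ℂ)
    (B : EuclideanSpace ℝ (Fin n) → EuclideanSpace ℂ (Fin n))
    (z : EuclideanSpace ℝ (Fin n) × EuclideanSpace ℝ (Fin n)) : ℂ :=
  ∑ j, (fderiv ℝ (fun z => fderiv ℝ Φ z (EuclideanSpace.single j 1, 0)) z
      (EuclideanSpace.single j 1, 0)
    + fderiv ℝ Φ z (EuclideanSpace.single j 1, 0) ^ 2
    + 2 * Complex.I * B z.1 j * fderiv ℝ Φ z (EuclideanSpace.single j 1, 0))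

theorem sum_coord_add_freq_mul_fderiv (h : ℝ) (ρ : EuclideanSpace ℂ (Fin n))
    (F : EuclideanSpace ℝ (Fin n) × EuclideanSpace ℝ (Fin n) → ℂ)
    (z : EuclideanSpace ℝ (Fin n) × EuclideanSpace ℝ (Fin n)) :
    ∑ j, ((z.2 j : ℂ) + h * ρ j) * fderiv ℝ F z (EuclideanSpace.single j 1, 0)
      = fderiv ℝ F z (z.2 + freqRe h ρ, 0) + Complex.I * fderiv ℝ F z (freqIm h ρ, 0) := by
  have hlin : ∀ v : EuclideanSpace ℝ (Fin n), fderiv ℝ F z (v, 0)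
      = ∑ j, (v j : ℂ) * fderiv ℝ F z (EuclideanSpace.single j 1, 0) := fun v => by
    have h1 : ((fderiv ℝ F z).comp (ContinuousLinearMap.inl ℝ _ _)) v
        = ∑ j, (v j : ℂ) * ((fderiv ℝ F z).comp (ContinuousLinearMap.inl ℝ _ _))
            (EuclideanSpace.single j 1) := by
      conv_lhs => rw [← (EuclideanSpace.basisFun (Fin n) ℝ).sum_repr v]
      rw [map_sum]
      exact Finset.sum_congr rfl fun j _ => by
        rw [map_smul, EuclideanSpace.basisFun_apply, EuclideanSpace.basisFun_repr,
          Complex.real_smul]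
    simpa using h1
  rw [hlin, hlin, Finset.mul_sum, ← Finset.sum_add_distrib]
  refine Finset.sum_congr rfl fun j _ => ?_
  have hρ : (h : ℂ) * ρ j = ((freqRe h ρ j : ℝ) : ℂ) + Complex.I * ((freqIm h ρ j : ℝ) : ℂ) := by
    conv_lhs => rw [← Complex.re_add_im (ρ j)]
    simp only [freqRe, freqIm]
    push_cast
    ring
  rw [hρ, PiLp.add_apply]
  push_cast
  ring

theorem contDiff_planeTransform {k : ℝ × ℝ → ℂ} (hk : ContDiff ℝ ∞ k) (R : ℝ)
    (a b : EuclideanSpace ℝ (Fin n)) {B : EuclideanSpace ℝ (Fin n) → ℂ} (hB : ContDiff ℝ ∞ B) :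
    ContDiff ℝ ∞ (planeTransform k R a b B) :=
  (contDiff_setIntegral_of_contDiff (μ := volume) (isCompact_polarBox R)
    (contDiff_planeTransform_integrand hk a b hB)).1

theorem contDiff_charSymbol (h : ℝ) (ρ : EuclideanSpace ℂ (Fin n)) :
    ContDiff ℝ ∞ (charSymbol h ρ) := by
  have h1 : ∀ j : Fin n, ContDiff ℝ ∞ fun ξ : EuclideanSpace ℝ (Fin n) => (ξ j : ℂ) := fun j =>
    (Complex.ofRealCLM.comp (EuclideanSpace.proj j : EuclideanSpace ℝ (Fin n) →L[ℝ] ℝ)).contDiff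
  exact ContDiff.sum fun j _ => ((h1 j).mul (h1 j)).add (contDiff_const.mul (h1 j))

theorem contDiff_microCutoff (h : ℝ) (ρ : EuclideanSpace ℂ (Fin n)) :
    ContDiff ℝ ∞ (microCutoff h ρ) := by
  have h1 : ContDiff ℝ ∞ fun ξ => Complex.normSq (charSymbol h ρ ξ) := by
    have hre := Complex.reCLM.contDiff.comp (contDiff_charSymbol h ρ)
    have him := Complex.imCLM.contDiff.comp (contDiff_charSymbol h ρ)
    exact (hre.mul hre).add (him.mul him)
  have h2 := contDiff_charCutoff.comp h1
  exact h2.mul ((h1.add h2).rpow_const_of_ne fun ξ => (regSq_pos h ρ ξ).ne')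

variable {τ h : ℝ} {ρ : EuclideanSpace ℂ (Fin n)}
  {B : EuclideanSpace ℝ (Fin n) → EuclideanSpace ℂ (Fin n)}

theorem ContDiff.component (hB : ContDiff ℝ ∞ B) (j : Fin n) : ContDiff ℝ ∞ fun x => B x j :=
  ((EuclideanSpace.proj j : EuclideanSpace ℂ (Fin n) →L[ℂ] ℂ).restrictScalars ℝ).contDiff.comp hB

/-- The Cauchy–Riemann equation in the plane spanned by `ξ + Re ρ̂` and `Im ρ̂` is the transport
equation with the complex direction `ξ + ρ̂`. -/
theorem transportSolution_transport (hh : 0 < h) (hB : ContDiff ℝ ∞ B) (k : Fin n)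
    (z : EuclideanSpace ℝ (Fin n) × EuclideanSpace ℝ (Fin n)) :
    ∑ j, ((z.2 j : ℂ) + h * ρ j) *
        fderiv ℝ (transportSolution τ h ρ B k) z (EuclideanSpace.single j 1, 0)
      = B z.1 k + transportError τ h ρ B k z := by
  have hBk := ContDiff.component hB k
  have h1 := cauchyRiemann_planeTransform hBk (Real.rpow_pos_of_pos hh (-τ)) (freqRe h ρ)
    (freqIm h ρ) z
  have h2 := (contDiff_planeTransform (contDiff_cauchyKernel (h ^ (-τ))) (h ^ (-τ)) (freqRe h ρ)
    (freqIm h ρ) hBk).differentiable (by simp)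
  have h3 : ∀ e, fderiv ℝ (transportSolution τ h ρ B k) z e = -(2 * Real.pi : ℂ)⁻¹ *
      fderiv ℝ (planeTransform (cauchyKernel (h ^ (-τ))) (h ^ (-τ)) (freqRe h ρ) (freqIm h ρ)
        (fun x => B x k)) z e := fun e => by
    have : transportSolution τ h ρ B k = fun z => -(2 * Real.pi : ℂ)⁻¹ *
      planeTransform (cauchyKernel (h ^ (-τ))) (h ^ (-τ)) (freqRe h ρ) (freqIm h ρ)
        (fun x => B x k) z := rfl
    rw [this, fderiv_const_mul (h2 z)]
    rfl
  rw [sum_coord_add_freq_mul_fderiv, h3, h3, transportError]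
  have hpi : (Real.pi : ℂ) ≠ 0 := Complex.ofReal_ne_zero.2 Real.pi_ne_zero
  have h4 : (2 * Real.pi : ℂ)⁻¹ * (2 * Real.pi) = 1 := inv_mul_cancel₀ (by simp)
  linear_combination (-(2 * Real.pi : ℂ)⁻¹) * h1 + B z.1 k * h4

theorem fderiv_phase (hB : ContDiff ℝ ∞ B)
    (z : EuclideanSpace ℝ (Fin n) × EuclideanSpace ℝ (Fin n)) (e : EuclideanSpace ℝ (Fin n)) :
    fderiv ℝ (phase τ h ρ B) z (e, 0) = -Complex.I * ((microCutoff h ρ z.2 : ℂ) *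
      ∑ k, ((z.2 k : ℂ) + h * ρ k) * fderiv ℝ (transportSolution τ h ρ B k) z (e, 0)) := by
  -- factors that depend on `ξ` only are constant in the direction `(e, 0)`
  have hsnd : ∀ {f : EuclideanSpace ℝ (Fin n) → ℂ}
      {F : EuclideanSpace ℝ (Fin n) × EuclideanSpace ℝ (Fin n) → ℂ}, ContDiff ℝ ∞ f →
      DifferentiableAt ℝ F z →
      fderiv ℝ (fun z => f z.2 * F z) z (e, 0) = f z.2 * fderiv ℝ F z (e, 0) := by
    intro f F hf hF
    have h1 : HasFDerivAt (fun z : EuclideanSpace ℝ (Fin n) × EuclideanSpace ℝ (Fin n) => f z.2)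
        ((fderiv ℝ f z.2).comp (ContinuousLinearMap.snd ℝ _ _)) z :=
      ((hf.differentiable (by simp)) z.2).hasFDerivAt.comp z hasFDerivAt_snd
    rw [(h1.fun_mul hF.hasFDerivAt).fderiv]
    simp
  have hΨ : ∀ k, ContDiff ℝ ∞ (transportSolution τ h ρ B k) := fun k =>
    contDiff_const.mul (contDiff_planeTransform (contDiff_cauchyKernel (h ^ (-τ))) (h ^ (-τ)) _ _
      (ContDiff.component hB k))
  have hm : ContDiff ℝ ∞ fun ξ => -Complex.I * (microCutoff h ρ ξ : ℂ) :=
    contDiff_const.mul (Complex.ofRealCLM.contDiff.comp (contDiff_microCutoff h ρ))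
  have hw : ∀ k : Fin n, ContDiff ℝ ∞ fun ξ : EuclideanSpace ℝ (Fin n) => (ξ k : ℂ) + h * ρ k :=
    fun k => (Complex.ofRealCLM.comp
      (EuclideanSpace.proj k : EuclideanSpace ℝ (Fin n) →L[ℝ] ℝ)).contDiff.add contDiff_const
  have hd : ∀ k ∈ Finset.univ, DifferentiableAt ℝ
      (fun z : EuclideanSpace ℝ (Fin n) × EuclideanSpace ℝ (Fin n) =>
        ((z.2 k : ℂ) + h * ρ k) * transportSolution τ h ρ B k z) z := fun k _ =>
    ((((hw k).comp contDiff_snd).mul (hΨ k)).differentiable (by simp)) z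
  have h1 : phase τ h ρ B = fun z => (-Complex.I * (microCutoff h ρ z.2 : ℂ)) *
      ∑ k, ((z.2 k : ℂ) + h * ρ k) * transportSolution τ h ρ B k z := by
    funext z; rw [phase]; ring
  rw [h1, hsnd hm (DifferentiableAt.fun_sum hd), fderiv_fun_sum hd, sum_apply, mul_assoc]
  congr 2
  exact Finset.sum_congr rfl fun k _ =>
    hsnd (hw k) (((hΨ k).differentiable (by simp)) z)

/-- The transport equation: on the set where `m = 1` the phase cancels `(ξ + ρ̂)·B` up to the
transport error. -/
theorem phase_transport (hh : 0 < h) (hB : ContDiff ℝ ∞ B)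
    (z : EuclideanSpace ℝ (Fin n) × EuclideanSpace ℝ (Fin n)) :
    ∑ j, ((z.2 j : ℂ) + h * ρ j) *
        (Complex.I * fderiv ℝ (phase τ h ρ B) z (EuclideanSpace.single j 1, 0))
      = (microCutoff h ρ z.2 : ℂ) *
        ∑ k, ((z.2 k : ℂ) + h * ρ k) * (B z.1 k + transportError τ h ρ B k z) := by
  simp only [fderiv_phase hB, ← transportSolution_transport (τ := τ) (ρ := ρ) hh hB]
  simp only [Finset.mul_sum]
  rw [Finset.sum_comm]
  refine Finset.sum_congr rfl fun j _ => Finset.sum_congr rfl fun k _ => ?_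
  linear_combination (-((z.2 k : ℂ) + h * ρ k) * (microCutoff h ρ z.2 : ℂ) *
    ((z.2 j : ℂ) + h * ρ j) *
    fderiv ℝ (transportSolution τ h ρ B j) z (EuclideanSpace.single k 1, 0)) * Complex.I_sq

/-- Splitting of the full symbol: near the characteristic set the phase removes the term of order
`h`, and away from it this term is divisible by `p`. -/
theorem symbol_splitting (hh : 0 < h) (hB : ContDiff ℝ ∞ B)
    (z : EuclideanSpace ℝ (Fin n) × EuclideanSpace ℝ (Fin n)) :
    charSymbol h ρ z.2
        + 2 * h * ∑ j, ((z.2 j : ℂ) + h * ρ j) *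
            (B z.1 j - Complex.I * fderiv ℝ (phase τ h ρ B) z (EuclideanSpace.single j 1, 0))
        - (h : ℂ) ^ 2 * secondOrderTerm (phase τ h ρ B) B z
      = (1 + 2 * h * (parametrix h ρ z.2 * ∑ j, ((z.2 j : ℂ) + h * ρ j) * B z.1 j))
          * charSymbol h ρ z.2
        - (2 * h * ((microCutoff h ρ z.2 : ℂ) *
            ∑ j, ((z.2 j : ℂ) + h * ρ j) * transportError τ h ρ B j z)
          + (h : ℂ) ^ 2 * secondOrderTerm (phase τ h ρ B) B z) := by
  have h1 := phase_transport (τ := τ) (ρ := ρ) hh hB z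
  have h2 := one_sub_microCutoff h ρ z.2
  simp only [mul_sub, mul_add, Finset.sum_sub_distrib, Finset.sum_add_distrib] at h1 ⊢
  linear_combination (-2 * (h : ℂ)) * h1
    + (2 * (h : ℂ) * ∑ j, ((z.2 j : ℂ) + h * ρ j) * B z.1 j) * h2

end Phase

end SemiclassicalConjugation

/-! ### Symbol bounds for the phase and the remainder -/

namespace SemiclassicalConjugation

noncomputable section PhaseBounds

variable {n : ℕ}

/-- The mean of `⟨·⟩^{-1-ε}` over the polar rectangle of radius `2R`, `R = h^{-τ}`, restricted to
frequencies near the characteristic set. -/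
def nearMean (ε τ : ℝ) (ρ : ℝ → EuclideanSpace ℂ (Fin n)) (h : ℝ)
    (z : EuclideanSpace ℝ (Fin n) × EuclideanSpace ℝ (Fin n)) : ℝ :=
  nearWeight ρ h z * ∫ y in polarBox (h ^ (-τ)),
    bracket (planePoint (freqRe h (ρ h)) (freqIm h (ρ h)) z y) ^ (-1 - ε)

/-- The outer half `R ≤ r ≤ 2R` of the mean in `nearMean`, normalised by `R`. -/
def nearTail (ε τ : ℝ) (ρ : ℝ → EuclideanSpace ℂ (Fin n)) (h : ℝ)
    (z : EuclideanSpace ℝ (Fin n) × EuclideanSpace ℝ (Fin n)) : ℝ :=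
  nearWeight ρ h z * ((h ^ (-τ))⁻¹ *
    ∫ y in Set.Icc (h ^ (-τ)) (2 * h ^ (-τ)) ×ˢ Set.Icc (-Real.pi) Real.pi,
      bracket (planePoint (freqRe h (ρ h)) (freqIm h (ρ h)) z y) ^ (-1 - ε))

variable {h₀ σ₀ σ τ ε lam : ℝ} {ρ : ℝ → EuclideanSpace ℂ (Fin n)}
  {B : ℝ → EuclideanSpace ℝ (Fin n) → EuclideanSpace ℂ (Fin n)}

theorem nearMean_nonneg (h : ℝ) (z : EuclideanSpace ℝ (Fin n) × EuclideanSpace ℝ (Fin n)) :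
    0 ≤ nearMean ε τ ρ h z :=
  mul_nonneg (nearWeight_nonneg h z) (integral_nonneg fun _ =>
    Real.rpow_nonneg (bracket_pos _).le _)

/-- A quantity that is bounded for nearly orthonormal frames is bounded by the same constant after
multiplication by the weight `nearWeight`. -/
theorem nearWeight_mul_le {h : ℝ} (hlam : 0 < lam) (hh : 0 < h) (hh4 : h ^ 2 * lam ≤ 1 / 4)
    (hρ : IsFrequency lam h (ρ h)) (z : EuclideanSpace ℝ (Fin n) × EuclideanSpace ℝ (Fin n))
    {q C : ℝ} (hC : 0 ≤ C)
    (hq : NearlyOrthonormal (z.2 + freqRe h (ρ h)) (freqIm h (ρ h)) → q ≤ C) :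
    nearWeight ρ h z * q ≤ C := by
  rcases nearWeight_eq (ρ := ρ) h z with ⟨hz, hw⟩ | ⟨-, hw⟩
  · rw [hw, one_mul]
    exact hq (nearlyOrthonormal_of_normSq_charSymbol_le hlam hh hh4 hρ hz)
  · rw [hw, zero_mul]; exact hC

theorem exists_nearMean_le (hε : 0 < ε) (hlam : 0 < lam)
    (hh4 : ∀ h ∈ Set.Ioc 0 h₀, h ^ 2 * lam ≤ 1 / 4)
    (hρ : ∀ h ∈ Set.Ioc 0 h₀, IsFrequency lam h (ρ h)) :
    ∃ C : ℝ, 0 ≤ C ∧ ∀ h ∈ Set.Ioc 0 h₀, ∀ z, nearMean ε τ ρ h z ≤ C := by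
  obtain ⟨C, hC, H⟩ := exists_planeIntegral_bracket_le (n := n) hε
  exact ⟨C, hC, fun h hh z => nearWeight_mul_le hlam hh.1 (hh4 h hh) (hρ h hh) z hC fun hz =>
    H _ _ z hz _ _⟩

theorem exists_bracket_mul_nearMean_le (hε : 0 < ε) (hε1 : ε ≤ 1) (hlam : 0 < lam) (hτ : 0 ≤ τ)
    (hh₀ : h₀ ≤ 1) (hh4 : ∀ h ∈ Set.Ioc 0 h₀, h ^ 2 * lam ≤ 1 / 4)
    (hρ : ∀ h ∈ Set.Ioc 0 h₀, IsFrequency lam h (ρ h)) :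
    ∃ C : ℝ, 0 ≤ C ∧ ∀ h ∈ Set.Ioc 0 h₀, ∀ z, bracket z.1 * nearMean ε τ ρ h z ≤ C * h ^ (-τ) := by
  obtain ⟨C, hC, H⟩ := exists_bracket_mul_planeIntegral_le (n := n) hε hε1
  refine ⟨C, hC, fun h hh z => ?_⟩
  rw [nearMean, mul_left_comm]
  exact nearWeight_mul_le hlam hh.1 (hh4 h hh) (hρ h hh) z
    (mul_nonneg hC (Real.rpow_nonneg hh.1.le _)) fun hz => H _ _ z hz _
      (Real.one_le_rpow_of_pos_of_le_one_of_nonpos hh.1 (hh.2.trans hh₀) (by linarith))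

theorem exists_bracket_mul_nearTail_le (hε : 0 < ε) (hε1 : ε ≤ 1) (hlam : 0 < lam) (hτ : 0 ≤ τ)
    (hh₀ : h₀ ≤ 1) (hh4 : ∀ h ∈ Set.Ioc 0 h₀, h ^ 2 * lam ≤ 1 / 4)
    (hρ : ∀ h ∈ Set.Ioc 0 h₀, IsFrequency lam h (ρ h)) :
    ∃ C : ℝ, 0 ≤ C ∧ ∀ h ∈ Set.Ioc 0 h₀, ∀ z,
      bracket z.1 * nearTail ε τ ρ h z ≤ C * h ^ (τ * ε / 8) := by
  obtain ⟨C, hC, H⟩ := exists_bracket_mul_tail_le (n := n) hε hε1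
  refine ⟨C, hC, fun h hh z => ?_⟩
  rw [nearTail, mul_left_comm]
  have e : h ^ (τ * ε / 8) = (h ^ (-τ)) ^ (-(ε / 8)) := by
    rw [← Real.rpow_mul hh.1.le]; congr 1; ring
  rw [e]
  exact nearWeight_mul_le hlam hh.1 (hh4 h hh) (hρ h hh) z
    (mul_nonneg hC (Real.rpow_nonneg (Real.rpow_nonneg hh.1.le _) _)) fun hz => H _ _ z hz _
      (Real.one_le_rpow_of_pos_of_le_one_of_nonpos hh.1 (hh.2.trans hh₀) (by linarith))

theorem bracket_mul_nearWeight_le (hlam : 0 < lam)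
    {h : ℝ} (hρ : IsFrequency lam h (ρ h))
    (z : EuclideanSpace ℝ (Fin n) × EuclideanSpace ℝ (Fin n)) :
    bracket z.2 * nearWeight ρ h z ≤ 4 * nearWeight ρ h z := by
  rcases nearWeight_eq (ρ := ρ) h z with ⟨hz, hw⟩ | ⟨-, hw⟩
  · rw [hw]
    have hb := bracket_sq_le_charSymbol hlam hρ z.2
    rw [Complex.normSq_eq_norm_sq] at hz
    have h1 : ‖charSymbol h (ρ h) z.2‖ ≤ 1 := by nlinarith [norm_nonneg (charSymbol h (ρ h) z.2)]
    nlinarith [one_le_bracket z.2]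
  · rw [hw]; simp

theorem SymbolBound.component {E : Type*} [NormedAddCommGroup E] [NormedSpace ℝ E] {w : ℝ → E → ℝ}
    {u : ℝ → E → EuclideanSpace ℂ (Fin n)} (hu : SymbolBound h₀ σ w u) (j : Fin n) :
    SymbolBound h₀ σ w (fun h z => u h z j) :=
  hu.clm_comp (((EuclideanSpace.proj j : EuclideanSpace ℂ (Fin n) →L[ℂ] ℂ)).restrictScalars ℝ)

theorem SymbolBound.const_mul {E : Type*} [NormedAddCommGroup E] [NormedSpace ℝ E] {w : ℝ → E → ℝ}
    {u : ℝ → E → ℂ} (hu : SymbolBound h₀ σ w u) (c : ℂ) :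
    SymbolBound h₀ σ w (fun h z => c * u h z) :=
  hu.clm_comp (ContinuousLinearMap.mul ℝ ℂ c)

theorem symbolBound_transportSolution (hh₀ : h₀ ≤ 1) (hτ : 0 ≤ τ)
    (hB : SymbolBound h₀ σ₀ (fun _ x => bracket x ^ (-1 - ε)) B) (j : Fin n) :
    SymbolBound h₀ (σ₀ + τ) (fun h z => ∫ y in polarBox (h ^ (-τ)),
        bracket (planePoint (freqRe h (ρ h)) (freqIm h (ρ h)) z y) ^ (-1 - ε))
      (fun h => transportSolution τ h (ρ h) (B h) j) := by
  have h1 := symbolBound_planeTransform hh₀ hτ (hB.component j)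
    (k := fun h => cauchyKernel (h ^ (-τ))) (K := fun _ _ => 1)
    (fun h _ => contDiff_cauchyKernel _) (fun h _ y _ => norm_cauchyKernel_le _ y)
    (fun h _ => continuousOn_const.integrableOn_compact (isCompact_polarBox _))
    (fun h => freqRe h (ρ h)) (fun h => freqIm h (ρ h))
  simp only [one_mul] at h1
  exact h1.const_mul _

theorem symbolBound_transportError (hh₀ : h₀ ≤ 1) (hτ : 0 ≤ τ)
    (hB : SymbolBound h₀ σ₀ (fun _ x => bracket x ^ (-1 - ε)) B) (j : Fin n) :
    SymbolBound h₀ (σ₀ + τ) (fun h z => (h ^ (-τ))⁻¹ *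
      ∫ y in Set.Icc (h ^ (-τ)) (2 * h ^ (-τ)) ×ˢ Set.Icc (-Real.pi) Real.pi,
        bracket (planePoint (freqRe h (ρ h)) (freqIm h (ρ h)) z y) ^ (-1 - ε))
      (fun h => transportError τ h (ρ h) (B h) j) := by
  obtain ⟨C, hC, HC⟩ := exists_norm_cutoffKernel_le
  have hmeas : ∀ R : ℝ, MeasurableSet (Set.Icc R (2 * R) ×ˢ Set.Icc (-Real.pi) Real.pi) :=
    fun R => measurableSet_Icc.prod measurableSet_Icc
  have h1 := symbolBound_planeTransform hh₀ hτ (hB.component j)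
    (k := fun h => cutoffKernel (h ^ (-τ))) (K := fun h y => C * ((h ^ (-τ))⁻¹ *
      (Set.Icc (h ^ (-τ)) (2 * h ^ (-τ)) ×ˢ Set.Icc (-Real.pi) Real.pi).indicator (fun _ => 1) y))
    (fun h _ => contDiff_cutoffKernel _)
    (fun h hh y hy => HC _ (Real.rpow_pos_of_pos hh.1 _) y hy)
    (fun h _ => (((continuousOn_const (c := (1 : ℝ))).integrableOn_compact
      (isCompact_polarBox _)).indicator (hmeas _) |>.const_mul _).const_mul _)
    (fun h => freqRe h (ρ h)) (fun h => freqIm h (ρ h))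
  refine (h1.weight_mono C hC fun h hh z => le_of_eq ?_).const_mul _
  have hR : 0 < h ^ (-τ) := Real.rpow_pos_of_pos hh.1 _
  have h2 : Set.Icc (h ^ (-τ)) (2 * h ^ (-τ)) ×ˢ Set.Icc (-Real.pi) Real.pi
      ⊆ polarBox (h ^ (-τ)) := Set.prod_mono (Set.Icc_subset_Icc_left hR.le) le_rfl
  have h3 : ∀ f : ℝ × ℝ → ℝ,
      ∫ y in Set.Icc (h ^ (-τ)) (2 * h ^ (-τ)) ×ˢ Set.Icc (-Real.pi) Real.pi, f y
        = ∫ y in polarBox (h ^ (-τ)),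
          (Set.Icc (h ^ (-τ)) (2 * h ^ (-τ)) ×ˢ Set.Icc (-Real.pi) Real.pi).indicator f y :=
    fun f => by rw [setIntegral_indicator (hmeas _), Set.inter_eq_self_of_subset_right h2]
  rw [h3, ← integral_const_mul, ← integral_const_mul]
  congr 1
  funext y
  by_cases hy : y ∈ Set.Icc (h ^ (-τ)) (2 * h ^ (-τ)) ×ˢ Set.Icc (-Real.pi) Real.pi
  · simp only [Set.indicator_of_mem hy]; ring
  · simp only [Set.indicator_of_notMem hy]; ring

/-- Products with the cutoff `m` and with `ξ + ρ̂` keep the weight, because `⟨ξ⟩` is bounded on the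
support of `m`. -/
theorem symbolBound_microCutoff_mul_sum (hh₀ : h₀ ≤ 1) (hσ : 0 ≤ σ) (hlam : 0 < lam)
    (hρ : ∀ h ∈ Set.Ioc 0 h₀, IsFrequency lam h (ρ h))
    {w : ℝ → EuclideanSpace ℝ (Fin n) × EuclideanSpace ℝ (Fin n) → ℝ}
    (hw : ∀ h ∈ Set.Ioc 0 h₀, ∀ z, 0 ≤ w h z)
    {u : Fin n → ℝ → EuclideanSpace ℝ (Fin n) × EuclideanSpace ℝ (Fin n) → ℂ}
    (hu : ∀ j, SymbolBound h₀ σ w (u j)) :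
    SymbolBound h₀ σ (fun h z => nearWeight ρ h z * w h z)
      (fun h z => (microCutoff h (ρ h) z.2 : ℂ) *
        ∑ j, ((z.2 j : ℂ) + h * ρ h j) * u j h z) := by
  have h1 : SymbolBound h₀ σ (fun h z => bracket z.2 * w h z)
      (fun h z => ∑ j, ((z.2 j : ℂ) + h * ρ h j) * u j h z) :=
    SymbolBound.sum Finset.univ (fun h hh z => mul_nonneg (bracket_pos _).le (hw h hh z))
      fun j _ => (symbolBound_coord_add_freq hh₀ hσ hlam hρ j).mul (hu j)
  refine ((symbolBound_microCutoff hh₀ hσ hlam hρ).mul h1).weight_mono 4 (by norm_num)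
    fun h hh z => ?_
  have h2 := mul_le_mul_of_nonneg_right (bracket_mul_nearWeight_le hlam (hρ h hh) z) (hw h hh z)
  calc nearWeight ρ h z * (bracket z.2 * w h z) = bracket z.2 * nearWeight ρ h z * w h z := by ring
    _ ≤ 4 * nearWeight ρ h z * w h z := h2
    _ = _ := by ring

theorem symbolBound_phase (hh₀ : h₀ ≤ 1) (hσ₀ : 0 ≤ σ₀) (hτ : 0 ≤ τ) (hlam : 0 < lam)
    (hρ : ∀ h ∈ Set.Ioc 0 h₀, IsFrequency lam h (ρ h))
    (hB : SymbolBound h₀ σ₀ (fun _ x => bracket x ^ (-1 - ε)) B) :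
    SymbolBound h₀ (σ₀ + τ) (nearMean ε τ ρ) (fun h => phase τ h (ρ h) (B h)) :=
  (symbolBound_microCutoff_mul_sum hh₀ (add_nonneg hσ₀ hτ) hlam hρ
    (fun _ _ _ => integral_nonneg fun _ => Real.rpow_nonneg (bracket_pos _).le _)
    (fun j => symbolBound_transportSolution hh₀ hτ hB j)).const_mul (-Complex.I)

theorem symbolBound_sum_transportError (hh₀ : h₀ ≤ 1) (hσ₀ : 0 ≤ σ₀) (hτ : 0 ≤ τ)
    (hlam : 0 < lam) (hρ : ∀ h ∈ Set.Ioc 0 h₀, IsFrequency lam h (ρ h))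
    (hB : SymbolBound h₀ σ₀ (fun _ x => bracket x ^ (-1 - ε)) B) :
    SymbolBound h₀ (σ₀ + τ) (nearTail ε τ ρ) (fun h z => (microCutoff h (ρ h) z.2 : ℂ) *
        ∑ j, ((z.2 j : ℂ) + h * ρ h j) * transportError τ h (ρ h) (B h) j z) :=
  symbolBound_microCutoff_mul_sum hh₀ (add_nonneg hσ₀ hτ) hlam hρ
    (fun _ hh _ => mul_nonneg (inv_nonneg.2 (Real.rpow_nonneg hh.1.le _))
      (integral_nonneg fun _ => Real.rpow_nonneg (bracket_pos _).le _))
    (fun j => symbolBound_transportError hh₀ hτ hB j)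

/-- Functions of `x` alone, viewed on phase space with a larger exponent. -/
theorem SymbolBound.comp_fst {F : Type*} [NormedAddCommGroup F] [NormedSpace ℝ F] (hh₀ : h₀ ≤ 1)
    (hσ : σ₀ ≤ σ) {w : ℝ → EuclideanSpace ℝ (Fin n) → ℝ} {u : ℝ → EuclideanSpace ℝ (Fin n) → F}
    (hw : ∀ h ∈ Set.Ioc 0 h₀, ∀ x, 0 ≤ w h x) (hu : SymbolBound h₀ σ₀ w u) :
    SymbolBound h₀ σ (fun h (z : EuclideanSpace ℝ (Fin n) × EuclideanSpace ℝ (Fin n)) => w h z.1)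
      (fun h z => u h z.1) := by
  refine ⟨fun h hh => (hu.1 h hh).comp contDiff_fst, fun k => ?_⟩
  obtain ⟨K, hK, H⟩ := hu.2 k
  refine ⟨K, hK, fun h hh z => ?_⟩
  have h1 := norm_iteratedFDeriv_comp_affine_le (hu.1 h hh) (ContinuousLinearMap.fst ℝ
    (EuclideanSpace ℝ (Fin n)) (EuclideanSpace ℝ (Fin n))) 0 k z
  simp only [add_zero, ContinuousLinearMap.coe_fst'] at h1
  have h2 : ‖ContinuousLinearMap.fst ℝ (EuclideanSpace ℝ (Fin n))
      (EuclideanSpace ℝ (Fin n))‖ ^ k ≤ 1 :=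
    pow_le_one₀ (norm_nonneg _) (ContinuousLinearMap.norm_fst_le ..)
  have h3 : h ^ (-σ₀) ≤ h ^ (-σ) :=
    Real.rpow_le_rpow_of_exponent_ge hh.1 (hh.2.trans hh₀) (by linarith)
  calc _ ≤ _ := h1
    _ ≤ ‖iteratedFDeriv ℝ k (u h) z.1‖ * 1 := by gcongr
    _ ≤ K * (h ^ (-σ₀)) ^ k * w h z.1 := by rw [mul_one]; exact H h hh z.1
    _ ≤ K * (h ^ (-σ)) ^ k * w h z.1 := by
      have := hw h hh z.1
      have := Real.rpow_nonneg hh.1.le (-σ₀)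
      gcongr

theorem symbolBound_bracket_fst (hh₀ : h₀ ≤ 1) (hσ : 0 ≤ σ) :
    SymbolBound h₀ σ (fun _ z => bracket z.1)
      (fun _ (z : EuclideanSpace ℝ (Fin n) × EuclideanSpace ℝ (Fin n)) => (bracket z.1 : ℂ)) := by
  have hcoord : ∀ j : Fin n, SymbolBound h₀ σ (fun _ z => bracket z.1)
      (fun _ (z : EuclideanSpace ℝ (Fin n) × EuclideanSpace ℝ (Fin n)) => z.1 j) := fun j =>
    SymbolBound.clm ((EuclideanSpace.proj j : EuclideanSpace ℝ (Fin n) →L[ℝ] ℝ).comp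
      (ContinuousLinearMap.fst ℝ (EuclideanSpace ℝ (Fin n)) (EuclideanSpace ℝ (Fin n)))) hh₀ hσ
      (fun _ _ z => one_le_bracket _)
      (fun _ _ z => (PiLp.norm_apply_le z.1 j).trans (norm_le_bracket z.1))
  have h1 : SymbolBound h₀ σ (fun _ z => bracket z.1 * bracket z.1)
      (fun _ (z : EuclideanSpace ℝ (Fin n) × EuclideanSpace ℝ (Fin n)) => ∑ j, z.1 j * z.1 j) :=
    SymbolBound.sum Finset.univ (fun _ _ _ => mul_self_nonneg _) fun j _ =>
      (hcoord j).mul (hcoord j)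
  have h2 : SymbolBound h₀ σ (fun _ z => bracket z.1 * bracket z.1)
      (fun _ (z : EuclideanSpace ℝ (Fin n) × EuclideanSpace ℝ (Fin n)) => (1 : ℝ)) :=
    SymbolBound.const fun _ _ z => by
      have := one_le_bracket z.1
      rw [norm_one]; nlinarith
  have h3 : SymbolBound h₀ σ (fun _ z => 1 + ‖z.1‖ ^ 2)
      (fun _ (z : EuclideanSpace ℝ (Fin n) × EuclideanSpace ℝ (Fin n)) => 1 + ‖z.1‖ ^ 2) := by
    refine ((h2.add h1).weight_mono 1 zero_le_one fun _ _ z => ?_).congr fun _ _ => ?_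
    · rw [← bracket_sq, one_mul, sq]
    · funext z
      rw [EuclideanSpace.norm_sq_eq]
      simp [sq]
  exact (h3.rpow (fun _ _ z => by positivity) (1 / 2)).clm_comp Complex.ofRealCLM

end PhaseBounds

end SemiclassicalConjugation

/-! ### The symbols of the conjugation -/

namespace SemiclassicalConjugation

noncomputable section ConjugationSymbols

variable {n : ℕ}

/-- The symbol `c = e^Φ` of `C`. -/
def ellipticSymbol (τ h : ℝ) (ρ : EuclideanSpace ℂ (Fin n))
    (B : EuclideanSpace ℝ (Fin n) → EuclideanSpace ℂ (Fin n))
    (z : EuclideanSpace ℝ (Fin n) × EuclideanSpace ℝ (Fin n)) : ℂ :=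
  Complex.exp (phase τ h ρ B z)

/-- The factor `c̃ / c = 1 + 2h ((1 - m) / p) (ξ + ρ̂)·B`. -/
def ellipticFactor (h : ℝ) (ρ : EuclideanSpace ℂ (Fin n))
    (B : EuclideanSpace ℝ (Fin n) → EuclideanSpace ℂ (Fin n))
    (z : EuclideanSpace ℝ (Fin n) × EuclideanSpace ℝ (Fin n)) : ℂ :=
  1 + 2 * h * (parametrix h ρ z.2 * ∑ j, ((z.2 j : ℂ) + h * ρ j) * B z.1 j)

/-- The factor `s / c`: the remainder of the symbol splitting, divided by `h^{1+β}⟨x⟩^{-1}`. -/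
def remainderFactor (β τ h : ℝ) (ρ : EuclideanSpace ℂ (Fin n))
    (B : EuclideanSpace ℝ (Fin n) → EuclideanSpace ℂ (Fin n))
    (z : EuclideanSpace ℝ (Fin n) × EuclideanSpace ℝ (Fin n)) : ℂ :=
  ((-2 * h ^ (-β) : ℝ) : ℂ) * ((bracket z.1 : ℂ) * ((microCutoff h ρ z.2 : ℂ) *
      ∑ j, ((z.2 j : ℂ) + h * ρ j) * transportError τ h ρ B j z))
    + ((-h ^ (1 - β) : ℝ) : ℂ) * ((bracket z.1 : ℂ) * secondOrderTerm (phase τ h ρ B) B z)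

/-- The symbol splitting multiplied by `c = e^Φ`: the full symbol of `(P + hQ) C` is
`c̃ p + h^{1+β}⟨x⟩^{-1} s`. -/
theorem ellipticSymbol_identity {β τ h : ℝ} {ρ : EuclideanSpace ℂ (Fin n)}
    {B : EuclideanSpace ℝ (Fin n) → EuclideanSpace ℂ (Fin n)} (hh : 0 < h) (hB : ContDiff ℝ ∞ B)
    (z : EuclideanSpace ℝ (Fin n) × EuclideanSpace ℝ (Fin n)) :
    ellipticSymbol τ h ρ B z * (charSymbol h ρ z.2
        + 2 * h * ∑ j, ((z.2 j : ℂ) + h * ρ j) *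
            (B z.1 j - Complex.I * fderiv ℝ (phase τ h ρ B) z (EuclideanSpace.single j 1, 0))
        - (h : ℂ) ^ 2 * secondOrderTerm (phase τ h ρ B) B z)
      = ellipticSymbol τ h ρ B z * ellipticFactor h ρ B z * charSymbol h ρ z.2
        + ((h ^ (1 + β) * (bracket z.1)⁻¹ : ℝ) : ℂ) *
          (ellipticSymbol τ h ρ B z * remainderFactor β τ h ρ B z) := by
  rw [symbol_splitting hh hB, ellipticFactor, remainderFactor]
  have h0 : ((bracket z.1)⁻¹ : ℝ) * bracket z.1 = 1 := inv_mul_cancel₀ (bracket_pos _).ne'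
  have h1 : h ^ (1 + β) * (bracket z.1)⁻¹ * (-2 * h ^ (-β) * bracket z.1) = -2 * h := by
    have : h ^ (1 + β) * h ^ (-β) = h := by
      rw [← Real.rpow_add hh]; simp
    linear_combination (-2 * ((bracket z.1)⁻¹ * bracket z.1)) * this - 2 * h * h0
  have h2 : h ^ (1 + β) * (bracket z.1)⁻¹ * (-h ^ (1 - β) * bracket z.1) = -h ^ 2 := by
    have : h ^ (1 + β) * h ^ (1 - β) = h ^ 2 := by
      rw [← Real.rpow_add hh, ← Real.rpow_natCast]; congr 1; push_cast; ring
    linear_combination (-((bracket z.1)⁻¹ * bracket z.1)) * this - h ^ 2 * h0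
  have h1' := congrArg (fun t : ℝ => (t : ℂ)) h1
  have h2' := congrArg (fun t : ℝ => (t : ℂ)) h2
  push_cast at h1' h2' ⊢
  linear_combination (-ellipticSymbol τ h ρ B z * ((microCutoff h ρ z.2 : ℂ) *
      ∑ j, ((z.2 j : ℂ) + h * ρ j) * transportError τ h ρ B j z)) * h1'
    - (ellipticSymbol τ h ρ B z * secondOrderTerm (phase τ h ρ B) B z) * h2'

/-- Bound of the term that is divided by `p`, with a constant that does not depend on the
frequency. -/
theorem norm_parametrix_mul_sum_le {lam h : ℝ} (hlam : 0 < lam) (hh : 0 < h)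
    {ρ : EuclideanSpace ℂ (Fin n)} (hρ : IsFrequency lam h ρ) (ξ : EuclideanSpace ℝ (Fin n))
    {v : EuclideanSpace ℂ (Fin n)} {K : ℝ} (hK : 0 ≤ K) (hv : ‖v‖ ≤ K) :
    ‖parametrix h ρ ξ * ∑ j, ((ξ j : ℂ) + h * ρ j) * v j‖ ≤ 150750 * n ^ 2 * K := by
  have hb1 := one_le_bracket ξ
  have hξ : ∀ j, ‖(ξ j : ℂ)‖ ≤ bracket ξ := fun j => by
    rw [Complex.norm_real]; exact (PiLp.norm_apply_le ξ j).trans (norm_le_bracket ξ)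
  have h1 : ‖∑ j, ((ξ j : ℂ) + h * ρ j) * v j‖ ≤ n * (3 * bracket ξ * K) := by
    refine (norm_sum_le_of_le _ (f := fun j => ((ξ j : ℂ) + h * ρ j) * v j)
      (n := fun _ => 3 * bracket ξ * K) fun j _ => ?_).trans (by simp)
    rw [norm_mul]
    have h2 := norm_add_le (ξ j : ℂ) (h * ρ j)
    have h3 := norm_freq_component_le hlam hh hρ j
    have h4 := hξ j
    have h5 : ‖(ξ j : ℂ) + h * ρ j‖ ≤ 3 * bracket ξ := by linarith
    exact mul_le_mul h5 ((PiLp.norm_apply_le v j).trans hv) (norm_nonneg _) (by positivity)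
  have h2 : ‖charSymbol h ρ ξ‖ ≤ n * (5 * bracket ξ ^ 2) := by
    refine (norm_sum_le_of_le _ (f := fun j => (ξ j : ℂ) * ξ j + 2 * (h * ρ j) * ξ j)
      (n := fun _ => 5 * bracket ξ ^ 2) fun j _ => ?_).trans (by simp)
    refine (norm_add_le _ _).trans ?_
    rw [norm_mul, norm_mul, norm_mul 2, Complex.norm_ofNat]
    have h3 := norm_freq_component_le hlam hh hρ j
    have h4 := hξ j
    have h5 : ‖(ξ j : ℂ)‖ * ‖(ξ j : ℂ)‖ ≤ bracket ξ * bracket ξ := by gcongr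
    have h6 : 2 * ‖(h : ℂ) * ρ j‖ * ‖(ξ j : ℂ)‖ ≤ 2 * 2 * bracket ξ := by gcongr
    nlinarith
  have hr : 0 ≤ regSq h ρ ξ ^ (-1 : ℝ) := Real.rpow_nonneg (regSq_pos h ρ ξ).le _
  have h3 := bracket_mul_parametrix_le hlam hρ ξ
  rw [norm_mul, parametrix, norm_mul, RCLike.norm_conj, Complex.norm_real, Real.norm_of_nonneg hr]
  calc ‖charSymbol h ρ ξ‖ * regSq h ρ ξ ^ (-1 : ℝ) * ‖∑ j, ((ξ j : ℂ) + h * ρ j) * v j‖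
      ≤ n * (5 * bracket ξ ^ 2) * regSq h ρ ξ ^ (-1 : ℝ) * (n * (3 * bracket ξ * K)) := by gcongr
    _ = 15 * n ^ 2 * K * (bracket ξ ^ 3 * regSq h ρ ξ ^ (-1 : ℝ)) := by ring
    _ ≤ 15 * n ^ 2 * K * (bracket ξ ^ 4 * regSq h ρ ξ ^ (-1 : ℝ)) := by
        gcongr; norm_num
    _ ≤ 15 * n ^ 2 * K * 10050 := by gcongr
    _ = _ := by ring

variable {h₀ σ₀ τ ε lam : ℝ} {ρ : ℝ → EuclideanSpace ℂ (Fin n)}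
  {B : ℝ → EuclideanSpace ℝ (Fin n) → EuclideanSpace ℂ (Fin n)}

theorem symbolBound_component_fst (hh₀ : h₀ ≤ 1) (hε : 0 < ε) (hτ : 0 ≤ τ)
    (hB : SymbolBound h₀ σ₀ (fun _ x => bracket x ^ (-1 - ε)) B) (j : Fin n) :
    SymbolBound h₀ (σ₀ + τ) (fun _ _ => 1)
      (fun h (z : EuclideanSpace ℝ (Fin n) × EuclideanSpace ℝ (Fin n)) => B h z.1 j) :=
  ((hB.component j).comp_fst hh₀ (by linarith) fun _ _ _ =>
    Real.rpow_nonneg (bracket_pos _).le _).weight_mono 1 zero_le_one fun _ _ z => by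
      rw [one_mul]
      exact Real.rpow_le_one_of_one_le_of_nonpos (one_le_bracket _) (by linarith)

theorem symbolBound_phase_one (hh₀ : h₀ ≤ 1) (hε : 0 < ε) (hσ₀ : 0 ≤ σ₀) (hτ : 0 ≤ τ)
    (hlam : 0 < lam) (hh4 : ∀ h ∈ Set.Ioc 0 h₀, h ^ 2 * lam ≤ 1 / 4)
    (hρ : ∀ h ∈ Set.Ioc 0 h₀, IsFrequency lam h (ρ h))
    (hB : SymbolBound h₀ σ₀ (fun _ x => bracket x ^ (-1 - ε)) B) :
    SymbolBound h₀ (σ₀ + τ) (fun _ _ => 1) (fun h => phase τ h (ρ h) (B h)) := by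
  obtain ⟨C, hC, H⟩ := exists_nearMean_le (τ := τ) hε hlam hh4 hρ
  exact (symbolBound_phase hh₀ hσ₀ hτ hlam hρ hB).weight_mono C hC fun h hh z => by
    rw [mul_one]; exact H h hh z

theorem symbolBound_ellipticFactor (hh₀ : h₀ ≤ 1) (hε : 0 < ε) (hσ₀ : 0 ≤ σ₀) (hτ : 0 ≤ τ)
    (hlam : 0 < lam) (hρ : ∀ h ∈ Set.Ioc 0 h₀, IsFrequency lam h (ρ h))
    (hB : SymbolBound h₀ σ₀ (fun _ x => bracket x ^ (-1 - ε)) B) :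
    SymbolBound h₀ (σ₀ + τ) (fun _ _ => 1) (fun h => ellipticFactor h (ρ h) (B h)) := by
  have hσ : 0 ≤ σ₀ + τ := add_nonneg hσ₀ hτ
  have h1 : SymbolBound h₀ (σ₀ + τ) (fun _ z => bracket z.2 * 1)
      (fun h (z : EuclideanSpace ℝ (Fin n) × EuclideanSpace ℝ (Fin n)) =>
        ∑ j, ((z.2 j : ℂ) + h * ρ h j) * B h z.1 j) :=
    SymbolBound.sum Finset.univ (fun _ _ z => by rw [mul_one]; exact (bracket_pos _).le)
      fun j _ => (symbolBound_coord_add_freq hh₀ hσ hlam hρ j).mul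
        (symbolBound_component_fst hh₀ hε hτ hB j)
  have h2 : SymbolBound h₀ (σ₀ + τ) (fun _ _ => 2)
      (fun h (_ : EuclideanSpace ℝ (Fin n) × EuclideanSpace ℝ (Fin n)) => 2 * (h : ℂ)) :=
    SymbolBound.const (a := fun h => 2 * (h : ℂ)) fun h hh z => by
      rw [norm_mul, Complex.norm_ofNat, Complex.norm_real, Real.norm_of_nonneg hh.1.le]
      linarith [hh.2]
  have h3 : SymbolBound h₀ (σ₀ + τ) (fun _ _ => 1)
      (fun h (z : EuclideanSpace ℝ (Fin n) × EuclideanSpace ℝ (Fin n)) => 2 * (h : ℂ) *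
        (parametrix h (ρ h) z.2 * ∑ j, ((z.2 j : ℂ) + h * ρ h j) * B h z.1 j)) := by
    refine (h2.mul ((symbolBound_parametrix hh₀ hσ hlam hρ).mul h1)).weight_mono 20100
      (by norm_num) fun h hh z => ?_
    have h4 := bracket_mul_parametrix_le hlam (hρ h hh) z.2
    have hr : 0 ≤ regSq h (ρ h) z.2 ^ (-1 : ℝ) := Real.rpow_nonneg (regSq_pos h (ρ h) z.2).le _
    have hb := one_le_bracket z.2
    calc 2 * (bracket z.2 ^ 2 * regSq h (ρ h) z.2 ^ (-1 : ℝ) * (bracket z.2 * 1))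
        = 2 * (bracket z.2 ^ 3 * regSq h (ρ h) z.2 ^ (-1 : ℝ)) := by ring
      _ ≤ 2 * (bracket z.2 ^ 4 * regSq h (ρ h) z.2 ^ (-1 : ℝ)) := by gcongr; norm_num
      _ ≤ 20100 * 1 := by linarith
  have h4 : SymbolBound h₀ (σ₀ + τ) (fun _ _ => 1)
      (fun _ (_ : EuclideanSpace ℝ (Fin n) × EuclideanSpace ℝ (Fin n)) => (1 : ℂ)) :=
    SymbolBound.const fun _ _ _ => by simp
  exact h4.add h3

/-- Two derivatives in `x` cost `h^{-2σ}`, the products are of the same size because the phase is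
bounded. -/
theorem symbolBound_secondOrderTerm (hh₀ : h₀ ≤ 1) (hε : 0 < ε) (hσ₀ : 0 ≤ σ₀) (hτ : 0 ≤ τ)
    (hlam : 0 < lam) (hh4 : ∀ h ∈ Set.Ioc 0 h₀, h ^ 2 * lam ≤ 1 / 4)
    (hρ : ∀ h ∈ Set.Ioc 0 h₀, IsFrequency lam h (ρ h))
    (hB : SymbolBound h₀ σ₀ (fun _ x => bracket x ^ (-1 - ε)) B) :
    SymbolBound h₀ (σ₀ + τ)
      (fun h z => h ^ (-(σ₀ + τ)) * (h ^ (-(σ₀ + τ)) * nearMean ε τ ρ h z))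
      (fun h => secondOrderTerm (phase τ h (ρ h) (B h)) (B h)) := by
  obtain ⟨C, hC, HC⟩ := exists_nearMean_le (τ := τ) hε hlam hh4 hρ
  have hΦ := symbolBound_phase hh₀ hσ₀ hτ hlam hρ hB
  have hp : ∀ h ∈ Set.Ioc 0 h₀, 0 ≤ h ^ (-(σ₀ + τ)) := fun h hh => Real.rpow_nonneg hh.1.le _
  have hp1 : ∀ h ∈ Set.Ioc 0 h₀, 1 ≤ h ^ (-(σ₀ + τ)) := fun h hh =>
    Real.one_le_rpow_of_pos_of_le_one_of_nonpos hh.1 (hh.2.trans hh₀) (by linarith)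
  refine SymbolBound.sum Finset.univ (fun h hh z => mul_nonneg (hp h hh) (mul_nonneg (hp h hh)
    (nearMean_nonneg h z))) fun j _ => ?_
  have hd := hΦ.fderiv_apply ((EuclideanSpace.single j 1, 0) :
    EuclideanSpace ℝ (Fin n) × EuclideanSpace ℝ (Fin n))
  have hdd := hd.fderiv_apply ((EuclideanSpace.single j 1, 0) :
    EuclideanSpace ℝ (Fin n) × EuclideanSpace ℝ (Fin n))
  have hsq : SymbolBound h₀ (σ₀ + τ)
      (fun h z => h ^ (-(σ₀ + τ)) * (h ^ (-(σ₀ + τ)) * nearMean ε τ ρ h z))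
      (fun h z => fderiv ℝ (phase τ h (ρ h) (B h)) z (EuclideanSpace.single j 1, 0) ^ 2) := by
    refine ((hd.mul hd).weight_mono C hC fun h hh z => ?_).congr fun h _ => funext fun z => sq _
    have h1 := mul_le_mul_of_nonneg_right (HC h hh z) (nearMean_nonneg (ε := ε) (τ := τ) (ρ := ρ) h z)
    calc h ^ (-(σ₀ + τ)) * nearMean ε τ ρ h z * (h ^ (-(σ₀ + τ)) * nearMean ε τ ρ h z)
        = h ^ (-(σ₀ + τ)) * h ^ (-(σ₀ + τ)) * (nearMean ε τ ρ h z * nearMean ε τ ρ h z) := by ring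
      _ ≤ h ^ (-(σ₀ + τ)) * h ^ (-(σ₀ + τ)) * (C * nearMean ε τ ρ h z) :=
        mul_le_mul_of_nonneg_left h1 (mul_nonneg (hp h hh) (hp h hh))
      _ = _ := by ring
  have hmix : SymbolBound h₀ (σ₀ + τ)
      (fun h z => h ^ (-(σ₀ + τ)) * (h ^ (-(σ₀ + τ)) * nearMean ε τ ρ h z))
      (fun h z => 2 * Complex.I * B h z.1 j *
        fderiv ℝ (phase τ h (ρ h) (B h)) z (EuclideanSpace.single j 1, 0)) := by
    refine ((((symbolBound_component_fst hh₀ hε hτ hB j).const_mul (2 * Complex.I)).mul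
      hd).weight_mono 1 zero_le_one fun h hh z => ?_)
    rw [one_mul, one_mul]
    exact le_mul_of_one_le_left (mul_nonneg (hp h hh) (nearMean_nonneg h z)) (hp1 h hh)
  exact (hdd.add hsq).add hmix

/-- The remainder is a symbol of order zero. The transport error gains `h^{τε/8}` over `h`; the
terms of second order gain `h^{1-2σ-τ}`, where `σ = σ₀ + τ` is the exponent of the class. -/
theorem symbolBound_remainderFactor {β : ℝ} (hβ1 : β ≤ τ * ε / 8) (hβ2 : β ≤ 1 - 3 * (σ₀ + τ))
    (hh₀ : h₀ ≤ 1) (hε : 0 < ε) (hε1 : ε ≤ 1) (hσ₀ : 0 ≤ σ₀) (hτ : 0 ≤ τ)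
    (hlam : 0 < lam) (hh4 : ∀ h ∈ Set.Ioc 0 h₀, h ^ 2 * lam ≤ 1 / 4)
    (hρ : ∀ h ∈ Set.Ioc 0 h₀, IsFrequency lam h (ρ h))
    (hB : SymbolBound h₀ σ₀ (fun _ x => bracket x ^ (-1 - ε)) B) :
    SymbolBound h₀ (σ₀ + τ) (fun _ _ => 1) (fun h => remainderFactor β τ h (ρ h) (B h)) := by
  have hbr := symbolBound_bracket_fst (n := n) (σ := σ₀ + τ) hh₀ (add_nonneg hσ₀ hτ)
  have hle1 : ∀ h ∈ Set.Ioc 0 h₀, ∀ a : ℝ, 0 ≤ a → h ^ a ≤ 1 := fun h hh a ha =>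
    Real.rpow_le_one hh.1.le (hh.2.trans hh₀) ha
  have h1 : SymbolBound h₀ (σ₀ + τ) (fun _ _ => 1)
      (fun h (z : EuclideanSpace ℝ (Fin n) × EuclideanSpace ℝ (Fin n)) =>
        ((-2 * h ^ (-β) : ℝ) : ℂ) * ((bracket z.1 : ℂ) * ((microCutoff h (ρ h) z.2 : ℂ) *
          ∑ j, ((z.2 j : ℂ) + h * ρ h j) * transportError τ h (ρ h) (B h) j z))) := by
    obtain ⟨C, hC, HC⟩ := exists_bracket_mul_nearTail_le hε hε1 hlam hτ hh₀ hh4 hρ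
    have hc : SymbolBound h₀ (σ₀ + τ) (fun h _ => 2 * h ^ (-β))
        (fun h (_ : EuclideanSpace ℝ (Fin n) × EuclideanSpace ℝ (Fin n)) =>
          ((-2 * h ^ (-β) : ℝ) : ℂ)) :=
      SymbolBound.const (a := fun h => ((-2 * h ^ (-β) : ℝ) : ℂ)) fun h hh z => by
        rw [Complex.norm_real, norm_mul, Real.norm_of_nonneg (Real.rpow_nonneg hh.1.le _)]
        simp
    refine (hc.mul (hbr.mul (symbolBound_sum_transportError hh₀ hσ₀ hτ hlam hρ hB))).weight_mono
      (2 * C) (by positivity) fun h hh z => ?_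
    calc 2 * h ^ (-β) * (bracket z.1 * nearTail ε τ ρ h z)
        ≤ 2 * h ^ (-β) * (C * h ^ (τ * ε / 8)) :=
          mul_le_mul_of_nonneg_left (HC h hh z) (by have := Real.rpow_nonneg hh.1.le (-β); positivity)
      _ = 2 * C * h ^ (-β + τ * ε / 8) := by rw [Real.rpow_add hh.1]; ring
      _ ≤ 2 * C * 1 := by
          gcongr; exact hle1 h hh _ (by linarith)
  have h2 : SymbolBound h₀ (σ₀ + τ) (fun _ _ => 1)
      (fun h (z : EuclideanSpace ℝ (Fin n) × EuclideanSpace ℝ (Fin n)) =>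
        ((-h ^ (1 - β) : ℝ) : ℂ) * ((bracket z.1 : ℂ) *
          secondOrderTerm (phase τ h (ρ h) (B h)) (B h) z)) := by
    obtain ⟨C, hC, HC⟩ := exists_bracket_mul_nearMean_le hε hε1 hlam hτ hh₀ hh4 hρ
    have hc : SymbolBound h₀ (σ₀ + τ) (fun h _ => h ^ (1 - β))
        (fun h (_ : EuclideanSpace ℝ (Fin n) × EuclideanSpace ℝ (Fin n)) =>
          ((-h ^ (1 - β) : ℝ) : ℂ)) :=
      SymbolBound.const (a := fun h => ((-h ^ (1 - β) : ℝ) : ℂ)) fun h hh z => by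
        rw [Complex.norm_real, norm_neg, Real.norm_of_nonneg (Real.rpow_nonneg hh.1.le _)]
    refine (hc.mul (hbr.mul (symbolBound_secondOrderTerm hh₀ hε hσ₀ hτ hlam hh4 hρ
      hB))).weight_mono C hC fun h hh z => ?_
    have hp : ∀ a : ℝ, 0 ≤ h ^ a := fun a => Real.rpow_nonneg hh.1.le a
    calc h ^ (1 - β) * (bracket z.1 *
          (h ^ (-(σ₀ + τ)) * (h ^ (-(σ₀ + τ)) * nearMean ε τ ρ h z)))
        = h ^ (1 - β) * h ^ (-(σ₀ + τ)) * h ^ (-(σ₀ + τ)) *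
          (bracket z.1 * nearMean ε τ ρ h z) := by ring
      _ ≤ h ^ (1 - β) * h ^ (-(σ₀ + τ)) * h ^ (-(σ₀ + τ)) * (C * h ^ (-τ)) :=
          mul_le_mul_of_nonneg_left (HC h hh z) (mul_nonneg (mul_nonneg (hp _) (hp _)) (hp _))
      _ = C * h ^ (1 - β + -(σ₀ + τ) + -(σ₀ + τ) + -τ) := by
          rw [Real.rpow_add hh.1, Real.rpow_add hh.1, Real.rpow_add hh.1]; ring
      _ ≤ C * 1 := by
          gcongr; exact hle1 h hh _ (by linarith)
  exact h1.add h2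

theorem SymbolBound.isSymbol {σ : ℝ}
    {c : ℝ → EuclideanSpace ℝ (Fin n) × EuclideanSpace ℝ (Fin n) → ℂ}
    (hc : SymbolBound h₀ σ (fun _ _ => 1) c) : IsSymbol h₀ 0 σ (fun h x ξ => c h (x, ξ)) := by
  refine ⟨hc.1, fun k => ?_⟩
  obtain ⟨K, -, H⟩ := hc.2 k
  refine ⟨K, fun h hh x ξ => (H h hh (x, ξ)).trans (le_of_eq ?_)⟩
  rw [Real.rpow_mul_natCast hh.1.le, Real.rpow_zero]

theorem SymbolBound.exists_bound {σ : ℝ}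
    {c : ℝ → EuclideanSpace ℝ (Fin n) × EuclideanSpace ℝ (Fin n) → ℂ}
    (hc : SymbolBound h₀ σ (fun _ _ => 1) c) {h : ℝ} (hh : h ∈ Set.Ioc 0 h₀) (k : ℕ) :
    ∃ K : ℝ, ∀ z, ‖iteratedFDeriv ℝ k (c h) z‖ ≤ K := by
  obtain ⟨K, -, H⟩ := hc.2 k
  exact ⟨_, fun z => (H h hh z).trans (le_of_eq (mul_one _))⟩

theorem SymbolBound.mul_bounded {σ : ℝ}
    {c d : ℝ → EuclideanSpace ℝ (Fin n) × EuclideanSpace ℝ (Fin n) → ℂ}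
    (hc : SymbolBound h₀ σ (fun _ _ => 1) c) (hd : SymbolBound h₀ σ (fun _ _ => 1) d) :
    SymbolBound h₀ σ (fun _ _ => 1) (fun h z => c h z * d h z) :=
  (hc.mul hd).weight_mono 1 zero_le_one fun _ _ _ => le_rfl

end ConjugationSymbols

end SemiclassicalConjugation

/-! ### Conjugation with uniform constants -/

namespace SemiclassicalConjugation

/-- The conjugation for one family of frequencies. The hypothesis `hM` makes the factor `c̃ / c`
close to one. -/
theorem exists_conjugation {n : ℕ} {h₀ σ₀ τ ε lam β M : ℝ} (hβ1 : β ≤ τ * ε / 8)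
    (hβ2 : β ≤ 1 - 3 * (σ₀ + τ)) (hh₀ : h₀ ≤ 1) (hε : 0 < ε) (hε1 : ε ≤ 1) (hσ₀ : 0 ≤ σ₀)
    (hτ : 0 ≤ τ) (hlam : 0 < lam) (hh4 : ∀ h ∈ Set.Ioc 0 h₀, h ^ 2 * lam ≤ 1 / 4)
    {B : ℝ → EuclideanSpace ℝ (Fin n) → EuclideanSpace ℂ (Fin n)}
    (hB : SymbolBound h₀ σ₀ (fun _ x => bracket x ^ (-1 - ε)) B) (hM0 : 0 ≤ M)
    (hBM : ∀ h ∈ Set.Ioc 0 h₀, ∀ x, ‖B h x‖ ≤ M) (hM : h₀ * (2 * (150750 * n ^ 2 * M)) ≤ 1 / 2)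
    {ρ : ℝ → EuclideanSpace ℂ (Fin n)} (hρ : ∀ h ∈ Set.Ioc 0 h₀, IsFrequency lam h (ρ h)) :
    ∃ c c' s : ℝ → EuclideanSpace ℝ (Fin n) → EuclideanSpace ℝ (Fin n) → ℂ,
      IsSymbol h₀ 0 (σ₀ + τ) c ∧ IsSymbol h₀ 0 (σ₀ + τ) c' ∧ IsSymbol h₀ 0 (σ₀ + τ) s ∧
      (∀ h ∈ Set.Ioc 0 h₀, ∀ (f : 𝓢(EuclideanSpace ℝ (Fin n), ℂ)) (x : EuclideanSpace ℝ (Fin n)),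
        opP h (ρ h) (Op h (c h) f) x + (h : ℂ) * opQ h (ρ h) (B h) (Op h (c h) f) x =
          Op h (c' h) (opP h (ρ h) f) x
            + ((h ^ (1 + β) * (bracket x)⁻¹ : ℝ) : ℂ) * Op h (s h) f x) ∧
      IsEllipticSymbol h₀ c ∧ IsEllipticSymbol h₀ c' := by
  have hΦ := symbolBound_phase_one hh₀ hε hσ₀ hτ hlam hh4 hρ hB
  have hc : SymbolBound h₀ (σ₀ + τ) (fun _ _ => 1) (fun h => ellipticSymbol τ h (ρ h) (B h)) :=
    SymbolBound.comp_of_bounded Complex.contDiff_exp hΦ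
  have hc' := hc.mul_bounded (symbolBound_ellipticFactor hh₀ hε hσ₀ hτ hlam hρ hB)
  have hs := hc.mul_bounded
    (symbolBound_remainderFactor hβ1 hβ2 hh₀ hε hε1 hσ₀ hτ hlam hh4 hρ hB)
  obtain ⟨K, hK, HK⟩ := hΦ.norm_le
  have hlow : ∀ h ∈ Set.Ioc 0 h₀, ∀ z, Real.exp (-K) ≤ ‖ellipticSymbol τ h (ρ h) (B h) z‖ :=
    fun h hh z => by
      rw [ellipticSymbol, Complex.norm_exp]
      refine Real.exp_le_exp.2 ?_
      have h1 := (Complex.abs_re_le_norm (phase τ h (ρ h) (B h) z)).trans (HK h hh z)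
      rw [mul_one] at h1
      exact (abs_le.1 h1).1
  refine ⟨_, _, _, hc.isSymbol, hc'.isSymbol, hs.isSymbol, fun h hh f x => ?_,
    ⟨Real.exp (-K), Real.exp_pos _, fun h hh x ξ => hlow h hh (x, ξ)⟩,
    ⟨Real.exp (-K) * (1 / 2), by positivity, fun h hh x ξ => ?_⟩⟩
  · exact conjugation_of_symbol_identity h (ρ h) (B h) (hΦ.1 h hh)
      (c := fun x ξ => ellipticSymbol τ h (ρ h) (B h) (x, ξ))
      (c' := fun x ξ => ellipticSymbol τ h (ρ h) (B h) (x, ξ) * ellipticFactor h (ρ h) (B h) (x, ξ))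
      (s := fun x ξ => ellipticSymbol τ h (ρ h) (B h) (x, ξ)
        * remainderFactor β τ h (ρ h) (B h) (x, ξ))
      (fun _ _ => rfl)
      (hc.exists_bound hh) (hc'.1 h hh) (hc'.exists_bound hh) (hs.1 h hh) (hs.exists_bound hh)
      (fun x => ((h ^ (1 + β) * (bracket x)⁻¹ : ℝ) : ℂ))
      (fun x η => ellipticSymbol_identity hh.1 (hB.1 h hh) (x, η)) f x
  · rw [norm_mul]
    refine mul_le_mul (hlow h hh _) ?_ (by norm_num) (norm_nonneg _)
    have h1 := norm_parametrix_mul_sum_le hlam hh.1 (hρ h hh) ξ hM0 (hBM h hh x)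
    have h2 : ‖2 * (h : ℂ) * (parametrix h (ρ h) ξ *
        ∑ j, ((ξ j : ℂ) + h * ρ h j) * B h x j)‖ ≤ 1 / 2 := by
      rw [norm_mul, norm_mul, Complex.norm_ofNat, Complex.norm_real, Real.norm_of_nonneg hh.1.le]
      calc 2 * h * ‖parametrix h (ρ h) ξ * ∑ j, ((ξ j : ℂ) + h * ρ h j) * B h x j‖
          ≤ 2 * h₀ * (150750 * n ^ 2 * M) := by
            have h3 := hh.2
            have h4 : 0 ≤ h₀ := hh.1.le.trans h3
            gcongr
        _ = h₀ * (2 * (150750 * n ^ 2 * M)) := by ring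
        _ ≤ 1 / 2 := hM
    have h3 := norm_sub_le_norm_add (1 : ℂ) (2 * (h : ℂ) * (parametrix h (ρ h) ξ *
        ∑ j, ((ξ j : ℂ) + h * ρ h j) * B h x j))
    rw [norm_one] at h3
    exact (by linarith : (1 : ℝ) / 2 ≤ _).trans h3

end SemiclassicalConjugation

theorem mainTheorem4 (n : ℕ) (hn : 3 ≤ n) (lam : ℝ) (hlam : 0 < lam)
    (A : EuclideanSpace ℝ (Fin n) → EuclideanSpace ℂ (Fin n)) (hAcont : Continuous A)
    (ε : ℝ) (hε : 0 < ε)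
    (hAdecay : ∃ K : ℝ, ∀ x, ‖A x‖ ≤ K * SemiclassicalConjugation.bracket x ^ (-1 - ε))
    (χ : EuclideanSpace ℝ (Fin n) → ℝ) (hχsmooth : ContDiff ℝ ∞ χ)
    (hχsupp : HasCompactSupport χ) (hχrange : ∀ x, 0 ≤ χ x ∧ χ x ≤ 1)
    (hχint : ∫ x, χ x = 1)
    (σ₀ σ : ℝ) (hσ₀ : 0 < σ₀) (hσ₀σ : σ₀ < σ) (hσ : σ < 1 / 3) :
    ∃ β : ℝ, 0 < β ∧ ∃ h₀ : ℝ, 0 < h₀ ∧ h₀ ≤ 1 ∧ h₀ ^ 2 * lam < 1 ∧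
      ∀ ρ : ℝ → EuclideanSpace ℂ (Fin n),
        (∀ h ∈ Set.Ioc 0 h₀, SemiclassicalConjugation.IsFrequency lam h (ρ h)) →
        ∃ c c' s : ℝ → EuclideanSpace ℝ (Fin n) → EuclideanSpace ℝ (Fin n) → ℂ,
          SemiclassicalConjugation.IsSymbol h₀ 0 σ c ∧
          SemiclassicalConjugation.IsSymbol h₀ 0 σ c' ∧
          SemiclassicalConjugation.IsSymbol h₀ 0 σ s ∧
          (∀ h ∈ Set.Ioc 0 h₀, ∀ (f : 𝓢(EuclideanSpace ℝ (Fin n), ℂ))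
            (x : EuclideanSpace ℝ (Fin n)),
            SemiclassicalConjugation.opP h (ρ h)
                (SemiclassicalConjugation.Op h (c h) f) x
              + (h : ℂ) * SemiclassicalConjugation.opQ h (ρ h)
                (SemiclassicalConjugation.sharp χ σ₀ h A)
                (SemiclassicalConjugation.Op h (c h) f) x =
            SemiclassicalConjugation.Op h (c' h)
                (SemiclassicalConjugation.opP h (ρ h) f) x
              + ((h ^ (1 + β) * (SemiclassicalConjugation.bracket x)⁻¹ : ℝ) : ℂ) *
                SemiclassicalConjugation.Op h (s h) f x) ∧
          SemiclassicalConjugation.IsEllipticSymbol h₀ c ∧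
          SemiclassicalConjugation.IsEllipticSymbol h₀ c' := by
  open SemiclassicalConjugation in
  -- the decay exponent may be lowered to `ε' ≤ 1`
  obtain ⟨ε', hε', hε'1, hε'le⟩ : ∃ ε' : ℝ, 0 < ε' ∧ ε' ≤ 1 ∧ ε' ≤ ε :=
    ⟨min ε 1, lt_min hε one_pos, min_le_right _ _, min_le_left _ _⟩
  have hdecay : ∃ K : ℝ, ∀ x, ‖A x‖ ≤ K * bracket x ^ (-1 - ε') := by
    obtain ⟨K, hK⟩ := hAdecay
    refine ⟨|K|, fun x => (hK x).trans ?_⟩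
    have h1 : bracket x ^ (-1 - ε) ≤ bracket x ^ (-1 - ε') :=
      Real.rpow_le_rpow_of_exponent_le (one_le_bracket x) (by linarith)
    exact mul_le_mul (le_abs_self K) h1 (Real.rpow_nonneg (bracket_pos x).le _) (abs_nonneg K)
  have hB : ∀ {h₀ : ℝ}, h₀ ≤ 1 → SymbolBound h₀ σ₀ (fun _ x => bracket x ^ (-1 - ε'))
      (fun h => sharp χ σ₀ h A) := fun hh₀ =>
    symbolBound_sharp hAcont hε' hdecay hχsmooth hχsupp hσ₀ hh₀
  -- the bound `M` of `A^♯` is fixed on `(0, 1]`, before `h₀` and the frequencies are chosen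
  obtain ⟨M, hM, HM⟩ := (hB le_rfl).norm_le
  have hBM : ∀ h ∈ Set.Ioc (0 : ℝ) 1, ∀ x, ‖sharp χ σ₀ h A x‖ ≤ M := fun h hh x =>
    (HM h hh x).trans (mul_le_of_le_one_right hM
      (Real.rpow_le_one_of_one_le_of_nonpos (one_le_bracket x) (by linarith)))
  -- with `h₀ = 1 / (1 + N)` both `h₀² λ ≤ 1/4` and the smallness of `c̃ / c - 1` hold
  set N : ℝ := 4 * lam + 4 * (150750 * n ^ 2 * M) with hN
  have hN1 : 4 * lam ≤ N := by
    have : (0 : ℝ) ≤ 150750 * n ^ 2 * M := by positivity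
    rw [hN]; linarith
  have hN2 : 4 * (150750 * n ^ 2 * M) ≤ N := by rw [hN]; linarith
  have hN0 : 0 < 1 + N := by linarith
  have hle1 : (1 + N)⁻¹ ≤ 1 := inv_le_one_of_one_le₀ (by linarith)
  have hpos : 0 < (1 + N)⁻¹ := inv_pos.2 hN0
  have hmul : (1 + N)⁻¹ * N ≤ 1 := by
    rw [inv_mul_le_iff₀ hN0]; linarith
  have hlam4 : (1 + N)⁻¹ * (4 * lam) ≤ 1 :=
    (mul_le_mul_of_nonneg_left hN1 hpos.le).trans hmul
  have hsq : ∀ h ∈ Set.Ioc 0 (1 + N)⁻¹, h ^ 2 * lam ≤ 1 / 4 := fun h hh => by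
    have h1 : h ^ 2 ≤ (1 + N)⁻¹ := by nlinarith [hh.1, hh.2]
    nlinarith
  have hτ : 0 < σ - σ₀ := by linarith
  refine ⟨min ((σ - σ₀) * ε' / 8) (1 - 3 * σ), lt_min (by positivity) (by linarith),
    (1 + N)⁻¹, hpos, hle1, (hsq _ ⟨hpos, le_rfl⟩).trans_lt (by norm_num), fun ρ hρ => ?_⟩
  have hσe : σ₀ + (σ - σ₀) = σ := by ring
  have key := exists_conjugation (min_le_left ((σ - σ₀) * ε' / 8) (1 - 3 * σ))
    (by rw [hσe]; exact min_le_right _ _) hle1 hε' hε'1 hσ₀.le hτ.le hlam hsq (hB hle1) hM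
    (fun h hh x => hBM h ⟨hh.1, hh.2.trans hle1⟩ x)
    (by have := (mul_le_mul_of_nonneg_left hN2 hpos.le).trans hmul; linarith) hρ
  rw [hσe] at key
  exact key
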